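/- \textbf{Proposition.} Let $0<\alpha<1$, $a(x)=|x|^\alpha$, and consider on $\mathbb R_t\times\mathbb R^2_{x,y}$ the $3\times3$ system $$L_a=\partial_t+\begin{pmatrix}0&\partial_x+x\,a\,\partial_y&x\,\partial_y\\ \partial_x-x\,a\,\partial_y&0&0\\ x(1+a^2)\,\partial_y&0&0\end{pmatrix},$$ that is $L_a=\partial_t+A_1\partial_x+A_2(x)\partial_y$, with symbol $A(x,\xi,\eta)=\xi A_1+\eta A_2(x)$. (i) \emph{$L_a$ has $C^\alpha$ symmetrizers.} There is a matrix $S(t,x,y,\xi,\eta)$ such that, for every $R>0$, on the set $\{|x|<R,\ (\xi,\eta)\neq0\}$: $S$ is bounded, homogeneous of degree $0$ in $(\xi,\eta)$, Hermitian and uniformly positive definite, $S\,A$ is Hermitian, and $S$ is uniformly Hölder continuous of order $\alpha$ on $\{|x|<R\}\times\{\xi^2+\eta^2=1\}$. (ii) \emph{Nevertheless the Cauchy problem for $L_a$ is ill posed in $L^2$.} For no $T>0$ is the Cauchy problem well posed in $L^2$ on $[0,T]$. Here well posed means: there is a constant $C$ such that for all $U_0\in L^2(\mathbb R^2;\mathbb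 C^3)$ and $f\in L^1([0,T];L^2)$ there is a unique $U\in C^0([0,T];L^2)$ with $L_aU=f$ in the sense of distributions on $(0,T)\times\mathbb R^2$ and $U(0)=U_0$, and it satisfies $\|U(t)\|_{L^2}\le C\|U_0\|_{L^2}+C\int_0^t\|f(s)\|_{L^2}\,ds$ for $t\in[0,T]$. Moreover: \quad (a) there are exponentially growing solutions, with arbitrarily large rate: for every $\mu>0$ there is a $C^1$ solution $U$ of $L_aU=0$ on $\mathbb R\times\mathbb R^2$, with $U\in C^0(\mathbb R;L^2(\mathbb R^2))$, $U(0)\ne0$ and $\|U(t)\|_{L^2}\ge e^{\mu t}\|U(0)\|_{L^2}$ for all $t\ge0$; \quad (b) the ill-posedness is local: if $\Omega\subset\mathbb R\times\mathbb R^2$ is open and contains a point with $x=0$, there are no constants $C,\gamma_0$ such that $\gamma\|u\|_{L^2(\Omega)}\le C\|(L_a+\gamma)u\|_{L^2(\Omega)}$ for all $\gamma\ge\gamma_0$ and all $u\in C_0^\infty(\Omega;\mathbb C^3)$. Thus for no $\alpha\in(0,1)$ does the existence of $C^\alpha$ symmetrizers as in (i) imply $L^2$ well-posedness, or the local energy estimate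 in (b); in this sense the Lipschitz condition on symmetrizers is sharp. -/

import Mathlib

open MeasureTheory Set
open scoped NNReal ContDiff

noncomputable section

namespace HypSys

/-- The space `ℝᵈ`. -/
abbrev Sp (d : ℕ) := EuclideanSpace ℝ (Fin d)

/-- The space `ℂᴺ` with its Hermitian norm. -/
abbrev Vec (N : ℕ) := EuclideanSpace ℂ (Fin N)

/-- The space `L²(ℝᵈ; ℂᴺ)`. -/
abbrev L2 (d N : ℕ) := Lp (Vec N) 2 (volume : Measure (Sp d))

/-- The coefficients `A₁, …, A_d`, functions of `(t, x) ∈ ℝ × ℝᵈ`, of a first order system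
`L = ∂_t + ∑ⱼ Aⱼ(t, x) ∂_{xⱼ}`. -/
abbrev Coeffs (d N : ℕ) := Fin d → ℝ × Sp d → Matrix (Fin N) (Fin N) ℂ

variable {d N : ℕ}

/-- `∂_t u`. -/
def dt (u : ℝ × Sp d → Vec N) (p : ℝ × Sp d) : Vec N :=
  fderiv ℝ u p (1, 0)

/-- `∂_{xⱼ} u`. -/
def dx (j : Fin d) (u : ℝ × Sp d → Vec N) (p : ℝ × Sp d) : Vec N :=
  fderiv ℝ u p (0, EuclideanSpace.single j 1)

/-- `L u = ∂_t u + ∑ⱼ Aⱼ ∂_{xⱼ} u`. -/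
def op (A : Coeffs d N) (u : ℝ × Sp d → Vec N) (p : ℝ × Sp d) : Vec N :=
  dt u p + ∑ j, Matrix.toEuclideanLin (A j p) (dx j u p)

/-- The formal adjoint `L* φ = - ∂_t φ - ∑ⱼ ∂_{xⱼ} (Aⱼ* φ)`. -/
def opAdj (A : Coeffs d N) (φ : ℝ × Sp d → Vec N) (p : ℝ × Sp d) : Vec N :=
  -dt φ p - ∑ j, dx j (fun q => Matrix.toEuclideanLin (A j q).conjTranspose (φ q)) p

/-- The symbol `A(t, x, ξ) = ∑ⱼ ξⱼ Aⱼ(t, x)`. -/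
def symbol (A : Coeffs d N) (p : ℝ × Sp d) (ξ : Sp d) : Matrix (Fin N) (Fin N) ℂ :=
  ∑ j, ((ξ j : ℝ) : ℂ) • A j p

/-- `S(t, x, ξ)` is a microlocal symmetrizer for `L = ∂_t + ∑ⱼ Aⱼ ∂_{xⱼ}` over the set `Ω` of
points `(t, x)`: it is bounded, homogeneous of degree `0` in `ξ ≠ 0`, Hermitian, uniformly positive
definite, and `S(t, x, ξ) A(t, x, ξ)` is Hermitian. -/
structure IsMicrolocalSymmetrizer (A : Coeffs d N) (Ω : Set (ℝ × Sp d))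
    (S : ℝ × Sp d → Sp d → Matrix (Fin N) (Fin N) ℂ) : Prop where
  bounded : ∃ M : ℝ, ∀ p ∈ Ω, ∀ ξ : Sp d, ξ ≠ 0 → ∀ i j, ‖S p ξ i j‖ ≤ M
  homogeneous : ∀ p ∈ Ω, ∀ ξ : Sp d, ξ ≠ 0 → ∀ r : ℝ, 0 < r → S p (r • ξ) = S p ξ
  hermitian : ∀ p ∈ Ω, ∀ ξ : Sp d, ξ ≠ 0 → (S p ξ).IsHermitian
  coercive : ∃ c : ℝ, 0 < c ∧ ∀ p ∈ Ω, ∀ ξ : Sp d, ξ ≠ 0 → ∀ v : Vec N,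
    c * ‖v‖ ^ 2 ≤ (inner ℂ v (Matrix.toEuclideanLin (S p ξ) v)).re
  symmetrizes : ∀ p ∈ Ω, ∀ ξ : Sp d, ξ ≠ 0 → (S p ξ * symbol A p ξ).IsHermitian

/-- `S` is Hölder continuous of order `α` in `(t, x, ξ)`, uniformly for `(t, x) ∈ Ω` and `ξ` in
the unit sphere. -/
def IsHolderSymbol (α : ℝ≥0) (Ω : Set (ℝ × Sp d))
    (S : ℝ × Sp d → Sp d → Matrix (Fin N) (Fin N) ℂ) : Prop :=
  ∃ K : ℝ≥0, ∀ i j, HolderOnWith K α (fun q : (ℝ × Sp d) × Sp d => S q.1 q.2 i j)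
    (Ω ×ˢ Metric.sphere (0 : Sp d) 1)

/-- `u ∈ C⁰([0, T]; L²)` is a solution of `L u = f` on `(0, T) × ℝᵈ` in the sense of distributions,
with `u(0) = u₀`. -/
structure IsSolution (A : Coeffs d N) (T : ℝ) (u₀ : L2 d N) (f u : ℝ → L2 d N) : Prop where
  cont : ContinuousOn u (Icc 0 T)
  initial : u 0 = u₀
  weak : ∀ φ : ℝ × Sp d → Vec N, ContDiff ℝ ∞ φ → HasCompactSupport φ →
    tsupport φ ⊆ Ioo 0 T ×ˢ univ →
    ∫ t in Ioo 0 T, ∫ x, inner ℂ (opAdj A φ (t, x)) (u t x) =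
      ∫ t in Ioo 0 T, ∫ x, inner ℂ (φ (t, x)) (f t x)

/-- The Cauchy problem for `L` is well posed in `L²` on `[0, T]`: for all `u₀ ∈ L²` and
`f ∈ L¹([0, T]; L²)` there is a unique solution `u ∈ C⁰([0, T]; L²)`, and it satisfies
`‖u(t)‖ ≤ C ‖u₀‖ + C ∫₀ᵗ ‖f(s)‖ ds` with `C` independent of `u₀` and `f`. -/
def L2WellPosed (A : Coeffs d N) (T : ℝ) : Prop :=
  ∃ C : ℝ, ∀ (u₀ : L2 d N) (f : ℝ → L2 d N), IntegrableOn f (Icc 0 T) →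
    ∃ u : ℝ → L2 d N, IsSolution A T u₀ f u ∧
      (∀ t ∈ Icc 0 T, ‖u t‖ ≤ C * ‖u₀‖ + C * ∫ s in Ioc 0 t, ‖f s‖) ∧
      ∀ v : ℝ → L2 d N, IsSolution A T u₀ f v → EqOn v u (Icc 0 T)

/-- The local `L²` energy estimate on an open set `Ω` of points `(t, x)`: there are `C` and `γ₀`
with `γ ‖u‖ ≤ C ‖(L + γ) u‖` (norms of `L²(Ω)`) for all `γ ≥ γ₀` and `u ∈ C₀^∞(Ω)`. -/
def LocalL2Estimate (A : Coeffs d N) (Ω : Set (ℝ × Sp d)) : Prop :=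
  ∃ C γ₀ : ℝ, ∀ γ : ℝ, γ₀ ≤ γ → ∀ u : ℝ × Sp d → Vec N, ContDiff ℝ ∞ u →
    HasCompactSupport u → tsupport u ⊆ Ω →
    γ * √(∫ p in Ω, ‖u p‖ ^ 2) ≤ C * √(∫ p in Ω, ‖op A u p + γ • u p‖ ^ 2)

/-- The `3 × 3` system in the space variables `(x, y) = (x₀, x₁)`:
`∂_t + [[0, ∂_x + x a ∂_y, x ∂_y], [∂_x - x a ∂_y, 0, 0], [x (1 + a²) ∂_y, 0, 0]]`, `a = a(x)`. -/
def exampleSystem (a : ℝ → ℝ) : Coeffs 2 3 :=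
  fun j p =>
    let x : ℝ := p.2 0
    (![!![0, 1, 0;
          1, 0, 0;
          0, 0, 0],
       !![0, x * a x, x;
          -(x * a x), 0, 0;
          x * (1 + a x ^ 2), 0, 0]] j : Matrix (Fin 3) (Fin 3) ℝ).map Complex.ofReal

end HypSys

end

/-!
The matrix `A₁ ξ + A₂ η` of the example is symmetrized, with `p = ξ` and `q = x η`, by a block
diagonal matrix consisting of `1` and of a positive `2 × 2` matrix of determinant `1`, whose
entries are polynomials in `a = |x|^α` and in the two quotients `p q / (p² + q²)` and
`q² / (p² + q²)`. These quotients are discontinuous at `x = ξ = 0` only, where their variation is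
of order `1 / |x|`. In the symmetrizer they always come with a factor `a`, and `|x|^α` times such
a function is Hölder continuous of order `α` (`abs_rpow_mul_sub_le`,
`isMicrolocalSymmetrizer_example`, `isHolderSymbol_example`).

The instability comes from a conjugation to a harmonic oscillator. For a mode
`e^{λ t + i η y} P(x)` the last two equations of the system give `P` in terms of its first
component `λ u`, and in the first equation the terms quadratic in `a` cancel, which leaves
`-u'' + η² x² u + i η (1 + α) |x|^α u = -λ² u`.
With `s = η^{1/2} x` and `ε = (1 + α) η^{-α/2}` this is
`-u'' + s² u + i ε |s|^α u = (1 + δ) u`, `-λ² = η (1 + δ)`.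
The ground state energy `1` of the oscillator is moved by `δ = i ε c + O(ε²)`, where `c > 0` is
the mean value of `|s|^α` for the Gaussian density. Hence `Re λ` is of order `η^{1/2} ε`, that is
`η^{(1-α)/2}`, and tends to infinity with `η` since `α < 1`. Instead of perturbation theory of
unbounded operators, the ansatz `u = exp (-s²/2 - ∫₀ˢ v)` is used. It leads to a Riccati equation
for a bounded function `v`, which is solved by the inverse function theorem (`exists_riccati`);
this provides a family of modes which is continuous in `η`, with Gaussian bounds
(`exists_growing_modes`).

The local energy estimate extends to `C¹` functions by mollification. It is violated by the modes,
multiplied by `e^{-γ t}`, `γ = Re λ`, and by a cut-off function, since `L + γ` then only falls on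
the cut-off (`not_localL2Estimate`). The integral of the modes over an interval of large
frequencies `η` is a `C¹` solution on the whole space, and by Plancherel's formula in `y` its `L²`
norm grows at least like `e^{μ t}` if `Re λ ≥ μ` on this interval (`exists_growing_solution`).
Such a solution is also a solution in the sense of distributions; if the Cauchy problem were well
posed it would be the only one with its initial data, and its growth would contradict the energy
estimate as soon as `e^{μ T} > C` (`not_L2WellPosed`).
-/

/-! ### Hölder continuous symmetrizers -/

namespace HypSys

/-- The symmetrizer as a function of `a`, `p = ξ` and `q = x η`. It is block diagonal, `1` and a
`2 × 2` block `Q` of determinant `1` which maps the first column `(p - a q, (1 + a²) q)` of the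
symbol to its first row `(p + a q, q)`. At `p = q = 0` the quotients are `0` and `Q = 1`. -/
noncomputable def symmMatrix (a p q : ℝ) : Matrix (Fin 3) (Fin 3) ℝ :=
  !![1, 0, 0;
     0, 1 + 2 * a * (p * q / (p ^ 2 + q ^ 2)) + (3 * a ^ 2 + a ^ 4) * (q ^ 2 / (p ^ 2 + q ^ 2)),
       (2 * a + a ^ 3) * (q ^ 2 / (p ^ 2 + q ^ 2)) - a ^ 2 * (p * q / (p ^ 2 + q ^ 2));
     0, (2 * a + a ^ 3) * (q ^ 2 / (p ^ 2 + q ^ 2)) - a ^ 2 * (p * q / (p ^ 2 + q ^ 2)),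
       1 - 2 * a * (p * q / (p ^ 2 + q ^ 2)) + a ^ 2 * (q ^ 2 / (p ^ 2 + q ^ 2))]

/-- The symbol `ξ A₁ + η A₂` of the example as a function of `a`, `p = ξ` and `q = x η`. -/
noncomputable def symbMatrix (a p q : ℝ) : Matrix (Fin 3) (Fin 3) ℝ :=
  !![0, p + a * q, q;
     p - a * q, 0, 0;
     (1 + a ^ 2) * q, 0, 0]

lemma sq_add_sq_eq_zero {p q : ℝ} (h : p ^ 2 + q ^ 2 = 0) : p = 0 ∧ q = 0 := by
  constructor <;> nlinarith [sq_nonneg p, sq_nonneg q]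

lemma symmMatrix_mul_symbMatrix (a p q : ℝ) :
    (symmMatrix a p q * symbMatrix a p q).transpose = symmMatrix a p q * symbMatrix a p q := by
  by_cases h : p ^ 2 + q ^ 2 = 0
  · obtain ⟨rfl, rfl⟩ := sq_add_sq_eq_zero h
    ext i j
    fin_cases i <;> fin_cases j <;>
      simp [symmMatrix, symbMatrix, Matrix.mul_apply, Fin.sum_univ_three]
  · ext i j
    fin_cases i <;> fin_cases j <;>
      simp [symmMatrix, symbMatrix, Matrix.mul_apply, Fin.sum_univ_three] <;>
      field_simp <;> ring

lemma sq_div_le_one (p q : ℝ) : |q ^ 2 / (p ^ 2 + q ^ 2)| ≤ 1 := by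
  rw [abs_of_nonneg (by positivity)]
  exact div_le_one_of_le₀ (by nlinarith [sq_nonneg p]) (by positivity)

lemma mul_div_le_one (p q : ℝ) : |p * q / (p ^ 2 + q ^ 2)| ≤ 1 := by
  rw [abs_div, abs_of_nonneg (by positivity : 0 ≤ p ^ 2 + q ^ 2)]
  refine div_le_one_of_le₀ ?_ (by positivity)
  rw [abs_le]
  constructor <;> nlinarith [sq_nonneg (p + q), sq_nonneg (p - q)]

lemma symmMatrix_det (a p q : ℝ) :
    symmMatrix a p q 1 1 * symmMatrix a p q 2 2 - symmMatrix a p q 1 2 ^ 2 = 1 := by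
  by_cases h : p ^ 2 + q ^ 2 = 0
  · obtain ⟨rfl, rfl⟩ := sq_add_sq_eq_zero h
    simp [symmMatrix]
  · simp [symmMatrix]
    field_simp
    ring

lemma symmMatrix_trace_pos (a p q : ℝ) : 0 < symmMatrix a p q 1 1 + symmMatrix a p q 2 2 := by
  have h0 : 0 ≤ q ^ 2 / (p ^ 2 + q ^ 2) := by positivity
  have : symmMatrix a p q 1 1 + symmMatrix a p q 2 2
      = 2 + (4 * a ^ 2 + a ^ 4) * (q ^ 2 / (p ^ 2 + q ^ 2)) := by
    simp [symmMatrix]; ring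
  rw [this]; positivity

lemma symmMatrix_trace_le {a p q M : ℝ} (ha : |a| ≤ M) :
    symmMatrix a p q 1 1 + symmMatrix a p q 2 2 ≤ 2 + (4 * M ^ 2 + M ^ 4) := by
  have h0 : 0 ≤ q ^ 2 / (p ^ 2 + q ^ 2) := by positivity
  have h1 : q ^ 2 / (p ^ 2 + q ^ 2) ≤ 1 := (le_abs_self _).trans (sq_div_le_one p q)
  have h2 : a ^ 2 ≤ M ^ 2 := by rw [← sq_abs]; gcongr
  have h4 : a ^ 4 ≤ M ^ 4 := by
    calc a ^ 4 = (a ^ 2) ^ 2 := by ring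
      _ ≤ (M ^ 2) ^ 2 := by gcongr
      _ = M ^ 4 := by ring
  have : symmMatrix a p q 1 1 + symmMatrix a p q 2 2
      = 2 + (4 * a ^ 2 + a ^ 4) * (q ^ 2 / (p ^ 2 + q ^ 2)) := by
    simp [symmMatrix]; ring
  rw [this]
  have : (4 * a ^ 2 + a ^ 4) * (q ^ 2 / (p ^ 2 + q ^ 2)) ≤ (4 * a ^ 2 + a ^ 4) * 1 := by gcongr
  linarith

lemma abs_symmMatrix_le {a M : ℝ} (ha0 : 0 ≤ a) (ha1 : a ≤ M) (p q : ℝ) (i j : Fin 3) :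
    |symmMatrix a p q i j| ≤ 1 + 2 * M + 3 * M ^ 2 + M ^ 3 + M ^ 4 := by
  have h1 := sq_div_le_one p q
  have h2 := mul_div_le_one p q
  have hM : 0 ≤ M := ha0.trans ha1
  have e2 : a ^ 2 ≤ M ^ 2 := by gcongr
  have e3 : a ^ 3 ≤ M ^ 3 := by gcongr
  have e4 : a ^ 4 ≤ M ^ 4 := by gcongr
  have p2 : 0 ≤ a ^ 2 := by positivity
  have p3 : 0 ≤ a ^ 3 := by positivity
  have p4 : 0 ≤ a ^ 4 := by positivity
  have key : ∀ c u : ℝ, 0 ≤ c → |u| ≤ 1 → -c ≤ c * u ∧ c * u ≤ c := by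
    intro c u hc hu
    have := abs_le.1 hu
    constructor <;> nlinarith
  rw [symmMatrix]
  generalize p * q / (p ^ 2 + q ^ 2) = σ at *
  generalize q ^ 2 / (p ^ 2 + q ^ 2) = θ at *
  obtain ⟨k1, k1'⟩ := key a σ ha0 h2
  obtain ⟨k2, k2'⟩ := key (a ^ 2) σ p2 h2
  obtain ⟨k3, k3'⟩ := key (a ^ 2) θ p2 h1
  obtain ⟨k4, k4'⟩ := key (a ^ 4) θ p4 h1
  obtain ⟨k5, k5'⟩ := key a θ ha0 h1
  obtain ⟨k6, k6'⟩ := key (a ^ 3) θ p3 h1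
  rw [abs_le]
  fin_cases i <;> fin_cases j <;> simp <;> constructor <;> linarith

/-- A symmetric `2 × 2` matrix `Q` of determinant `1` satisfies `tr Q • Q = 1 + Q²`. -/
lemma sq_add_sq_le_trace_mul {A B D : ℝ} (h : A * D - B ^ 2 = 1) (x y : ℝ) :
    x ^ 2 + y ^ 2 ≤ (A + D) * (A * x ^ 2 + 2 * B * x * y + D * y ^ 2) := by
  have : (A + D) * (A * x ^ 2 + 2 * B * x * y + D * y ^ 2) =
      (A * D - B ^ 2) * (x ^ 2 + y ^ 2) + (A * x + B * y) ^ 2 + (B * x + D * y) ^ 2 := by ring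
  rw [this, h]
  nlinarith [sq_nonneg (A * x + B * y), sq_nonneg (B * x + D * y)]

/-- The symmetrizer of the example system. -/
noncomputable def exampleSymmetrizer (α : ℝ) (P : ℝ × Sp 2) (ξ : Sp 2) :
    Matrix (Fin 3) (Fin 3) ℂ :=
  (symmMatrix (|P.2 0| ^ α) (ξ 0) (P.2 0 * ξ 1)).map Complex.ofReal

lemma symbol_exampleSystem (a : ℝ → ℝ) (P : ℝ × Sp 2) (ξ : Sp 2) :
    symbol (exampleSystem a) P ξ =
      (symbMatrix (a (P.2 0)) (ξ 0) (P.2 0 * ξ 1)).map Complex.ofReal := by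
  ext i j
  fin_cases i <;> fin_cases j <;>
    simp [symbol, exampleSystem, symbMatrix, Fin.sum_univ_two] <;> ring

lemma re_inner_symmMatrix (a p q : ℝ) (v : Vec 3) :
    (inner ℂ v (Matrix.toEuclideanLin ((symmMatrix a p q).map Complex.ofReal) v)).re =
      ‖v 0‖ ^ 2 + ((symmMatrix a p q 1 1 * (v 1).re ^ 2 +
        2 * symmMatrix a p q 1 2 * (v 1).re * (v 2).re + symmMatrix a p q 2 2 * (v 2).re ^ 2) +
        (symmMatrix a p q 1 1 * (v 1).im ^ 2 +
        2 * symmMatrix a p q 1 2 * (v 1).im * (v 2).im + symmMatrix a p q 2 2 * (v 2).im ^ 2)) := by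
  have h00 : symmMatrix a p q 0 0 = 1 := rfl
  have h01 : symmMatrix a p q 0 1 = 0 := rfl
  have h02 : symmMatrix a p q 0 2 = 0 := rfl
  have h10 : symmMatrix a p q 1 0 = 0 := rfl
  have h20 : symmMatrix a p q 2 0 = 0 := rfl
  have h21 : symmMatrix a p q 2 1 = symmMatrix a p q 1 2 := rfl
  simp only [PiLp.inner_apply, Fin.sum_univ_three, Matrix.toLpLin_apply, Matrix.mulVec,
    dotProduct, Matrix.map_apply, h00, h01, h02, h10, h20, h21, RCLike.inner_apply,
    Complex.sq_norm, Complex.normSq_apply]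
  simp
  ring

lemma isMicrolocalSymmetrizer_example {α : ℝ} (hα : 0 < α) {R : ℝ} (hR : 0 < R) :
    IsMicrolocalSymmetrizer (exampleSystem fun x => |x| ^ α) {p | |p.2 0| < R}
      (exampleSymmetrizer α) where
  bounded := by
    refine ⟨1 + 2 * R ^ α + 3 * (R ^ α) ^ 2 + (R ^ α) ^ 3 + (R ^ α) ^ 4, ?_⟩
    intro P hP ξ _ i j
    have hP' : |P.2 0| < R := hP
    simp only [exampleSymmetrizer, Matrix.map_apply, Complex.norm_real, Real.norm_eq_abs]
    exact abs_symmMatrix_le (by positivity) (by gcongr) _ _ i j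
  homogeneous := by
    intro P _ ξ _ r hr
    have hr2 : r ^ 2 ≠ 0 := by positivity
    have h1 : ∀ p q : ℝ, (r * p) * (r * q) / ((r * p) ^ 2 + (r * q) ^ 2)
        = p * q / (p ^ 2 + q ^ 2) := fun p q => by
      rw [show (r * p) * (r * q) = r ^ 2 * (p * q) by ring,
        show (r * p) ^ 2 + (r * q) ^ 2 = r ^ 2 * (p ^ 2 + q ^ 2) by ring,
        mul_div_mul_left _ _ hr2]
    have h2 : ∀ p q : ℝ, (r * q) ^ 2 / ((r * p) ^ 2 + (r * q) ^ 2)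
        = q ^ 2 / (p ^ 2 + q ^ 2) := fun p q => by
      rw [show (r * q) ^ 2 = r ^ 2 * q ^ 2 by ring,
        show (r * p) ^ 2 + r ^ 2 * q ^ 2 = r ^ 2 * (p ^ 2 + q ^ 2) by ring,
        mul_div_mul_left _ _ hr2]
    have h3 : P.2 0 * (r * ξ 1) = r * (P.2 0 * ξ 1) := by ring
    simp only [exampleSymmetrizer, symmMatrix, PiLp.smul_apply, smul_eq_mul, h3, h1, h2]
  hermitian := by
    intro P _ ξ _
    ext i j
    fin_cases i <;> fin_cases j <;> simp [exampleSymmetrizer, symmMatrix]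
  coercive := by
    set τ : ℝ := 2 + (4 * (R ^ α) ^ 2 + (R ^ α) ^ 4) with hτ
    have hτ1 : 1 ≤ τ := by rw [hτ]; nlinarith [sq_nonneg (R ^ α), sq_nonneg ((R ^ α) ^ 2)]
    refine ⟨τ⁻¹, by positivity, ?_⟩
    intro P hP ξ _ v
    have hP' : |P.2 0| < R := hP
    have ha : |(|P.2 0| ^ α)| ≤ R ^ α := by
      rw [abs_of_nonneg (by positivity)]; gcongr
    rw [exampleSymmetrizer, re_inner_symmMatrix]
    set S := symmMatrix (|P.2 0| ^ α) (ξ 0) (P.2 0 * ξ 1) with hS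
    have hdet : S 1 1 * S 2 2 - S 1 2 ^ 2 = 1 := symmMatrix_det _ _ _
    have htr : S 1 1 + S 2 2 ≤ τ := symmMatrix_trace_le ha
    have htr0 : 0 < S 1 1 + S 2 2 := symmMatrix_trace_pos _ _ _
    have key : ∀ x y : ℝ, x ^ 2 + y ^ 2 ≤
        τ * (S 1 1 * x ^ 2 + 2 * S 1 2 * x * y + S 2 2 * y ^ 2) := by
      intro x y
      have h := sq_add_sq_le_trace_mul hdet x y
      have h0 : 0 ≤ S 1 1 * x ^ 2 + 2 * S 1 2 * x * y + S 2 2 * y ^ 2 := by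
        by_contra! hneg
        nlinarith [sq_nonneg x, sq_nonneg y]
      exact h.trans (by gcongr)
    have k1 := key (v 1).re (v 2).re
    have k2 := key (v 1).im (v 2).im
    rw [inv_mul_le_iff₀ (by positivity), EuclideanSpace.norm_sq_eq, Fin.sum_univ_three]
    have e : ∀ z : ℂ, ‖z‖ ^ 2 = z.re ^ 2 + z.im ^ 2 := fun z => by
      rw [Complex.sq_norm, Complex.normSq_apply]; ring
    have k0 : ‖v 0‖ ^ 2 ≤ τ * ‖v 0‖ ^ 2 := by nlinarith [sq_nonneg ‖v 0‖]
    rw [e (v 1), e (v 2), mul_add, mul_add]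
    linarith
  symmetrizes := by
    intro P _ ξ _
    rw [symbol_exampleSystem, exampleSymmetrizer]
    have e : ∀ A B : Matrix (Fin 3) (Fin 3) ℝ,
        A.map Complex.ofReal * B.map Complex.ofReal = (A * B).map Complex.ofReal := fun A B =>
      (Matrix.map_mul (f := Complex.ofRealHom)).symm
    rw [e, Matrix.IsHermitian, ← Matrix.conjTranspose_map _ (fun x => by simp),
      Matrix.conjTranspose_eq_transpose_of_trivial, symmMatrix_mul_symbMatrix]

/-! ### The Hölder estimate -/

lemma abs_mul_sub_mul_le (p q p' q' : ℝ) :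
    |q * p' - q' * p| ≤ (|p - p'| + |q - q'|) * √(p' ^ 2 + q' ^ 2) := by
  have h1 : |p'| ≤ √(p' ^ 2 + q' ^ 2) := Real.abs_le_sqrt (by nlinarith [sq_nonneg q'])
  have h2 : |q'| ≤ √(p' ^ 2 + q' ^ 2) := Real.abs_le_sqrt (by nlinarith [sq_nonneg p'])
  calc |q * p' - q' * p| = |(q - q') * p' - (p - p') * q'| := by ring_nf
    _ ≤ |(q - q') * p'| + |(p - p') * q'| := abs_sub _ _
    _ = |q - q'| * |p'| + |p - p'| * |q'| := by rw [abs_mul, abs_mul]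
    _ ≤ |q - q'| * √(p' ^ 2 + q' ^ 2) + |p - p'| * √(p' ^ 2 + q' ^ 2) := by gcongr
    _ = _ := by ring

/-- A quotient of a product of the form `(q p' - q' p) m`, `|m| ≤ |(p, q)| |(p', q')|`, by
`|(p, q)|² |(p', q')|²`: the common bound for the variations of `q² / (p² + q²)` and
`p q / (p² + q²)`. -/
lemma abs_div_le_of_wedge {p q p' q' m : ℝ} (h : 0 < p ^ 2 + q ^ 2) (h' : 0 < p' ^ 2 + q' ^ 2)
    (hm : m ^ 2 ≤ (p ^ 2 + q ^ 2) * (p' ^ 2 + q' ^ 2)) :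
    |(q * p' - q' * p) * m / ((p ^ 2 + q ^ 2) * (p' ^ 2 + q' ^ 2))| ≤
      (|p - p'| + |q - q'|) / √(p ^ 2 + q ^ 2) := by
  set ρ := p ^ 2 + q ^ 2
  set ρ' := p' ^ 2 + q' ^ 2
  have hs : 0 < √ρ := Real.sqrt_pos.2 h
  have hs' : 0 < √ρ' := Real.sqrt_pos.2 h'
  have hm' : |m| ≤ √ρ * √ρ' := by
    rw [← Real.sqrt_mul h.le]; exact Real.abs_le_sqrt hm
  have hw := abs_mul_sub_mul_le p q p' q'
  rw [abs_div, abs_of_pos (mul_pos h h'), div_le_div_iff₀ (mul_pos h h') hs, abs_mul]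
  have e1 : √ρ * √ρ = ρ := Real.mul_self_sqrt h.le
  have e2 : √ρ' * √ρ' = ρ' := Real.mul_self_sqrt h'.le
  calc |q * p' - q' * p| * |m| * √ρ
      ≤ ((|p - p'| + |q - q'|) * √ρ') * (√ρ * √ρ') * √ρ := by gcongr
    _ = (|p - p'| + |q - q'|) * ((√ρ * √ρ) * (√ρ' * √ρ')) := by ring
    _ = _ := by rw [e1, e2]

lemma abs_sq_div_sub_le {p q p' q' : ℝ} (h : 0 < p ^ 2 + q ^ 2) (h' : 0 < p' ^ 2 + q' ^ 2) :
    |q ^ 2 / (p ^ 2 + q ^ 2) - q' ^ 2 / (p' ^ 2 + q' ^ 2)| ≤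
      (|p - p'| + |q - q'|) / √(p ^ 2 + q ^ 2) := by
  convert abs_div_le_of_wedge (m := q * p' + q' * p) h h' ?_ using 2
  · field_simp; ring
  · nlinarith [sq_nonneg (p * p' - q * q')]

lemma abs_mul_div_sub_le {p q p' q' : ℝ} (h : 0 < p ^ 2 + q ^ 2) (h' : 0 < p' ^ 2 + q' ^ 2) :
    |p * q / (p ^ 2 + q ^ 2) - p' * q' / (p' ^ 2 + q' ^ 2)| ≤
      (|p - p'| + |q - q'|) / √(p ^ 2 + q ^ 2) := by
  convert abs_div_le_of_wedge (m := p * p' - q * q') h h' ?_ using 2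
  · field_simp; ring
  · nlinarith [sq_nonneg (p * q' + q * p')]

lemma abs_rpow_sub_rpow_le {α : ℝ} (h0 : 0 < α) (h1 : α < 1) (x y : ℝ) :
    |(|x| ^ α - |y| ^ α)| ≤ |x - y| ^ α := by
  wlog h : |y| ≤ |x| generalizing x y
  · rw [abs_sub_comm, abs_sub_comm x y]; exact this y x (le_of_not_ge h)
  have h2 : |y| ^ α ≤ |x| ^ α := by gcongr
  rw [abs_of_nonneg (by linarith)]
  have h3 : |x| ≤ |x - y| + |y| := by
    calc |x| = |(x - y) + y| := by ring_nf
      _ ≤ _ := abs_add_le _ _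
  have h4 : |x| ^ α ≤ (|x - y| + |y|) ^ α := by gcongr
  have h5 := Real.rpow_add_le_add_rpow (abs_nonneg (x - y)) (abs_nonneg y) h0.le h1.le
  linarith

/-- If a function of `x` (and of other variables) is bounded by `1`, and its values `f`, `f'` at two
points of distance `h` differ by at most `K h / |x|`, then its product with `|x|^α` is Hölder
continuous of order `α`: for `|x| ≤ 2 h` both values of the product are `O(h^α)`, and otherwise
`h / |x| ≤ (h / |x|)^α`. -/
lemma abs_rpow_mul_sub_le {α : ℝ} (h0 : 0 < α) (h1 : α < 1) {K h x x' f f' : ℝ}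
    (hK : 1 ≤ K) (hf : |f| ≤ 1) (hf' : |f'| ≤ 1) (hx : |x - x'| ≤ h)
    (hff : x ≠ 0 → x' ≠ 0 → |f - f'| * |x| ≤ K * h ∧ |f - f'| * |x'| ≤ K * h) :
    |(|x| ^ α * f - |x'| ^ α * f')| ≤ 4 * K * h ^ α := by
  wlog hle : |x'| ≤ |x| generalizing x x' f f'
  · rw [abs_sub_comm]
    refine this hf' hf (by rwa [abs_sub_comm]) (fun a b => ?_) (le_of_not_ge hle)
    rw [abs_sub_comm]; exact (hff b a).symm
  have hh : 0 ≤ h := (abs_nonneg _).trans hx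
  have hhα : 0 ≤ h ^ α := by positivity
  have hxα : 0 ≤ |x| ^ α := by positivity
  have hx'α : 0 ≤ |x'| ^ α := by positivity
  have hle' : |x'| ^ α ≤ |x| ^ α := by gcongr
  by_cases hc : |x| ≤ 2 * h
  · have h3 : |x| ^ α ≤ 2 * h ^ α := by
      calc |x| ^ α ≤ (2 * h) ^ α := by gcongr
        _ = 2 ^ α * h ^ α := Real.mul_rpow (by norm_num) hh
        _ ≤ 2 ^ (1 : ℝ) * h ^ α := by gcongr; norm_num
        _ = _ := by norm_num
    calc |(|x| ^ α * f - |x'| ^ α * f')| ≤ |(|x| ^ α * f)| + |(|x'| ^ α * f')| := abs_sub _ _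
      _ = |x| ^ α * |f| + |x'| ^ α * |f'| := by
          rw [abs_mul, abs_mul, abs_of_nonneg hxα, abs_of_nonneg hx'α]
      _ ≤ |x| ^ α * 1 + |x| ^ α * 1 := by gcongr
      _ ≤ 4 * 1 * h ^ α := by linarith
      _ ≤ _ := by gcongr
  · push Not at hc
    have hx0 : 0 < |x| := by linarith
    have hx'0 : x' ≠ 0 := by
      rintro rfl
      rw [sub_zero] at hx
      linarith
    have h3 := (hff (abs_pos.1 hx0) hx'0).1
    have h4 : |f - f'| ≤ K * (h / |x|) ^ α := by
      have h5 : |f - f'| ≤ K * (h / |x|) := by rw [← mul_div_assoc, le_div_iff₀ hx0]; exact h3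
      refine h5.trans ?_
      have h6 : h / |x| ≤ 1 := by rw [div_le_one hx0]; linarith
      have : h / |x| ≤ (h / |x|) ^ α :=
        Real.self_le_rpow_of_le_one (by positivity) h6 h1.le
      gcongr
    have h5 : |x| ^ α * |f - f'| ≤ K * h ^ α := by
      rw [Real.div_rpow hh hx0.le] at h4
      have hp : 0 < |x| ^ α := by positivity
      calc |x| ^ α * |f - f'| ≤ |x| ^ α * (K * (h ^ α / |x| ^ α)) := by gcongr
        _ = _ := by field_simp
    have h6 : |(|x| ^ α - |x'| ^ α)| ≤ h ^ α :=
      (abs_rpow_sub_rpow_le h0 h1 x x').trans (by gcongr)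
    calc |(|x| ^ α * f - |x'| ^ α * f')|
        = |(|x| ^ α * (f - f') + (|x| ^ α - |x'| ^ α) * f')| := by ring_nf
      _ ≤ |(|x| ^ α * (f - f'))| + |((|x| ^ α - |x'| ^ α) * f')| := abs_add_le _ _
      _ = |x| ^ α * |f - f'| + |(|x| ^ α - |x'| ^ α)| * |f'| := by
          rw [abs_mul, abs_mul, abs_of_nonneg hxα]
      _ ≤ K * h ^ α + h ^ α * 1 := by gcongr
      _ ≤ 4 * K * h ^ α := by nlinarith

/-- `f` is bounded and uniformly Hölder continuous of order `α` on `s`. -/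
def BddHolderOn {X : Type*} [PseudoMetricSpace X] (α : ℝ) (s : Set X) (f : X → ℝ) : Prop :=
  ∃ B, 0 ≤ B ∧ (∀ x ∈ s, |f x| ≤ B) ∧ ∀ x ∈ s, ∀ y ∈ s, |f x - f y| ≤ B * dist x y ^ α

namespace BddHolderOn

variable {X : Type*} [PseudoMetricSpace X] {α : ℝ} {s : Set X} {f g : X → ℝ}

lemma const (c : ℝ) : BddHolderOn α s (fun _ => c) :=
  ⟨|c|, abs_nonneg c, fun _ _ => le_rfl, fun x _ y _ => by simp; positivity⟩

lemma add (hf : BddHolderOn α s f) (hg : BddHolderOn α s g) :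
    BddHolderOn α s (fun x => f x + g x) := by
  obtain ⟨B, hB, hf1, hf2⟩ := hf
  obtain ⟨C, hC, hg1, hg2⟩ := hg
  refine ⟨B + C, by positivity,
    fun x hx => (abs_add_le _ _).trans (add_le_add (hf1 x hx) (hg1 x hx)),
    fun x hx y hy => ?_⟩
  calc |f x + g x - (f y + g y)| = |(f x - f y) + (g x - g y)| := by ring_nf
    _ ≤ _ := abs_add_le _ _
    _ ≤ B * dist x y ^ α + C * dist x y ^ α := add_le_add (hf2 x hx y hy) (hg2 x hx y hy)
    _ = _ := by ring

lemma mul (hf : BddHolderOn α s f) (hg : BddHolderOn α s g) :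
    BddHolderOn α s (fun x => f x * g x) := by
  obtain ⟨B, hB, hf1, hf2⟩ := hf
  obtain ⟨C, hC, hg1, hg2⟩ := hg
  refine ⟨2 * (B * C), by positivity, fun x hx => ?_, fun x hx y hy => ?_⟩
  · rw [abs_mul]
    calc |f x| * |g x| ≤ B * C := by gcongr; exacts [hf1 x hx, hg1 x hx]
      _ ≤ _ := by nlinarith [mul_nonneg hB hC]
  · have hd : 0 ≤ dist x y ^ α := by positivity
    calc |f x * g x - f y * g y| = |(f x - f y) * g x + f y * (g x - g y)| := by ring_nf
      _ ≤ |(f x - f y) * g x| + |f y * (g x - g y)| := abs_add_le _ _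
      _ = |f x - f y| * |g x| + |f y| * |g x - g y| := by rw [abs_mul, abs_mul]
      _ ≤ (B * dist x y ^ α) * C + B * (C * dist x y ^ α) := by
          gcongr
          exacts [hf2 x hx y hy, hg1 x hx, hf1 y hy, hg2 x hx y hy]
      _ = _ := by ring

end BddHolderOn

/-- On the unit sphere in `ξ`, the vector `(p, q) = (ξ, x η)` has length at least
`|x| / (1 + R)`. -/
lemma abs_le_mul_sqrt {R x u v : ℝ} (hR : 0 < R) (hx : |x| < R) (huv : u ^ 2 + v ^ 2 = 1) :
    |x| ≤ (1 + R) * √(u ^ 2 + (x * v) ^ 2) := by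
  have hx2 : x ^ 2 < R ^ 2 := sq_lt_sq' (by linarith [neg_abs_le x]) (by linarith [le_abs_self x])
  have : |x| ≤ √((1 + R) ^ 2 * (u ^ 2 + (x * v) ^ 2)) := by
    apply Real.abs_le_sqrt
    have h1 : x ^ 2 = x ^ 2 * u ^ 2 + x ^ 2 * v ^ 2 := by rw [← mul_add, huv, mul_one]
    have h2 : x ^ 2 * u ^ 2 ≤ R ^ 2 * u ^ 2 := by gcongr
    have h3 : 0 ≤ (1 + 2 * R) * u ^ 2 := by positivity
    have h4 : 0 ≤ (2 * R + R ^ 2) * (x ^ 2 * v ^ 2) := by positivity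
    nlinarith
  rwa [Real.sqrt_mul (by positivity), Real.sqrt_sq (by positivity)] at this

/-- The products of `|x|^α` with the degree `0` homogeneous functions of `(p, q)` which are entries
of the symmetrizer are Hölder continuous. -/
lemma bddHolderOn_rpow_mul {α : ℝ} (h0 : 0 < α) (h1 : α < 1) {R : ℝ} (hR : 0 < R)
    (F : ℝ → ℝ → ℝ) (hF : ∀ p q, |F p q| ≤ 1)
    (hF' : ∀ p q p' q', 0 < p ^ 2 + q ^ 2 → 0 < p' ^ 2 + q' ^ 2 →
      |F p q - F p' q'| ≤ (|p - p'| + |q - q'|) / √(p ^ 2 + q ^ 2)) :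
    BddHolderOn α ({p : ℝ × Sp 2 | |p.2 0| < R} ×ˢ Metric.sphere (0 : Sp 2) 1)
      (fun z => |z.1.2 0| ^ α * F (z.2 0) (z.1.2 0 * z.2 1)) := by
  set K : ℝ := (1 + R) * (2 + R) with hK
  have hK1 : 1 ≤ K := by rw [hK]; nlinarith
  refine ⟨R ^ α + 4 * K, by positivity, ?_, ?_⟩
  · rintro ⟨⟨t, x⟩, ξ⟩ ⟨hx, hξ⟩
    have hx' : |x 0| < R := hx
    simp only
    rw [abs_mul, abs_of_nonneg (by positivity : 0 ≤ |x 0| ^ α)]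
    calc |x 0| ^ α * |F (ξ 0) (x 0 * ξ 1)| ≤ R ^ α * 1 := by gcongr; exact hF _ _
      _ ≤ _ := by linarith
  · rintro ⟨⟨t, x⟩, ξ⟩ ⟨hx, hξ⟩ ⟨⟨t', x'⟩, ξ'⟩ ⟨hx', hξ'⟩
    have hx : |x 0| < R := hx
    have hx' : |x' 0| < R := hx'
    have hs : ∀ ζ : Sp 2, ζ ∈ Metric.sphere (0 : Sp 2) 1 → ζ 0 ^ 2 + ζ 1 ^ 2 = 1 := by
      intro ζ hζ
      have h : ‖ζ‖ = 1 := by simpa using hζ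
      have h2 := EuclideanSpace.norm_sq_eq ζ
      rw [h, Fin.sum_univ_two] at h2
      simpa using h2.symm
    have hc : ∀ (y y' : Sp 2) (i : Fin 2), |y i - y' i| ≤ dist y y' := by
      intro y y' i
      rw [dist_eq_norm]
      exact PiLp.norm_apply_le (y - y') i
    set h := dist (((t, x), ξ) : (ℝ × Sp 2) × Sp 2) ((t', x'), ξ') with hh
    have hd1 : dist x x' ≤ h := (le_max_right _ _).trans (le_max_left _ _)
    have hd2 : dist ξ ξ' ≤ h := le_max_right _ _
    have hx0 := (hc x x' 0).trans hd1
    have hξ0 := (hc ξ ξ' 0).trans hd2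
    have hξ1 := (hc ξ ξ' 1).trans hd2
    have hh0 : 0 ≤ h := dist_nonneg
    have hsξ := hs ξ hξ
    have hsξ' := hs ξ' hξ'
    have hη : |ξ 1| ≤ 1 := abs_le_one_iff_mul_self_le_one.2 (by nlinarith [sq_nonneg (ξ 0)])
    -- the map `(x, ξ, η) ↦ (ξ, x η)` is Lipschitz on the strip
    have hpq : |ξ 0 - ξ' 0| + |x 0 * ξ 1 - x' 0 * ξ' 1| ≤ (2 + R) * h := by
      have : |x 0 * ξ 1 - x' 0 * ξ' 1| ≤ h + R * h := by
        calc |x 0 * ξ 1 - x' 0 * ξ' 1|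
            = |(x 0 - x' 0) * ξ 1 + x' 0 * (ξ 1 - ξ' 1)| := by ring_nf
          _ ≤ |(x 0 - x' 0) * ξ 1| + |x' 0 * (ξ 1 - ξ' 1)| := abs_add_le _ _
          _ = |x 0 - x' 0| * |ξ 1| + |x' 0| * |ξ 1 - ξ' 1| := by rw [abs_mul, abs_mul]
          _ ≤ h * 1 + R * h := by gcongr
          _ = _ := by ring
      linarith
    have hbd : ∀ {y : ℝ} {ζ : Sp 2} {D : ℝ}, y ≠ 0 → |y| < R → ζ 0 ^ 2 + ζ 1 ^ 2 = 1 →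
        D ≤ ((2 + R) * h) / √(ζ 0 ^ 2 + (y * ζ 1) ^ 2) →
        0 < ζ 0 ^ 2 + (y * ζ 1) ^ 2 → D * |y| ≤ K * h := by
      intro y ζ D hy0 hy hζ hD hpos
      have hsq := Real.sqrt_pos.2 hpos
      rw [le_div_iff₀ hsq] at hD
      have h3 := abs_le_mul_sqrt hR hy hζ
      rcases le_or_gt D 0 with hD0 | hD0
      · exact (mul_nonpos_of_nonpos_of_nonneg hD0 (abs_nonneg _)).trans (by positivity)
      · calc D * |y| ≤ D * ((1 + R) * √(ζ 0 ^ 2 + (y * ζ 1) ^ 2)) := by gcongr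
          _ = (1 + R) * (D * √(ζ 0 ^ 2 + (y * ζ 1) ^ 2)) := by ring
          _ ≤ (1 + R) * ((2 + R) * h) := by gcongr
          _ = K * h := by rw [hK]; ring
    have hpos : ∀ {y : ℝ} {ζ : Sp 2}, y ≠ 0 → ζ 0 ^ 2 + ζ 1 ^ 2 = 1 →
        0 < ζ 0 ^ 2 + (y * ζ 1) ^ 2 := by
      intro y ζ hy hζ
      by_contra! hneg
      obtain ⟨e0, e1⟩ := sq_add_sq_eq_zero (le_antisymm hneg (by positivity))
      have e2 : ζ 1 = 0 := (mul_eq_zero.1 e1).resolve_left hy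
      rw [e0, e2] at hζ
      norm_num at hζ
    refine (abs_rpow_mul_sub_le h0 h1 hK1 (hF _ _) (hF _ _) hx0 fun hy hy' => ⟨?_, ?_⟩).trans ?_
    · refine hbd hy hx hsξ ((hF' _ _ _ _ (hpos hy hsξ) (hpos hy' hsξ')).trans ?_) (hpos hy hsξ)
      gcongr
    · refine hbd hy' hx' hsξ' ?_ (hpos hy' hsξ')
      rw [abs_sub_comm]
      refine (hF' _ _ _ _ (hpos hy' hsξ') (hpos hy hsξ)).trans ?_
      rw [abs_sub_comm (ξ' 0), abs_sub_comm (x' 0 * ξ' 1)]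
      gcongr
    · have : 0 ≤ R ^ α := by positivity
      gcongr
      linarith

lemma isHolderSymbol_example {α : ℝ} (h0 : 0 < α) (h1 : α < 1) {R : ℝ} (hR : 0 < R) :
    IsHolderSymbol α.toNNReal {p | |p.2 0| < R} (exampleSymmetrizer α) := by
  set D := {p : ℝ × Sp 2 | |p.2 0| < R} ×ˢ Metric.sphere (0 : Sp 2) 1
  have Hσ := bddHolderOn_rpow_mul h0 h1 hR (fun p q => p * q / (p ^ 2 + q ^ 2)) mul_div_le_one
    fun p q p' q' => abs_mul_div_sub_le
  have Hθ := bddHolderOn_rpow_mul h0 h1 hR (fun p q => q ^ 2 / (p ^ 2 + q ^ 2)) sq_div_le_one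
    fun p q p' q' => abs_sq_div_sub_le
  have Ha := bddHolderOn_rpow_mul h0 h1 hR (fun _ _ => 1) (by simp)
    fun p q p' q' _ _ => by simp; positivity
  have key : ∀ i j, BddHolderOn α D (fun z => symmMatrix (|z.1.2 0| ^ α) (z.2 0)
      (z.1.2 0 * z.2 1) i j) := by
    intro i j
    have H22 : BddHolderOn α D _ :=
      ((BddHolderOn.const 1).add ((BddHolderOn.const (-2)).mul Hσ)).add (Ha.mul Hθ)
    have H12 : BddHolderOn α D _ := (((BddHolderOn.const 2).add (Ha.mul Ha)).mul Hθ).add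
      (((BddHolderOn.const (-1)).mul Ha).mul Hσ)
    have H11 : BddHolderOn α D _ := ((BddHolderOn.const 1).add ((BddHolderOn.const 2).mul Hσ)).add
      ((((BddHolderOn.const 3).mul Ha).add (Ha.mul (Ha.mul Ha))).mul Hθ)
    fin_cases i <;> fin_cases j
    · exact BddHolderOn.const 1
    · exact BddHolderOn.const 0
    · exact BddHolderOn.const 0
    · exact BddHolderOn.const 0
    · convert H11 using 2; simp [symmMatrix]; ring
    · convert H12 using 2; simp [symmMatrix]; ring
    · exact BddHolderOn.const 0
    · convert H12 using 2; simp [symmMatrix]; ring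
    · convert H22 using 2; simp [symmMatrix]; ring
  choose B hB _ hH using key
  refine ⟨∑ i, ∑ j, (B i j).toNNReal, fun i j => ?_⟩
  intro z hz w hw
  have hα : ((α.toNNReal : ℝ≥0) : ℝ) = α := Real.coe_toNNReal _ h0.le
  have h := hH i j z hz w hw
  have hle : (B i j).toNNReal ≤ ∑ i, ∑ j, (B i j).toNNReal :=
    (Finset.single_le_sum (f := fun j => (B i j).toNNReal) (fun _ _ => zero_le)
      (Finset.mem_univ j)).trans
      (Finset.single_le_sum (f := fun i => ∑ j, (B i j).toNNReal) (fun _ _ => zero_le)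
        (Finset.mem_univ i))
  rw [edist_nndist, edist_nndist, ← ENNReal.coe_rpow_of_nonneg _ (by positivity), ← ENNReal.coe_mul,
    ENNReal.coe_le_coe]
  refine le_trans ?_ (mul_le_mul_left hle _)
  rw [← NNReal.coe_le_coe]
  push_cast
  rw [hα, Real.coe_toNNReal _ (hB i j)]
  simpa [exampleSymmetrizer, Complex.dist_eq, ← Complex.ofReal_sub] using h

end HypSys

/-! ### A Riccati equation -/

namespace HypSys

open Filter Topology BoundedContinuousFunction

/-- The mean value of `g` for the Gaussian probability density `π^{-1/2} e^{-r²}`. -/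
noncomputable def gaussMean (g : ℝ → ℂ) : ℂ := (√Real.pi)⁻¹ • ∫ r, Real.exp (-r ^ 2) • g r

/-- The solution `v(s) = e^{s²} ∫_s^∞ e^{-r²} (g(r) - m) dr` of `v' = 2 s v - (g - m)`. It is
bounded at `-∞` too since `m` is the Gaussian mean of `g`. -/
noncomputable def riccatiInv (g : ℝ → ℂ) (s : ℝ) : ℂ :=
  Real.exp (s ^ 2) • ∫ r in Ioi s, Real.exp (-r ^ 2) • (g r - gaussMean g)

lemma integrable_exp_neg_sq : Integrable fun r : ℝ => Real.exp (-r ^ 2) := by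
  simpa using integrable_exp_neg_mul_sq (b := 1) one_pos

lemma integral_exp_neg_sq : ∫ r : ℝ, Real.exp (-r ^ 2) = √Real.pi := by
  simpa using integral_gaussian 1

lemma integrable_mul_exp_neg_sq : Integrable fun r : ℝ => r * Real.exp (-r ^ 2) := by
  simpa using integrable_mul_exp_neg_mul_sq (b := 1) one_pos

lemma integrable_abs_mul_exp_neg_sq : Integrable fun r : ℝ => |r| * Real.exp (-r ^ 2) := by
  simpa [abs_mul] using integrable_mul_exp_neg_sq.abs

lemma integral_Ioi_mul_exp_neg_sq (s : ℝ) :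
    ∫ r in Ioi s, r * Real.exp (-r ^ 2) = Real.exp (-s ^ 2) / 2 := by
  have hd : ∀ x ∈ Ici s, HasDerivAt (fun r : ℝ => -(Real.exp (-r ^ 2) / 2))
      (x * Real.exp (-x ^ 2)) x := by
    intro x _
    have h := (((hasDerivAt_pow 2 x).neg).exp.div_const 2).neg
    refine h.congr_deriv ?_
    simp
    ring
  have ht : Tendsto (fun r : ℝ => -(Real.exp (-r ^ 2) / 2)) atTop (𝓝 0) := by
    have h : Tendsto (fun r : ℝ => Real.exp (-r ^ 2)) atTop (𝓝 0) :=
      Real.tendsto_exp_neg_atTop_nhds_zero.comp (tendsto_pow_atTop two_ne_zero)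
    simpa using (h.div_const 2).neg
  rw [integral_Ioi_of_hasDerivAt_of_tendsto' hd integrable_mul_exp_neg_sq.integrableOn ht]
  ring

lemma integral_abs_mul_exp_neg_sq : ∫ r : ℝ, |r| * Real.exp (-r ^ 2) = 1 := by
  have h := integral_comp_abs (f := fun r : ℝ => r * Real.exp (-r ^ 2))
  simp only [sq_abs] at h
  rw [h, integral_Ioi_mul_exp_neg_sq]
  simp

lemma one_le_sqrt_pi : 1 ≤ √Real.pi := by
  rw [Real.one_le_sqrt]; linarith [Real.pi_gt_three]

lemma sqrt_pi_le_two : √Real.pi ≤ 2 := by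
  rw [Real.sqrt_le_left (by norm_num)]; linarith [Real.pi_le_four]

section growth

variable {g : ℝ → ℂ} {A B : ℝ}

lemma norm_exp_smul_le (hg : ∀ r, ‖g r‖ ≤ A + B * |r|) (r : ℝ) :
    ‖Real.exp (-r ^ 2) • g r‖ ≤ A * Real.exp (-r ^ 2) + B * (|r| * Real.exp (-r ^ 2)) := by
  rw [norm_smul, Real.norm_eq_abs, abs_of_pos (Real.exp_pos _)]
  calc Real.exp (-r ^ 2) * ‖g r‖ ≤ Real.exp (-r ^ 2) * (A + B * |r|) := by gcongr; exact hg r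
    _ = _ := by ring

lemma integrable_exp_smul (hc : Continuous g) (hg : ∀ r, ‖g r‖ ≤ A + B * |r|) :
    Integrable fun r : ℝ => Real.exp (-r ^ 2) • g r :=
  ((integrable_exp_neg_sq.const_mul A).add (integrable_abs_mul_exp_neg_sq.const_mul B)).mono'
    (Continuous.aestronglyMeasurable (by fun_prop))
    (Eventually.of_forall (norm_exp_smul_le hg))

lemma norm_gaussMean_le (hB : 0 ≤ B) (hg : ∀ r, ‖g r‖ ≤ A + B * |r|) :
    ‖gaussMean g‖ ≤ A + B := by
  have h1 : ‖∫ r : ℝ, Real.exp (-r ^ 2) • g r‖ ≤ A * √Real.pi + B := by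
    refine (norm_integral_le_of_norm_le ((integrable_exp_neg_sq.const_mul A).add
      (integrable_abs_mul_exp_neg_sq.const_mul B))
      (Eventually.of_forall (norm_exp_smul_le hg))).trans_eq ?_
    simp only [Pi.add_apply]
    rw [integral_add (integrable_exp_neg_sq.const_mul A)
      (integrable_abs_mul_exp_neg_sq.const_mul B), integral_const_mul, integral_const_mul,
      integral_exp_neg_sq, integral_abs_mul_exp_neg_sq, mul_one]
  have hp := one_le_sqrt_pi
  rw [gaussMean, norm_smul, norm_inv, Real.norm_eq_abs, abs_of_pos (by linarith),
    inv_mul_le_iff₀ (by linarith)]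
  nlinarith

lemma norm_sub_gaussMean_le (hB : 0 ≤ B) (hg : ∀ r, ‖g r‖ ≤ A + B * |r|) (r : ℝ) :
    ‖g r - gaussMean g‖ ≤ (A + (A + B)) + B * |r| := by
  have := norm_sub_le (g r) (gaussMean g)
  linarith [hg r, norm_gaussMean_le hB hg]

lemma integral_exp_smul_sub_gaussMean (hc : Continuous g) (hg : ∀ r, ‖g r‖ ≤ A + B * |r|) :
    ∫ r : ℝ, Real.exp (-r ^ 2) • (g r - gaussMean g) = 0 := by
  have hp : (√Real.pi) ≠ 0 := by linarith [one_le_sqrt_pi]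
  simp only [smul_sub]
  rw [integral_sub (integrable_exp_smul hc hg) (integrable_exp_neg_sq.smul_const _),
    integral_smul_const, integral_exp_neg_sq, gaussMean, smul_smul, mul_inv_cancel₀ hp, one_smul,
    sub_self]

/-- For `r ≥ s ≥ 0` one has `s² - r² ≤ -(r - s)²`. -/
lemma norm_exp_smul_integral_Ioi_le (hA : 0 ≤ A) (hB : 0 ≤ B)
    (hg : ∀ r, ‖g r‖ ≤ A + B * |r|) {s : ℝ} (hs : 0 ≤ s) :
    ‖Real.exp (s ^ 2) • ∫ r in Ioi s, Real.exp (-r ^ 2) • g r‖ ≤ 2 * A + B := by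
  have i1 : Integrable fun r : ℝ => A * Real.exp (-(r - s) ^ 2) :=
    (integrable_exp_neg_sq.comp_sub_right s).const_mul A
  have i2 : Integrable fun r : ℝ => B * Real.exp (s ^ 2) * (r * Real.exp (-r ^ 2)) :=
    integrable_mul_exp_neg_sq.const_mul _
  rw [← integral_smul]
  have hbd : ∀ r ∈ Ioi s, ‖Real.exp (s ^ 2) • (Real.exp (-r ^ 2) • g r)‖ ≤
      A * Real.exp (-(r - s) ^ 2) + B * Real.exp (s ^ 2) * (r * Real.exp (-r ^ 2)) := by
    intro r hr
    have hr' : s < r := hr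
    have hg' := hg r
    rw [abs_of_nonneg (by linarith)] at hg'
    rw [norm_smul, norm_smul, Real.norm_eq_abs, Real.norm_eq_abs, abs_of_pos (Real.exp_pos _),
      abs_of_pos (Real.exp_pos _)]
    have h1 : Real.exp (s ^ 2) * Real.exp (-r ^ 2) ≤ Real.exp (-(r - s) ^ 2) := by
      rw [← Real.exp_add]
      exact Real.exp_le_exp.2 (by nlinarith)
    calc Real.exp (s ^ 2) * (Real.exp (-r ^ 2) * ‖g r‖)
        ≤ Real.exp (s ^ 2) * (Real.exp (-r ^ 2) * (A + B * r)) := by gcongr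
      _ = A * (Real.exp (s ^ 2) * Real.exp (-r ^ 2)) +
          B * Real.exp (s ^ 2) * (r * Real.exp (-r ^ 2)) := by ring
      _ ≤ _ := by gcongr
  refine (norm_integral_le_of_norm_le (i1.add i2).integrableOn
    ((ae_restrict_iff' measurableSet_Ioi).2 (Eventually.of_forall hbd))).trans ?_
  simp only [Pi.add_apply]
  rw [integral_add i1.integrableOn i2.integrableOn, integral_const_mul, integral_const_mul,
    integral_Ioi_mul_exp_neg_sq]
  have h1 : ∫ r in Ioi s, Real.exp (-(r - s) ^ 2) ≤ 2 := by
    refine (setIntegral_le_integral (integrable_exp_neg_sq.comp_sub_right s)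
      (Eventually.of_forall fun r => (Real.exp_pos _).le)).trans ?_
    rw [integral_sub_right_eq_self (fun r : ℝ => Real.exp (-r ^ 2)) s, integral_exp_neg_sq]
    exact sqrt_pi_le_two
  have h2 : B * Real.exp (s ^ 2) * (Real.exp (-s ^ 2) / 2) = B / 2 := by
    rw [mul_assoc, ← mul_div_assoc, ← Real.exp_add, add_neg_cancel, Real.exp_zero]; ring
  rw [h2]
  nlinarith

lemma hasDerivAt_riccatiInv (hB : 0 ≤ B) (hc : Continuous g) (hg : ∀ r, ‖g r‖ ≤ A + B * |r|)
    (s : ℝ) : HasDerivAt (riccatiInv g) (2 * s * riccatiInv g s - (g s - gaussMean g)) s := by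
  set k : ℝ → ℂ := fun r => Real.exp (-r ^ 2) • (g r - gaussMean g) with hk
  have hkc : Continuous k := by fun_prop
  have hki : Integrable k :=
    integrable_exp_smul (by fun_prop) (norm_sub_gaussMean_le hB hg)
  have e : (fun s => ∫ r in Ioi s, k r) =
      fun s => (∫ r in Ioi 0, k r) - ∫ r in (0 : ℝ)..s, k r := by
    ext s
    rw [← intervalIntegral.integral_Ioi_sub_Ioi' hki.integrableOn hki.integrableOn]
    ring
  have hd : HasDerivAt (fun s => ∫ r in Ioi s, k r) (-k s) s := by
    rw [e]
    simpa using (intervalIntegral.integral_hasDerivAt_right (hkc.intervalIntegrable _ _)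
      (hkc.stronglyMeasurableAtFilter _ _) hkc.continuousAt).const_sub (∫ r in Ioi 0, k r)
  have h2 : HasDerivAt (fun s : ℝ => Real.exp (s ^ 2)) (Real.exp (s ^ 2) * (2 * s)) s := by
    simpa using (hasDerivAt_pow 2 s).exp
  refine (h2.smul hd).congr_deriv ?_
  have h3 : Real.exp (s ^ 2) • k s = g s - gaussMean g := by
    rw [hk]
    simp only
    rw [smul_smul, ← Real.exp_add, add_neg_cancel, Real.exp_zero, one_smul]
  have h4 : riccatiInv g s = Real.exp (s ^ 2) • ∫ r in Ioi s, k r := rfl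
  rw [smul_neg, h3, h4]
  simp only [Complex.real_smul]
  push_cast
  ring

lemma norm_riccatiInv_le (hA : 0 ≤ A) (hB : 0 ≤ B) (hc : Continuous g)
    (hg : ∀ r, ‖g r‖ ≤ A + B * |r|) (s : ℝ) : ‖riccatiInv g s‖ ≤ 4 * A + 3 * B := by
  have hbd := norm_sub_gaussMean_le hB hg
  rcases le_total 0 s with hs | hs
  · refine (norm_exp_smul_integral_Ioi_le (by positivity) hB hbd hs).trans (by linarith)
  · have hki : Integrable fun r : ℝ => Real.exp (-r ^ 2) • (g r - gaussMean g) :=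
      integrable_exp_smul (by fun_prop) hbd
    have h0 := integral_exp_smul_sub_gaussMean hc hg
    rw [← intervalIntegral.integral_Iic_add_Ioi (b := s) hki.integrableOn hki.integrableOn] at h0
    have h1 : ∫ r in Iic s, Real.exp (-r ^ 2) • (g r - gaussMean g) =
        ∫ r in Ioi (-s), Real.exp (-r ^ 2) • (g (-r) - gaussMean g) := by
      rw [← integral_comp_neg_Iic]
      simp
    rw [riccatiInv, eq_neg_of_add_eq_zero_right h0, h1, smul_neg, norm_neg, ← neg_sq s]
    refine (norm_exp_smul_integral_Ioi_le (g := fun r => g (-r) - gaussMean g)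
      (by positivity) hB (fun r => ?_) (neg_nonneg.2 hs)).trans
        (by linarith : 2 * (A + (A + B)) + B ≤ _)
    simpa using hbd (-r)

end growth

lemma norm_apply_le_add (f : ℝ →ᵇ ℂ) (r : ℝ) : ‖f r‖ ≤ ‖f‖ + 0 * |r| := by
  simpa using f.norm_coe_le_norm r

lemma gaussMean_add (f g : ℝ →ᵇ ℂ) : gaussMean (f + g) = gaussMean f + gaussMean g := by
  simp only [gaussMean, Pi.add_apply, smul_add]
  rw [integral_add (integrable_exp_smul f.continuous (norm_apply_le_add f))
    (integrable_exp_smul g.continuous (norm_apply_le_add g)), smul_add]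

lemma gaussMean_smul (c : ℝ) (f : ℝ →ᵇ ℂ) : gaussMean (c • f) = c • gaussMean f := by
  simp only [gaussMean, Pi.smul_apply, smul_comm _ c, integral_smul]

/-- The Gaussian mean as a bounded linear form on bounded continuous functions. -/
noncomputable def gaussMeanL : (ℝ →ᵇ ℂ) →L[ℝ] ℂ :=
  LinearMap.mkContinuous
    { toFun := fun f => gaussMean f
      map_add' := fun f g => gaussMean_add f g
      map_smul' := fun c f => gaussMean_smul c f } 1
    fun f => by simpa using norm_gaussMean_le le_rfl (norm_apply_le_add f)

/-- `riccatiInv` as a bounded operator on bounded continuous functions. -/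
noncomputable def riccatiInvL : (ℝ →ᵇ ℂ) →L[ℝ] (ℝ →ᵇ ℂ) :=
  LinearMap.mkContinuous
    { toFun := fun f => BoundedContinuousFunction.ofNormedAddCommGroup (riccatiInv f)
        (continuous_iff_continuousAt.2 fun s =>
          (hasDerivAt_riccatiInv le_rfl f.continuous (norm_apply_le_add f) s).continuousAt)
        (4 * ‖f‖ + 3 * 0)
        (norm_riccatiInv_le (norm_nonneg f) le_rfl f.continuous (norm_apply_le_add f))
      map_add' := fun f g => by
        ext s
        have hi : ∀ f : ℝ →ᵇ ℂ, Integrable fun r : ℝ => Real.exp (-r ^ 2) • (f r - gaussMean f) :=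
          fun f => integrable_exp_smul (by fun_prop)
            (norm_sub_gaussMean_le le_rfl (norm_apply_le_add f))
        simp only [BoundedContinuousFunction.coe_ofNormedAddCommGroup,
          BoundedContinuousFunction.coe_add, Pi.add_apply, riccatiInv, gaussMean_add]
        rw [← smul_add, ← integral_add (hi f).integrableOn (hi g).integrableOn]
        simp only [← smul_add]
        congr 2
        ext r
        ring_nf
      map_smul' := fun c f => by
        ext s
        simp only [BoundedContinuousFunction.coe_ofNormedAddCommGroup,
          BoundedContinuousFunction.coe_smul, riccatiInv, RingHom.id_apply]
        have : gaussMean (fun r => c • f r) = c • gaussMean f := gaussMean_smul c f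
        rw [this]
        simp only [← smul_sub, smul_comm _ c, integral_smul] }
    4 fun f => by
      rw [BoundedContinuousFunction.norm_le (by positivity)]
      intro s
      simpa using norm_riccatiInv_le (norm_nonneg f) le_rfl f.continuous (norm_apply_le_add f) s

lemma riccatiInvL_apply (f : ℝ →ᵇ ℂ) (s : ℝ) : riccatiInvL f s = riccatiInv f s := rfl

lemma gaussMeanL_apply (f : ℝ →ᵇ ℂ) : gaussMeanL f = gaussMean f := rfl

lemma norm_gaussMeanL_le (f : ℝ →ᵇ ℂ) : ‖gaussMeanL f‖ ≤ ‖f‖ := by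
  simpa [gaussMeanL_apply] using norm_gaussMean_le le_rfl (norm_apply_le_add f)

section power

variable {α : ℝ}

lemma abs_rpow_le_one_add (h0 : 0 < α) (h1 : α < 1) (r : ℝ) : |r| ^ α ≤ 1 + |r| := by
  rcases le_total |r| 1 with h | h
  · exact (Real.rpow_le_one (abs_nonneg r) h h0.le).trans (by linarith [abs_nonneg r])
  · calc |r| ^ α ≤ |r| ^ (1 : ℝ) := Real.rpow_le_rpow_of_exponent_le h h1.le
      _ ≤ _ := by rw [Real.rpow_one]; linarith

lemma continuous_abs_rpow (h0 : 0 < α) : Continuous fun r : ℝ => |r| ^ α :=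
  continuous_abs.rpow_const fun _ => Or.inr h0.le

lemma norm_ofReal_abs_rpow_le (h0 : 0 < α) (h1 : α < 1) (r : ℝ) :
    ‖((|r| ^ α : ℝ) : ℂ)‖ ≤ 1 + 1 * |r| := by
  rw [Complex.norm_real, Real.norm_eq_abs, abs_of_nonneg (by positivity), one_mul]
  exact abs_rpow_le_one_add h0 h1 r

lemma continuous_ofReal_abs_rpow (h0 : 0 < α) : Continuous fun r : ℝ => ((|r| ^ α : ℝ) : ℂ) :=
  Complex.continuous_ofReal.comp (continuous_abs_rpow h0)

lemma gaussMean_abs_rpow (h0 : 0 < α) (h1 : α < 1) :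
    ∃ c : ℝ, 0 < c ∧ gaussMean (fun r => ((|r| ^ α : ℝ) : ℂ)) = c := by
  refine ⟨(√Real.pi)⁻¹ * ∫ r : ℝ, Real.exp (-r ^ 2) * |r| ^ α, ?_, ?_⟩
  · have hp : 0 < √Real.pi := by linarith [one_le_sqrt_pi]
    refine mul_pos (inv_pos.2 hp) ?_
    have hcont : Continuous fun r : ℝ => Real.exp (-r ^ 2) * |r| ^ α := by
      have := continuous_abs_rpow h0
      fun_prop
    refine integral_pos_of_integrable_nonneg_nonzero hcont ?_ (fun r => by positivity)
      (x := 1) (by simp)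
    have h := (integrable_exp_smul (continuous_ofReal_abs_rpow h0)
      (norm_ofReal_abs_rpow_le h0 h1)).norm
    refine h.congr (Eventually.of_forall fun r => ?_)
    simp only [norm_smul, Complex.norm_real, Real.norm_eq_abs]
    rw [abs_of_pos (Real.exp_pos _), abs_of_nonneg (by positivity : 0 ≤ |r| ^ α)]
  · rw [gaussMean]
    push_cast
    rw [← integral_complex_ofReal]
    simp [Complex.real_smul]

/-- For small `ε` the Riccati equation `v' = 2 s v + v² - i ε |s|^α + δ` has a bounded solution on
`ℝ` for one value `δ = δ(ε)`, with `v` and `δ` continuous in `ε` and `Im δ ≥ κ ε`. With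
`T = riccatiInv` the equation becomes `v + T (v²) = i ε T (|·|^α)`, solvable by the inverse function
theorem in the space of bounded continuous functions; to first order in `ε`, `δ` is `i` times the
Gaussian mean of `ε |s|^α`. -/
theorem exists_riccati (h0 : 0 < α) (h1 : α < 1) :
    ∃ ε₁ : ℝ, 0 < ε₁ ∧ ∃ (v : ℝ → (ℝ →ᵇ ℂ)) (δ : ℝ → ℂ) (κ : ℝ), 0 < κ ∧
      ContinuousOn v (Icc 0 ε₁) ∧ ContinuousOn δ (Icc 0 ε₁) ∧ ∀ ε ∈ Icc 0 ε₁,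
        (∀ s, HasDerivAt (v ε)
          (2 * s * v ε s + v ε s ^ 2 - Complex.I * ε * (|s| ^ α : ℝ) + δ ε) s) ∧
        ‖v ε‖ ≤ 1 ∧ ‖δ ε‖ ≤ 1 / 2 ∧ κ * ε ≤ (δ ε).im := by
  obtain ⟨c, hc, hcm⟩ := gaussMean_abs_rpow h0 h1
  set p : ℝ → ℂ := fun r => ((|r| ^ α : ℝ) : ℂ) with hp
  have hpc : Continuous p := continuous_ofReal_abs_rpow h0
  have hpb : ∀ r, ‖p r‖ ≤ 1 + 1 * |r| := norm_ofReal_abs_rpow_le h0 h1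
  have hpd := hasDerivAt_riccatiInv zero_le_one hpc hpb
  let h : ℝ →ᵇ ℂ := BoundedContinuousFunction.ofNormedAddCommGroup (riccatiInv p)
    (continuous_iff_continuousAt.2 fun s => (hpd s).continuousAt) _
    (norm_riccatiInv_le zero_le_one zero_le_one hpc hpb)
  have hh : ∀ s, h s = riccatiInv p s := fun s => rfl
  let F : (ℝ →ᵇ ℂ) → (ℝ →ᵇ ℂ) := fun v => v + riccatiInvL (v * v)
  have hF : HasStrictFDerivAt F
      ((ContinuousLinearEquiv.refl ℝ (ℝ →ᵇ ℂ) : (ℝ →ᵇ ℂ) →L[ℝ] (ℝ →ᵇ ℂ))) 0 := by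
    have h2 := (hasStrictFDerivAt_id (𝕜 := ℝ) (0 : ℝ →ᵇ ℂ)).mul' (hasStrictFDerivAt_id (𝕜 := ℝ) 0)
    have h3 := (hasStrictFDerivAt_id (𝕜 := ℝ) (0 : ℝ →ᵇ ℂ)).add
      (riccatiInvL.hasStrictFDerivAt.comp (0 : ℝ →ᵇ ℂ) h2)
    refine h3.congr_fderiv ?_
    ext f : 1
    simp
  let Φ := hF.toOpenPartialHomeomorph F
  have hΦ0 : (0 : ℝ →ᵇ ℂ) ∈ Φ.source := hF.mem_toOpenPartialHomeomorph_source
  have hF0 : F 0 = 0 := by simp [F]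
  have hΦt : (0 : ℝ →ᵇ ℂ) ∈ Φ.target := by
    have := Φ.map_source hΦ0
    rwa [show Φ 0 = F 0 from rfl, hF0] at this
  have hΦs : Φ.symm 0 = 0 := by
    have := Φ.left_inv hΦ0
    rwa [show Φ 0 = F 0 from rfl, hF0] at this
  let y : ℝ → (ℝ →ᵇ ℂ) := fun ε => (Complex.I * ε) • h
  have hy : Continuous y := by fun_prop
  have hy0 : y 0 = 0 := by simp [y]
  let v : ℝ → (ℝ →ᵇ ℂ) := fun ε => Φ.symm (y ε)
  have hv0 : v 0 = 0 := by simp only [v, hy0, hΦs]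
  let δ : ℝ → ℂ := fun ε => Complex.I * ε * c - gaussMeanL (v ε * v ε)
  have ev1 : ∀ᶠ ε in 𝓝 (0 : ℝ), y ε ∈ Φ.target :=
    hy.continuousAt.eventually_mem (by rw [hy0]; exact Φ.open_target.mem_nhds hΦt)
  have hvc : ∀ ε, y ε ∈ Φ.target → ContinuousAt v ε := fun ε hε =>
    (Φ.continuousAt_symm hε).comp hy.continuousAt
  have hvn : ContinuousAt (fun ε => ‖v ε‖) 0 :=
    (hvc 0 (by rw [hy0]; exact hΦt)).norm
  set N := ‖riccatiInvL‖
  set H := ‖h‖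
  have small : ∀ q : ℝ, 0 < q → ∀ᶠ ε in 𝓝 (0 : ℝ), ‖v ε‖ < q := fun q hq =>
    hvn.eventually_lt continuousAt_const (by simp [hv0, hq])
  have ev2 := small 1 one_pos
  have ev3 := small (1 / (2 * (N + 1))) (by positivity)
  have ev4 := small (1 / 2) (by norm_num)
  have ev5 : ∀ᶠ ε in 𝓝 (0 : ℝ), ε < min (1 / (4 * c)) (c / (8 * (H ^ 2 + 1))) :=
    eventually_lt_nhds (by positivity)
  obtain ⟨r, hr, hball⟩ := Metric.eventually_nhds_iff.1
    (ev1.and (ev2.and (ev3.and (ev4.and ev5))))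
  have hall : ∀ ε ∈ Icc 0 (r / 2), y ε ∈ Φ.target ∧ ‖v ε‖ < 1 ∧ ‖v ε‖ < 1 / (2 * (N + 1)) ∧
      ‖v ε‖ < 1 / 2 ∧ ε < min (1 / (4 * c)) (c / (8 * (H ^ 2 + 1))) := fun ε hε =>
    hball (by rw [Real.dist_eq, sub_zero, abs_of_nonneg hε.1]; linarith [hε.2])
  have hvcon : ContinuousOn v (Icc 0 (r / 2)) := fun ε hε =>
    (hvc ε (hall ε hε).1).continuousWithinAt
  refine ⟨r / 2, by positivity, v, δ, c / 2, by positivity, hvcon, ?_, ?_⟩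
  · have : ContinuousOn (fun ε => gaussMeanL (v ε * v ε)) (Icc 0 (r / 2)) :=
      gaussMeanL.continuous.comp_continuousOn (hvcon.mul hvcon)
    exact ContinuousOn.sub (by fun_prop) this
  intro ε hε
  obtain ⟨e1, e2, e3, e4, e5⟩ := hall ε hε
  have heq : v ε + riccatiInvL (v ε * v ε) = y ε := Φ.right_inv e1
  have hε0 : 0 ≤ ε := hε.1
  -- `v = O(ε)` follows from the equation since `v` is small
  have hyn : ‖y ε‖ ≤ ε * H := by
    simp only [y, norm_smul, norm_mul, Complex.norm_I, Complex.norm_real, one_mul,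
      Real.norm_eq_abs, abs_of_nonneg hε0]
    exact le_rfl
  have hvv : ‖v ε * v ε‖ ≤ ‖v ε‖ * ‖v ε‖ := norm_mul_le _ _
  have hvε : ‖v ε‖ ≤ 2 * ε * H := by
    have hT : ‖riccatiInvL (v ε * v ε)‖ ≤ N * (‖v ε‖ * ‖v ε‖) :=
      (riccatiInvL.le_opNorm _).trans (by gcongr)
    have h2 : ‖v ε‖ ≤ ‖y ε‖ + ‖riccatiInvL (v ε * v ε)‖ := by
      rw [← heq]
      simpa using norm_sub_le (v ε + riccatiInvL (v ε * v ε)) (riccatiInvL (v ε * v ε))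
    have h3 : N * ‖v ε‖ ≤ 1 / 2 := by
      have hN : 0 ≤ N := norm_nonneg _
      rw [lt_div_iff₀ (by positivity)] at e3
      nlinarith [norm_nonneg (v ε)]
    have h4 : N * (‖v ε‖ * ‖v ε‖) ≤ 1 / 2 * ‖v ε‖ := by
      rw [← mul_assoc]; gcongr
    linarith
  have hm : ‖gaussMeanL (v ε * v ε)‖ ≤ ‖v ε‖ * ‖v ε‖ := (norm_gaussMeanL_le _).trans hvv
  have e5a : ε * c ≤ 1 / 4 := by
    have := (e5.trans_le (min_le_left _ _)).le
    rw [le_div_iff₀ (by positivity)] at this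
    linarith
  have e5b : ε * (8 * (H ^ 2 + 1)) ≤ c := by
    have := (e5.trans_le (min_le_right _ _)).le
    rwa [le_div_iff₀ (by positivity)] at this
  refine ⟨fun s => ?_, e2.le, ?_, ?_⟩
  · have hv : (v ε : ℝ → ℂ) =
        fun s => Complex.I * ε * riccatiInv p s - riccatiInv (v ε * v ε : ℝ →ᵇ ℂ) s := by
      ext s
      have h2 := DFunLike.congr_fun heq s
      simp only [BoundedContinuousFunction.coe_add, Pi.add_apply, riccatiInvL_apply, y,
        BoundedContinuousFunction.coe_smul, smul_eq_mul, hh] at h2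
      rw [← h2]; ring
    have hd := ((hpd s).const_mul (Complex.I * ε)).sub (hasDerivAt_riccatiInv le_rfl
      (v ε * v ε).continuous (norm_apply_le_add (v ε * v ε)) s)
    have hvs := congrFun hv s
    have hd' : HasDerivAt (v ε) (Complex.I * ε * (2 * s * riccatiInv p s - (p s - gaussMean p)) -
        (2 * s * riccatiInv (v ε * v ε : ℝ →ᵇ ℂ) s -
          ((v ε * v ε : ℝ →ᵇ ℂ) s - gaussMean (v ε * v ε : ℝ →ᵇ ℂ)))) s := by
      rw [hv]; exact hd
    refine hd'.congr_deriv ?_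
    have hsq : (v ε * v ε : ℝ →ᵇ ℂ) s = v ε s ^ 2 := by
      rw [BoundedContinuousFunction.mul_apply, sq]
    have hδ : δ ε = Complex.I * ε * c - gaussMean (v ε * v ε : ℝ →ᵇ ℂ) := rfl
    have hps : p s = (|s| ^ α : ℝ) := rfl
    rw [hcm, hδ, hsq, ← hps]
    linear_combination (-2 * (s : ℂ)) * hvs
  · calc ‖δ ε‖ ≤ ‖Complex.I * ε * c‖ + ‖gaussMeanL (v ε * v ε)‖ := norm_sub_le _ _
      _ ≤ ε * c + 1 / 4 := by
        gcongr
        · simp [abs_of_nonneg hε0, abs_of_pos hc]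
        · nlinarith [norm_nonneg (v ε)]
      _ ≤ 1 / 2 := by linarith
  · have him : (δ ε).im = ε * c - (gaussMeanL (v ε * v ε)).im := by
      simp [δ]
    have h2 : (gaussMeanL (v ε * v ε)).im ≤ (2 * ε * H) * (2 * ε * H) := by
      refine ((Complex.abs_im_le_norm _).trans' (le_abs_self _)).trans (hm.trans ?_)
      gcongr
    rw [him]
    have h3 : ε * (ε * (8 * (H ^ 2 + 1))) ≤ ε * c := by gcongr
    nlinarith [sq_nonneg ε]

end power

end HypSys

/-! ### Growing modes -/

namespace HypSys

open Filter Topology BoundedContinuousFunction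

lemma hasDerivAt_mul_abs_rpow {α : ℝ} (hα : 0 < α) (x : ℝ) :
    HasDerivAt (fun x : ℝ => x * |x| ^ α) ((1 + α) * |x| ^ α) x := by
  rcases eq_or_ne x 0 with rfl | hx
  · rw [abs_zero, Real.zero_rpow hα.ne', mul_zero, hasDerivAt_iff_tendsto_slope]
    have h : Tendsto (fun x : ℝ => |x| ^ α) (𝓝[≠] 0) (𝓝 0) := by
      have := (continuous_abs_rpow hα).tendsto 0
      rw [abs_zero, Real.zero_rpow hα.ne'] at this
      exact this.mono_left nhdsWithin_le_nhds
    refine h.congr' ?_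
    filter_upwards [self_mem_nhdsWithin] with y hy
    have hy' : y ≠ 0 := hy
    simp [slope_def_field]
    field_simp
  · have h1 := (hasDerivAt_id x).mul
      ((hasDerivAt_abs hx).rpow_const (p := α) (Or.inl (abs_ne_zero.2 hx)))
    refine h1.congr_deriv ?_
    have h2 : |x| ^ α = |x| ^ (α - 1) * |x| := by
      rw [← Real.rpow_add_one (abs_ne_zero.2 hx)]; ring_nf
    have h3 : x * (SignType.sign x : ℝ) = |x| := by rw [mul_comm]; exact sign_mul_self x
    simp only [id]
    linear_combination (-α) * h2 + (α * |x| ^ (α - 1)) * h3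

lemma hasDerivAt_mul_one_add_abs_rpow_sq {α : ℝ} (hα : 0 < α) (x : ℝ) :
    HasDerivAt (fun x : ℝ => x * (1 + (|x| ^ α) ^ 2)) (1 + (1 + 2 * α) * (|x| ^ α) ^ 2) x := by
  have e : ∀ x : ℝ, (|x| ^ α) ^ 2 = |x| ^ (2 * α) := fun x => by
    rw [← Real.rpow_natCast, ← Real.rpow_mul (abs_nonneg x)]; ring_nf
  have h := (hasDerivAt_id x).add (hasDerivAt_mul_abs_rpow (α := 2 * α) (by positivity) x)
  rw [e]
  refine (h.congr_of_eventuallyEq (Eventually.of_forall fun y => ?_))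
  simp only [e, Pi.add_apply, id]
  ring

lemma hasDerivAt_vec3 {f g h : ℝ → ℂ} {f' g' h' : ℂ} {x : ℝ} (hf : HasDerivAt f f' x)
    (hg : HasDerivAt g g' x) (hh : HasDerivAt h h' x) :
    HasDerivAt (fun x => (!₂[f x, g x, h x] : Vec 3)) !₂[f', g', h'] x := by
  have h1 : HasDerivAt (fun x => (![f x, g x, h x] : Fin 3 → ℂ)) ![f', g', h'] x := by
    rw [hasDerivAt_pi]
    intro i
    fin_cases i
    · exact hf
    · exact hg
    · exact hh
  exact (PiLp.continuousLinearEquiv 2 ℝ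
    (fun _ : Fin 3 => ℂ)).symm.hasFDerivAt.comp_hasDerivAt x h1

lemma continuous_vec3 {X : Type*} [TopologicalSpace X] {f g h : X → ℂ} (hf : Continuous f)
    (hg : Continuous g) (hh : Continuous h) : Continuous fun x => (!₂[f x, g x, h x] : Vec 3) := by
  have h1 : Continuous fun x => (![f x, g x, h x] : Fin 3 → ℂ) := by
    refine continuous_pi fun i => ?_
    fin_cases i
    · exact hf
    · exact hg
    · exact hh
  exact (PiLp.continuousLinearEquiv 2 ℝ (fun _ : Fin 3 => ℂ)).symm.continuous.comp h1

lemma norm_vec3_le (a b c : ℂ) : ‖(!₂[a, b, c] : Vec 3)‖ ≤ ‖a‖ + ‖b‖ + ‖c‖ := by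
  refine abs_le_of_sq_le_sq' ?_ (by positivity) |>.2
  rw [EuclideanSpace.norm_sq_eq, Fin.sum_univ_three]
  simp only [Matrix.cons_val]
  nlinarith [mul_nonneg (norm_nonneg a) (norm_nonneg b), mul_nonneg (norm_nonneg a) (norm_nonneg c),
    mul_nonneg (norm_nonneg b) (norm_nonneg c)]

/-- The perturbed Gaussian `exp (-s²/2 - ∫₀ˢ v)` at `s = b x`. -/
noncomputable def pertGaussian (v : ℝ →ᵇ ℂ) (b x : ℝ) : ℂ :=
  Complex.exp (-((b * x : ℝ) : ℂ) ^ 2 / 2 - ∫ r in (0 : ℝ)..(b * x), v r)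

/-- The amplitude of the mode `e^{l t + i b² y}`. Its first component is `l` times the perturbed
Gaussian, the others are then given by the last two equations of the system. -/
noncomputable def profile (α : ℝ) (v : ℝ →ᵇ ℂ) (l : ℂ) (b x : ℝ) : Vec 3 :=
  !₂[l * pertGaussian v b x,
    (b * (b * x + v (b * x)) + Complex.I * b ^ 2 * (x * |x| ^ α : ℝ)) * pertGaussian v b x,
    -(Complex.I * b ^ 2 * (x * (1 + (|x| ^ α) ^ 2) : ℝ)) * pertGaussian v b x]

/-- The `x`-derivative of `profile`, simplified by means of the Riccati equation. -/
noncomputable def profileDeriv (α : ℝ) (v : ℝ →ᵇ ℂ) (l : ℂ) (b x : ℝ) : Vec 3 :=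
  !₂[-(l * (b * (b * x + v (b * x)))) * pertGaussian v b x,
    -(l ^ 2 + b ^ 4 * x ^ 2 + Complex.I * b ^ 3 * (x * |x| ^ α : ℝ) * (b * x + v (b * x))) *
      pertGaussian v b x,
    (-(Complex.I * b ^ 2 * (1 + (1 + 2 * α) * (|x| ^ α) ^ 2 : ℝ)) +
      Complex.I * b ^ 3 * (x * (1 + (|x| ^ α) ^ 2) : ℝ) * (b * x + v (b * x))) *
      pertGaussian v b x]

lemma hasDerivAt_pertGaussian (v : ℝ →ᵇ ℂ) (b x : ℝ) :
    HasDerivAt (pertGaussian v b) (-(b * (b * x + v (b * x))) * pertGaussian v b x) x := by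
  have h1 : HasDerivAt (fun x : ℝ => b * x) b x := by
    simpa using (hasDerivAt_id x).const_mul b
  have h2 : HasDerivAt (fun x : ℝ => ∫ r in (0 : ℝ)..(b * x), v r) (b • v (b * x)) x :=
    (intervalIntegral.integral_hasDerivAt_right (v.continuous.intervalIntegrable _ _)
      (v.continuous.stronglyMeasurableAtFilter _ _) v.continuous.continuousAt).scomp x h1
  have h3 := ((((h1.ofReal_comp).pow 2).neg.div_const 2).sub h2).cexp
  refine h3.congr_deriv ?_
  simp only [pertGaussian, Complex.real_smul, Pi.sub_apply, Pi.neg_apply, Pi.pow_apply]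
  push_cast
  ring

/-- The hypothesis `hε` says that `ε |s|^α` is the function `(x |x|^α)'` in the variable
`s = b x`. -/
lemma hasDerivAt_profile {α : ℝ} (hα : 0 < α) {v : ℝ →ᵇ ℂ} {l δ : ℂ} {b ε : ℝ}
    (hl : l ^ 2 = -(b ^ 2 * (1 + δ))) (hε : ∀ x, ε * |b * x| ^ α = (1 + α) * |x| ^ α)
    (hv : ∀ s, HasDerivAt v (2 * s * v s + v s ^ 2 - Complex.I * ε * (|s| ^ α : ℝ) + δ) s) (x : ℝ) :
    HasDerivAt (profile α v l b) (profileDeriv α v l b x) x := by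
  have hG := hasDerivAt_pertGaussian v b x
  have h1 : HasDerivAt (fun x : ℝ => b * x) b x := by
    simpa using (hasDerivAt_id x).const_mul b
  have h1c : HasDerivAt (fun x : ℝ => (b * x : ℂ)) b x := by
    simpa using h1.ofReal_comp
  have hvb := (hv (b * x)).scomp x h1
  have ha := (hasDerivAt_mul_abs_rpow hα x).ofReal_comp
  have ha2 := (hasDerivAt_mul_one_add_abs_rpow_sq hα x).ofReal_comp
  have hεx : (ε : ℂ) * ((|b * x| ^ α : ℝ) : ℂ) = (1 + α) * ((|x| ^ α : ℝ) : ℂ) := by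
    exact_mod_cast congrArg (fun y : ℝ => (y : ℂ)) (hε x)
  refine hasDerivAt_vec3 ?_ ?_ ?_
  · refine (hG.const_mul l).congr_deriv ?_
    ring
  · refine ((((h1c.add hvb).const_mul (b : ℂ)).add
      (ha.const_mul (Complex.I * b ^ 2))).mul hG).congr_deriv ?_
    simp only [Complex.real_smul, Pi.add_apply, Function.comp_apply]
    push_cast at hεx ⊢
    linear_combination pertGaussian v b x * (hl - Complex.I * b ^ 2 * hεx)
  · refine ((ha2.const_mul (Complex.I * b ^ 2)).neg.mul hG).congr_deriv ?_
    simp only [Pi.neg_apply]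
    push_cast
    ring

/-- The system for a mode of frequency `η = b²`. The last two equations hold by the choice of the
components of `profile`, the first one by the form of `profileDeriv`. -/
lemma profile_eq (α : ℝ) (v : ℝ →ᵇ ℂ) (l : ℂ) (b : ℝ) (p : ℝ × Sp 2) :
    l • profile α v l b (p.2 0) +
      Matrix.toEuclideanLin (exampleSystem (fun x => |x| ^ α) 0 p) (profileDeriv α v l b (p.2 0)) +
      (Complex.I * (b ^ 2 : ℝ)) • Matrix.toEuclideanLin (exampleSystem (fun x => |x| ^ α) 1 p)
        (profile α v l b (p.2 0)) = 0 := by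
  ext i
  fin_cases i
  · simp [profile, profileDeriv, exampleSystem, Matrix.toLpLin_apply, Matrix.mulVec, dotProduct,
      Fin.sum_univ_three]
    ring_nf
    simp only [Complex.I_sq]
    ring
  · simp [profile, profileDeriv, exampleSystem, Matrix.toLpLin_apply, Matrix.mulVec, dotProduct,
      Fin.sum_univ_three]
    ring
  · simp [profile, profileDeriv, exampleSystem, Matrix.toLpLin_apply, Matrix.mulVec, dotProduct,
      Fin.sum_univ_three]
    ring

lemma abs_re_integral_le {v : ℝ →ᵇ ℂ} (hv : ‖v‖ ≤ 1) (s : ℝ) :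
    |(∫ r in (0 : ℝ)..s, v r).re| ≤ |s| := by
  refine (Complex.abs_re_le_norm _).trans ?_
  simpa using intervalIntegral.norm_integral_le_of_norm_le_const (a := 0) (b := s) (f := v) (C := 1)
    fun r _ => (v.norm_coe_le_norm r).trans hv

lemma norm_pertGaussian (v : ℝ →ᵇ ℂ) (b x : ℝ) :
    ‖pertGaussian v b x‖ =
      Real.exp (-(b * x) ^ 2 / 2 - (∫ r in (0 : ℝ)..(b * x), v r).re) := by
  rw [pertGaussian, Complex.norm_exp, Complex.sub_re]
  congr 2
  norm_cast

lemma norm_profile_le {α : ℝ} (h0 : 0 < α) (h1 : α < 1) {v : ℝ →ᵇ ℂ} (hv : ‖v‖ ≤ 1) {l : ℂ}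
    {b : ℝ} (hb : 1 ≤ b) (hl : ‖l‖ ≤ 2 * b) (x : ℝ) :
    ‖profile α v l b x‖ ≤ 6 * Real.exp 16 * b * Real.exp (-(b ^ 2 * x ^ 2 / 4)) := by
  set s := b * x with hs
  have hxs : |x| ≤ |s| := by
    rw [hs, abs_mul, abs_of_pos (by linarith : 0 < b)]
    nlinarith [abs_nonneg x]
  have hbs : b * |x| = |s| := by rw [hs, abs_mul, abs_of_pos (by linarith : 0 < b)]
  have ha : |x| ^ α ≤ 1 + |s| := (abs_rpow_le_one_add h0 h1 x).trans (by linarith)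
  have ha0 : 0 ≤ |x| ^ α := by positivity
  have hs0 : 0 ≤ |s| := abs_nonneg s
  set g := ‖pertGaussian v b x‖ with hg
  have hg0 : 0 ≤ g := norm_nonneg _
  have c0 : ‖l * pertGaussian v b x‖ ≤ 2 * b * g := by rw [norm_mul]; gcongr
  have c1 : ‖(b * (b * x + v (b * x)) + Complex.I * b ^ 2 * (x * |x| ^ α : ℝ)) *
      pertGaussian v b x‖ ≤ (b * (|s| + 1) + b * (|s| * (1 + |s|))) * g := by
    rw [norm_mul]
    gcongr
    refine (norm_add_le _ _).trans ?_
    have hb0 : ‖(b : ℂ)‖ = b := by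
      rw [Complex.norm_real, Real.norm_eq_abs, abs_of_pos (by linarith)]
    gcongr
    · rw [norm_mul, hb0]
      gcongr
      refine (norm_add_le _ _).trans (add_le_add (le_of_eq ?_) ((v.norm_coe_le_norm _).trans hv))
      rw [hs, ← Complex.ofReal_mul, Complex.norm_real, Real.norm_eq_abs]
    · rw [norm_mul, norm_mul, norm_pow, hb0, Complex.norm_I, Complex.norm_real, Real.norm_eq_abs,
        abs_mul, abs_of_nonneg ha0, one_mul]
      calc b ^ 2 * (|x| * |x| ^ α) = b * ((b * |x|) * |x| ^ α) := by ring
        _ ≤ b * (|s| * (1 + |s|)) := by rw [hbs]; gcongr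
  have c2 : ‖-(Complex.I * b ^ 2 * (x * (1 + (|x| ^ α) ^ 2) : ℝ)) * pertGaussian v b x‖ ≤
      b * (|s| * (1 + (1 + |s|) ^ 2)) * g := by
    rw [norm_mul]
    gcongr
    have hb0 : ‖(b : ℂ)‖ = b := by
      rw [Complex.norm_real, Real.norm_eq_abs, abs_of_pos (by linarith)]
    rw [norm_neg, norm_mul, norm_mul, norm_pow, hb0, Complex.norm_I, Complex.norm_real,
      Real.norm_eq_abs, abs_mul, abs_of_nonneg (by positivity : 0 ≤ 1 + (|x| ^ α) ^ 2), one_mul]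
    calc b ^ 2 * (|x| * (1 + (|x| ^ α) ^ 2)) = b * ((b * |x|) * (1 + (|x| ^ α) ^ 2)) := by ring
      _ ≤ _ := by rw [hbs]; gcongr
  have hge : g ≤ Real.exp (-s ^ 2 / 2 + |s|) := by
    rw [hg, norm_pertGaussian]
    gcongr
    have := (abs_le.1 (abs_re_integral_le hv s)).1
    rw [← hs]
    linarith
  have hu : 1 + |s| ≤ Real.exp |s| := by linarith [Real.add_one_le_exp |s|]
  -- the polynomial factors are absorbed by `1 + |s| ≤ e^{|s|}`, then `4 |s| ≤ s² / 4 + 16`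
  calc ‖profile α v l b x‖ ≤ _ := norm_vec3_le _ _ _
    _ ≤ 2 * b * g + (b * (|s| + 1) + b * (|s| * (1 + |s|))) * g +
        b * (|s| * (1 + (1 + |s|) ^ 2)) * g := add_le_add (add_le_add c0 c1) c2
    _ = b * (2 + (|s| + 1) + |s| * (1 + |s|) + |s| * (1 + (1 + |s|) ^ 2)) * g := by ring
    _ ≤ b * (6 * (1 + |s|) ^ 3) * g := by
        gcongr
        nlinarith [mul_nonneg hs0 hs0, mul_nonneg hs0 (mul_nonneg hs0 hs0)]
    _ ≤ b * (6 * Real.exp |s| ^ 3) * Real.exp (-s ^ 2 / 2 + |s|) := by gcongr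
    _ = 6 * b * Real.exp (4 * |s| - s ^ 2 / 2) := by
        rw [← Real.exp_nat_mul,
          show b * (6 * Real.exp ((3 : ℕ) * |s|)) * Real.exp (-s ^ 2 / 2 + |s|) =
          6 * b * (Real.exp ((3 : ℕ) * |s|) * Real.exp (-s ^ 2 / 2 + |s|)) by ring, ← Real.exp_add]
        congr 2
        push_cast
        ring
    _ ≤ 6 * b * Real.exp (16 + -(b ^ 2 * x ^ 2 / 4)) := by
        gcongr
        have : b ^ 2 * x ^ 2 = |s| ^ 2 := by rw [sq_abs, hs]; ring
        rw [this, ← sq_abs s]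
        nlinarith [sq_nonneg (|s| - 8)]
    _ = _ := by rw [Real.exp_add]; ring

lemma le_norm_profile {α : ℝ} {v : ℝ →ᵇ ℂ} (hv : ‖v‖ ≤ 1) {l : ℂ} {b : ℝ}
    (hl : b / 2 ≤ ‖l‖) {x : ℝ} (hx : b ^ 2 * x ^ 2 ≤ 1) :
    Real.exp (-2) / 2 * b ≤ ‖profile α v l b x‖ := by
  have h1 : ‖(profile α v l b x) 0‖ ≤ ‖profile α v l b x‖ := PiLp.norm_apply_le _ _
  refine le_trans ?_ h1
  simp only [profile, PiLp.toLp_apply, Matrix.cons_val_zero, norm_mul, norm_pertGaussian]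
  have hs : |b * x| ≤ 1 := by
    rw [abs_le_one_iff_mul_self_le_one]; nlinarith
  have h2 := (abs_le.1 (abs_re_integral_le hv (b * x))).2
  calc Real.exp (-2) / 2 * b = b / 2 * Real.exp (-2) := by ring
    _ ≤ ‖l‖ * Real.exp (-2) := by gcongr
    _ ≤ _ := by
      gcongr
      nlinarith [sq_abs (b * x)]

/-- The principal square root of `1 + δ` for small `δ`. -/
noncomputable def sqrtOneAdd (δ : ℂ) : ℂ := Complex.exp (Complex.log (1 + δ) / 2)

lemma one_add_mem_slitPlane {δ : ℂ} (hδ : ‖δ‖ ≤ 1 / 2) : 1 + δ ∈ Complex.slitPlane := by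
  refine Or.inl ?_
  have := (abs_le.1 (Complex.abs_re_le_norm δ)).1
  simp
  linarith

lemma sqrtOneAdd_sq {δ : ℂ} (hδ : ‖δ‖ ≤ 1 / 2) : sqrtOneAdd δ ^ 2 = 1 + δ := by
  rw [sqrtOneAdd, ← Complex.exp_nat_mul, Nat.cast_ofNat, mul_div_cancel₀ _ two_ne_zero,
    Complex.exp_log (Complex.slitPlane_ne_zero (one_add_mem_slitPlane hδ))]

lemma norm_sqrtOneAdd {δ : ℂ} (hδ : ‖δ‖ ≤ 1 / 2) :
    1 / 2 ≤ ‖sqrtOneAdd δ‖ ∧ ‖sqrtOneAdd δ‖ ≤ 2 := by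
  have h : ‖sqrtOneAdd δ‖ ^ 2 = ‖1 + δ‖ := by rw [← norm_pow, sqrtOneAdd_sq hδ]
  have h1 : ‖1 + δ‖ ≤ 1 + 1 / 2 := (norm_add_le _ _).trans (by simpa using hδ)
  have h2 : 1 - 1 / 2 ≤ ‖1 + δ‖ := by
    have := norm_sub_le (1 + δ) δ
    simp only [add_sub_cancel_right, norm_one] at this
    linarith
  constructor <;> nlinarith [norm_nonneg (sqrtOneAdd δ)]

lemma le_im_sqrtOneAdd {δ : ℂ} (hδ : ‖δ‖ ≤ 1 / 2) {t : ℝ} (ht : 0 ≤ t) (h : t ≤ δ.im) :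
    t / 4 ≤ (sqrtOneAdd δ).im := by
  have hre : 0 ≤ (sqrtOneAdd δ).re := by
    rw [sqrtOneAdd, Complex.exp_re]
    refine mul_nonneg (Real.exp_pos _).le (Real.cos_nonneg_of_neg_pi_div_two_le_of_le ?_ ?_)
    · have := Complex.neg_pi_lt_arg (1 + δ)
      simp [Complex.log_im]; linarith
    · have := Complex.arg_le_pi (1 + δ)
      simp [Complex.log_im]; linarith
  have h2 : (sqrtOneAdd δ).re ≤ 2 :=
    (Complex.re_le_norm _).trans (norm_sqrtOneAdd hδ).2
  have h3 : 2 * ((sqrtOneAdd δ).re * (sqrtOneAdd δ).im) = δ.im := by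
    have := congrArg Complex.im (sqrtOneAdd_sq hδ)
    rw [sq, Complex.mul_im, Complex.add_im, Complex.one_im] at this
    linarith
  by_contra! hc
  rcases le_or_gt (sqrtOneAdd δ).im 0 with h5 | h5
  · have := mul_nonpos_of_nonneg_of_nonpos hre h5
    have h6 : t = 0 := by linarith
    have h7 : (sqrtOneAdd δ).re = 0 := by
      by_contra h8
      have h9 : 0 < (sqrtOneAdd δ).re := lt_of_le_of_ne hre (Ne.symm h8)
      nlinarith
    -- a purely imaginary square root would have a square with negative real part
    have h10 := congrArg Complex.re (sqrtOneAdd_sq hδ)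
    have h11 := (abs_le.1 (Complex.abs_re_le_norm δ)).1
    rw [sq, Complex.mul_re, Complex.add_re, Complex.one_re, h7] at h10
    nlinarith
  · nlinarith

/-- For every large frequency `η` in `y` the system has a mode `e^{λ t + i η y} P(x)`, localized at
`|x| ≲ η^{-1/2}`, and its growth rate `Re λ`, of order `η^{(1-α)/2}`, tends to infinity with `η`.
The family depends continuously on `η`. -/
theorem exists_growing_modes {α : ℝ} (h0 : 0 < α) (h1 : α < 1) :
    ∃ (η₀ K c : ℝ) (l : ℝ → ℂ) (P P' : ℝ → ℝ → Vec 3), 1 ≤ η₀ ∧ 0 < K ∧ 0 < c ∧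
      Continuous l ∧ Continuous P.uncurry ∧ Continuous P'.uncurry ∧
      Tendsto (fun η => (l η).re) atTop atTop ∧
      (∀ η x, HasDerivAt (P η) (P' η x) x) ∧
      ∀ η, η₀ ≤ η →
        (∀ p : ℝ × Sp 2, l η • P η (p.2 0) +
          Matrix.toEuclideanLin (exampleSystem (fun x => |x| ^ α) 0 p) (P' η (p.2 0)) +
          (Complex.I * η) • Matrix.toEuclideanLin (exampleSystem (fun x => |x| ^ α) 1 p)
            (P η (p.2 0)) = 0) ∧
        (∀ x, ‖P η x‖ ≤ K * √η * Real.exp (-(η * x ^ 2 / 4))) ∧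
        ∀ x, η * x ^ 2 ≤ 1 → c * √η ≤ ‖P η x‖ := by
  obtain ⟨ε₁, hε₁, v, δ, κ, hκ, hvc, hδc, hall⟩ := exists_riccati h0 h1
  -- below the threshold `b₀` the frequency is frozen, to have families defined for all `η`
  set b₀ : ℝ := max 1 (((1 + α) / ε₁) ^ α⁻¹) with hb₀
  have hb₀1 : 1 ≤ b₀ := le_max_left _ _
  let b : ℝ → ℝ := fun η => √(max η (b₀ ^ 2))
  have hbc : Continuous b := by fun_prop
  have hb : ∀ η, b₀ ≤ b η := fun η => Real.le_sqrt_of_sq_le (le_max_right _ _)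
  have hb1 : ∀ η, 1 ≤ b η := fun η => hb₀1.trans (hb η)
  have hbpos : ∀ η, 0 < b η := fun η => one_pos.trans_le (hb1 η)
  let ε : ℝ → ℝ := fun η => (1 + α) * (b η) ^ (-α)
  have hεc : Continuous ε := by
    refine continuous_const.mul (hbc.rpow_const fun η => Or.inl (hbpos η).ne')
  have hε : ∀ η, ε η ∈ Icc 0 ε₁ := by
    intro η
    have hbp := hbpos η
    refine ⟨by positivity, ?_⟩
    have h2 : (1 + α) / ε₁ ≤ b η ^ α := by
      have h3 : ((1 + α) / ε₁) ^ α⁻¹ ≤ b η := (le_max_right _ _).trans (hb η)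
      calc (1 + α) / ε₁ = (((1 + α) / ε₁) ^ α⁻¹) ^ α := by
            rw [← Real.rpow_mul (by positivity), inv_mul_cancel₀ h0.ne', Real.rpow_one]
        _ ≤ _ := by gcongr
    simp only [ε]
    rw [Real.rpow_neg hbp.le, ← div_eq_mul_inv, div_le_iff₀ (by positivity)]
    rwa [div_le_iff₀ hε₁, mul_comm] at h2
  let V : ℝ → (ℝ →ᵇ ℂ) := fun η => v (ε η)
  have hV : Continuous V := hvc.comp_continuous hεc hε
  let D : ℝ → ℂ := fun η => δ (ε η)
  have hD : Continuous D := hδc.comp_continuous hεc hε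
  have hDn : ∀ η, ‖D η‖ ≤ 1 / 2 := fun η => (hall _ (hε η)).2.2.1
  have hVn : ∀ η, ‖V η‖ ≤ 1 := fun η => (hall _ (hε η)).2.1
  let l : ℝ → ℂ := fun η => -Complex.I * b η * sqrtOneAdd (D η)
  have hsc : Continuous fun η => sqrtOneAdd (D η) := by
    refine Complex.continuous_exp.comp (Continuous.div_const ?_ 2)
    exact (continuous_const.add hD).clog fun η => one_add_mem_slitPlane (hDn η)
  have hlc : Continuous l := by fun_prop
  have hl2 : ∀ η, l η ^ 2 = -(b η ^ 2 * (1 + D η)) := by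
    intro η
    simp only [l, mul_pow, sqrtOneAdd_sq (hDn η), neg_sq, Complex.I_sq]
    ring
  have hln : ∀ η, ‖l η‖ = b η * ‖sqrtOneAdd (D η)‖ := by
    intro η
    simp [l, abs_of_pos (hbpos η)]
  have hlle : ∀ η, ‖l η‖ ≤ 2 * b η := fun η => by
    rw [hln]; nlinarith [(norm_sqrtOneAdd (hDn η)).2, hbpos η]
  have hlge : ∀ η, b η / 2 ≤ ‖l η‖ := fun η => by
    rw [hln]; nlinarith [(norm_sqrtOneAdd (hDn η)).1, hbpos η]
  have hlre : ∀ η, κ * (1 + α) / 4 * b η ^ (1 - α) ≤ (l η).re := by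
    intro η
    have h2 := le_im_sqrtOneAdd (hDn η) (mul_nonneg hκ.le (hε η).1) (hall _ (hε η)).2.2.2
    have h3 : (l η).re = b η * (sqrtOneAdd (D η)).im := by simp [l]
    have h4 : b η ^ (1 - α) = b η * b η ^ (-α) := by
      rw [sub_eq_add_neg, Real.rpow_add (hbpos η), Real.rpow_one]
    rw [h3, h4]
    calc κ * (1 + α) / 4 * (b η * b η ^ (-α)) = b η * (κ * ε η / 4) := by simp only [ε]; ring
      _ ≤ _ := by
        have := (hbpos η).le
        gcongr
  have hbt : Tendsto b atTop atTop :=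
    Real.tendsto_sqrt_atTop.comp (tendsto_atTop_mono (fun η => le_max_left _ _) tendsto_id)
  have hlt : Tendsto (fun η => (l η).re) atTop atTop := by
    refine tendsto_atTop_mono hlre (Tendsto.const_mul_atTop (by positivity) ?_)
    exact (tendsto_rpow_atTop (by linarith)).comp hbt
  have hεb : ∀ η x, ε η * |b η * x| ^ α = (1 + α) * |x| ^ α := by
    intro η x
    have hbp := hbpos η
    simp only [ε]
    rw [abs_mul, abs_of_pos hbp, Real.mul_rpow hbp.le (abs_nonneg x), Real.rpow_neg hbp.le]
    field_simp
  have hGc : Continuous fun z : ℝ × ℝ => pertGaussian (V z.1) (b z.1) z.2 := by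
    have h2 : Continuous fun z : (ℝ × ℝ) × ℝ => V z.1.1 z.2 :=
      (hV.comp (continuous_fst.comp continuous_fst)).eval continuous_snd
    have h3 : Continuous fun z : ℝ × ℝ => ∫ r in (0 : ℝ)..(b z.1 * z.2), V z.1 r :=
      intervalIntegral.continuous_parametric_intervalIntegral_of_continuous
        (f := fun (z : ℝ × ℝ) r => V z.1 r) h2 (by fun_prop)
    have h4 : Continuous fun z : ℝ × ℝ => ((b z.1 * z.2 : ℝ) : ℂ) := by fun_prop
    exact Complex.continuous_exp.comp ((((h4.pow 2).neg).div_const 2).sub h3)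
  have hVb : Continuous fun z : ℝ × ℝ => V z.1 (b z.1 * z.2) :=
    (hV.comp continuous_fst).eval (by fun_prop)
  have hac : Continuous fun z : ℝ × ℝ => |z.2| ^ α :=
    (continuous_abs_rpow h0).comp continuous_snd
  refine ⟨b₀ ^ 2, 6 * Real.exp 16, Real.exp (-2) / 2, l, fun η => profile α (V η) (l η) (b η),
    fun η => profileDeriv α (V η) (l η) (b η), one_le_pow₀ hb₀1, by positivity, by positivity,
    hlc, ?_, ?_, hlt, fun η x => ?_, fun η hη => ?_⟩
  · refine continuous_vec3 ?_ ?_ ?_ <;> fun_prop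
  · refine continuous_vec3 ?_ ?_ ?_ <;> fun_prop
  · exact hasDerivAt_profile h0 (hl2 η) (hεb η) (hall _ (hε η)).1 x
  · have hbη : b η = √η := by simp only [b, max_eq_left hη]
    have hη0 : 0 ≤ η := le_trans (by positivity) hη
    have hb2 : b η ^ 2 = η := by rw [hbη, Real.sq_sqrt hη0]
    refine ⟨fun p => ?_, fun x => ?_, fun x hx => ?_⟩
    · have := profile_eq α (V η) (l η) (b η) p
      rwa [hb2] at this
    · have := norm_profile_le h0 h1 (hVn η) (hb1 η) (hlle η) x
      rw [hb2] at this
      rwa [← hbη]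
    · rw [← hbη]
      exact le_norm_profile (hVn η) (hlge η) (by rwa [hb2])

end HypSys

/-! ### First order operators and modes -/

namespace HypSys

open Filter Topology

section op

variable {d N : ℕ}

lemma toEuclideanLin_ofReal_smul (M : Matrix (Fin N) (Fin N) ℂ) (r : ℝ) (v : Vec N) :
    Matrix.toEuclideanLin M (r • v) = r • Matrix.toEuclideanLin M v :=
  LinearMap.map_smul_of_tower _ r v

lemma norm_toEuclideanLin_le (M : Matrix (Fin N) (Fin N) ℂ) (v : Vec N) :
    ‖Matrix.toEuclideanLin M v‖ ≤ (∑ i, ∑ k, ‖M i k‖) * ‖v‖ := by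
  have h1 : ∀ w : Vec N, ‖w‖ ≤ ∑ i, ‖w i‖ := by
    intro w
    refine abs_le_of_sq_le_sq' ?_ (Finset.sum_nonneg fun i _ => norm_nonneg _) |>.2
    rw [EuclideanSpace.norm_sq_eq]
    exact Finset.sum_sq_le_sq_sum_of_nonneg fun i _ => norm_nonneg _
  refine (h1 _).trans ?_
  rw [Finset.sum_mul]
  refine Finset.sum_le_sum fun i _ => ?_
  rw [Matrix.toLpLin_apply, PiLp.toLp_apply, Matrix.mulVec, dotProduct, Finset.sum_mul]
  refine (norm_sum_le _ _).trans (Finset.sum_le_sum fun k _ => ?_)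
  rw [norm_mul]
  gcongr
  exact PiLp.norm_apply_le v k

lemma continuous_toEuclideanLin {X : Type*} [TopologicalSpace X]
    {M : X → Matrix (Fin N) (Fin N) ℂ} {v : X → Vec N} (hM : Continuous M) (hv : Continuous v) :
    Continuous fun x => Matrix.toEuclideanLin (M x) (v x) := by
  simp only [Matrix.toLpLin_apply]
  exact (PiLp.continuous_toLp 2 _).comp
    (hM.matrix_mulVec ((PiLp.continuous_ofLp 2 _).comp hv))

lemma continuous_dt {u : ℝ × Sp d → Vec N} (hu : ContDiff ℝ 1 u) : Continuous (dt u) :=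
  (hu.continuous_fderiv one_ne_zero).clm_apply continuous_const

lemma continuous_dx {u : ℝ × Sp d → Vec N} (hu : ContDiff ℝ 1 u) (j : Fin d) :
    Continuous (dx j u) :=
  (hu.continuous_fderiv one_ne_zero).clm_apply continuous_const

lemma continuous_op {A : Coeffs d N} (hA : ∀ j, Continuous (A j)) {u : ℝ × Sp d → Vec N}
    (hu : ContDiff ℝ 1 u) : Continuous (op A u) :=
  (continuous_dt hu).add (continuous_finsetSum _ fun j _ =>
    continuous_toEuclideanLin (hA j) (continuous_dx hu j))

/-- The value `τ • v + ∑ⱼ ζⱼ • Aⱼ v` of the symbol on the covector `(τ, ζ)`, given as a linear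
form on `ℝ × ℝᵈ`. -/
noncomputable def principalPart (A : Coeffs d N) (p : ℝ × Sp d) (ν : ℝ × Sp d →L[ℝ] ℝ)
    (v : Vec N) : Vec N :=
  ν (1, 0) • v + ∑ j, ν (0, EuclideanSpace.single j 1) • Matrix.toEuclideanLin (A j p) v

/-- The Leibniz rule `L (χ u) = χ L u + [L, χ] u`. -/
lemma op_smul (A : Coeffs d N) {χ : ℝ × Sp d → ℝ} {u : ℝ × Sp d → Vec N} {p : ℝ × Sp d}
    (hχ : DifferentiableAt ℝ χ p) (hu : DifferentiableAt ℝ u p) :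
    op A (fun q => χ q • u q) p = χ p • op A u p + principalPart A p (fderiv ℝ χ p) (u p) := by
  have h : ∀ v, fderiv ℝ (fun q => χ q • u q) p v =
      χ p • fderiv ℝ u p v + fderiv ℝ χ p v • u p := by
    intro v
    rw [fderiv_fun_smul hχ hu]
    simp
  simp only [op, dt, dx, h, principalPart, map_add, toEuclideanLin_ofReal_smul,
    Finset.sum_add_distrib, smul_add, Finset.smul_sum]
  abel

/-- A bound for the norm of `v ↦ A₁ v, …, A_d v`, continuous in the coefficients. -/
noncomputable def coeffBound (A : Coeffs d N) (p : ℝ × Sp d) : ℝ :=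
  1 + ∑ j, ∑ i, ∑ k, ‖A j p i k‖

lemma continuous_coeffBound {A : Coeffs d N} (hA : ∀ j, Continuous (A j)) :
    Continuous (coeffBound A) := by
  unfold coeffBound
  fun_prop

lemma norm_principalPart_le (A : Coeffs d N) (p : ℝ × Sp d) (ν : ℝ × Sp d →L[ℝ] ℝ) (v : Vec N) :
    ‖principalPart A p ν v‖ ≤ ‖ν‖ * coeffBound A p * ‖v‖ := by
  have h0 : ‖ν (1, 0)‖ ≤ ‖ν‖ := by simpa using ν.le_opNorm ((1, 0) : ℝ × Sp d)
  have hj : ∀ j, ‖ν (0, EuclideanSpace.single j 1)‖ ≤ ‖ν‖ := fun j => by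
    simpa using ν.le_opNorm ((0, EuclideanSpace.single j 1) : ℝ × Sp d)
  calc ‖principalPart A p ν v‖ ≤ ‖ν (1, 0) • v‖ +
        ∑ j, ‖ν (0, EuclideanSpace.single j 1) • Matrix.toEuclideanLin (A j p) v‖ :=
        (norm_add_le _ _).trans (by gcongr; exact norm_sum_le _ _)
    _ ≤ ‖ν‖ * ‖v‖ + ∑ j, ‖ν‖ * ((∑ i, ∑ k, ‖A j p i k‖) * ‖v‖) := by
        gcongr with j
        · rw [norm_smul]; gcongr
        · rw [norm_smul]
          gcongr
          · exact hj j
          · exact norm_toEuclideanLin_le _ _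
    _ = _ := by
        rw [coeffBound, ← Finset.mul_sum, ← Finset.sum_mul]; ring

lemma norm_op_le (A : Coeffs d N) (u : ℝ × Sp d → Vec N) (p : ℝ × Sp d) :
    ‖op A u p‖ ≤ coeffBound A p * ‖fderiv ℝ u p‖ := by
  have h0 : ‖dt u p‖ ≤ ‖fderiv ℝ u p‖ := by
    simpa [dt] using (fderiv ℝ u p).le_opNorm ((1, 0) : ℝ × Sp d)
  have hj : ∀ j, ‖dx j u p‖ ≤ ‖fderiv ℝ u p‖ := fun j => by
    simpa [dx] using (fderiv ℝ u p).le_opNorm ((0, EuclideanSpace.single j 1) : ℝ × Sp d)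
  calc ‖op A u p‖ ≤ ‖dt u p‖ + ∑ j, ‖Matrix.toEuclideanLin (A j p) (dx j u p)‖ :=
        (norm_add_le _ _).trans (by gcongr; exact norm_sum_le _ _)
    _ ≤ ‖fderiv ℝ u p‖ + ∑ j, (∑ i, ∑ k, ‖A j p i k‖) * ‖fderiv ℝ u p‖ := by
        gcongr with j
        exact (norm_toEuclideanLin_le _ _).trans (by gcongr; exact hj j)
    _ = _ := by rw [coeffBound, ← Finset.sum_mul]; ring

lemma tendsto_op {A : Coeffs d N} {W : ℕ → ℝ × Sp d → Vec N} {w : ℝ × Sp d → Vec N} {p : ℝ × Sp d}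
    (h : Tendsto (fun n => fderiv ℝ (W n) p) atTop (𝓝 (fderiv ℝ w p))) :
    Tendsto (fun n => op A (W n) p) atTop (𝓝 (op A w p)) := by
  have hv : ∀ v, Tendsto (fun n => fderiv ℝ (W n) p v) atTop (𝓝 (fderiv ℝ w p v)) := fun v =>
    ((ContinuousLinearMap.apply ℝ (Vec N) v).continuous.tendsto _).comp h
  refine (hv _).add (tendsto_finsetSum _ fun j _ => ?_)
  exact ((LinearMap.continuous_of_finiteDimensional (Matrix.toEuclideanLin (A j p))).tendsto _).comp
    (hv _)

end op

lemma continuous_exampleSystem {a : ℝ → ℝ} (ha : Continuous a) (j : Fin 2) :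
    Continuous (exampleSystem a j) := by
  have hx : Continuous fun p : ℝ × Sp 2 => p.2 0 := by fun_prop
  have hax := ha.comp hx
  refine continuous_matrix fun i k => ?_
  fin_cases j <;> fin_cases i <;> fin_cases k <;> simp [exampleSystem] <;> fun_prop

/-- `t`, as a linear form. -/
noncomputable def coordT : ℝ × Sp 2 →L[ℝ] ℝ := ContinuousLinearMap.fst ℝ ℝ (Sp 2)

/-- The space coordinate `i`, as a linear form on space-time. -/
noncomputable def coordX (i : Fin 2) : ℝ × Sp 2 →L[ℝ] ℝ :=
  (EuclideanSpace.proj i : Sp 2 →L[ℝ] ℝ) ∘L ContinuousLinearMap.snd ℝ ℝ (Sp 2)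

/-- The phase `e^{l t + i η y}`. -/
noncomputable def phase (l : ℂ) (η : ℝ) (p : ℝ × Sp 2) : ℂ :=
  Complex.exp (l * p.1 + Complex.I * η * p.2 1)

/-- The mode `e^{l t + i η y} P(x)`. -/
noncomputable def mode (l : ℂ) (η : ℝ) (P : ℝ → Vec 3) (p : ℝ × Sp 2) : Vec 3 :=
  phase l η p • P (p.2 0)

/-- The derivative of `mode`, where `P'` stands for the derivative of `P`. -/
noncomputable def modeFDeriv (l : ℂ) (η : ℝ) (P P' : ℝ → Vec 3) (p : ℝ × Sp 2) :
    ℝ × Sp 2 →L[ℝ] Vec 3 :=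
  coordT.smulRight (phase l η p • l • P (p.2 0)) +
    (coordX 0).smulRight (phase l η p • P' (p.2 0)) +
    (coordX 1).smulRight (phase l η p • (Complex.I * η) • P (p.2 0))

lemma hasFDerivAt_phase (l : ℂ) (η : ℝ) (p : ℝ × Sp 2) :
    HasFDerivAt (phase l η) (coordT.smulRight (phase l η p * l) +
      (coordX 1).smulRight (phase l η p * (Complex.I * η))) p := by
  have h1 : HasFDerivAt (fun q : ℝ × Sp 2 => (q.1 : ℂ)) (Complex.ofRealCLM ∘L coordT) p :=
    (Complex.ofRealCLM ∘L coordT).hasFDerivAt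
  have h2 : HasFDerivAt (fun q : ℝ × Sp 2 => (q.2 1 : ℂ)) (Complex.ofRealCLM ∘L coordX 1) p :=
    (Complex.ofRealCLM ∘L coordX 1).hasFDerivAt
  refine ((h1.const_mul l).add (h2.const_mul (Complex.I * η))).cexp.congr_fderiv ?_
  refine ContinuousLinearMap.ext fun v => ?_
  simp [phase, coordT, coordX]
  ring

lemma hasFDerivAt_mode (l : ℂ) (η : ℝ) {P P' : ℝ → Vec 3} (hP : ∀ x, HasDerivAt P (P' x) x)
    (p : ℝ × Sp 2) : HasFDerivAt (mode l η P) (modeFDeriv l η P P' p) p := by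
  have h1 : HasFDerivAt (fun q : ℝ × Sp 2 => P (q.2 0)) ((coordX 0).smulRight (P' (p.2 0))) p :=
    (hP (p.2 0)).hasFDerivAt.comp p (coordX 0).hasFDerivAt |>.congr_fderiv
      (ContinuousLinearMap.ext fun v => by simp [coordX])
  refine ((hasFDerivAt_phase l η p).smul h1).congr_fderiv ?_
  refine ContinuousLinearMap.ext fun v => ?_
  simp [modeFDeriv, coordT, coordX]
  module

lemma continuous_modeFDeriv {X : Type*} [TopologicalSpace X] {l : X → ℂ} {η : X → ℝ}
    {P P' : X → ℝ → Vec 3} {p : X → ℝ × Sp 2} (hl : Continuous l) (hη : Continuous η)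
    (hP : Continuous fun x => P x ((p x).2 0)) (hP' : Continuous fun x => P' x ((p x).2 0))
    (hp : Continuous p) : Continuous fun x => modeFDeriv (l x) (η x) (P x) (P' x) (p x) := by
  have hph : Continuous fun x => phase (l x) (η x) (p x) := by
    unfold phase
    fun_prop
  have hs : ∀ T : ℝ × Sp 2 →L[ℝ] ℝ, Continuous fun v : Vec 3 => T.smulRight v := fun T =>
    (ContinuousLinearMap.smulRightL ℝ (ℝ × Sp 2) (Vec 3) T).continuous
  unfold modeFDeriv
  refine Continuous.add (Continuous.add ?_ ?_) ?_
  · exact (hs coordT).comp (hph.smul (hl.smul hP))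
  · exact (hs (coordX 0)).comp (hph.smul hP')
  · have hη' : Continuous fun x => Complex.I * (η x : ℂ) := by fun_prop
    exact (hs (coordX 1)).comp (hph.smul (hη'.smul hP))

/-- `L` applied to a mode. -/
lemma op_of_modeFDeriv (A : Coeffs 2 3) (l : ℂ) (η : ℝ) (P P' : ℝ → Vec 3)
    {u : ℝ × Sp 2 → Vec 3} {p : ℝ × Sp 2} (h : fderiv ℝ u p = modeFDeriv l η P P' p) :
    op A u p = phase l η p • (l • P (p.2 0) + Matrix.toEuclideanLin (A 0 p) (P' (p.2 0)) +
      (Complex.I * η) • Matrix.toEuclideanLin (A 1 p) (P (p.2 0))) := by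
  simp only [op, dt, dx, h, Fin.sum_univ_two]
  simp [modeFDeriv, coordT, coordX]
  module

end HypSys

/-! ### Smooth approximation and the local energy estimate -/

namespace HypSys

open Filter Topology

lemma norm_normed_convolution_le {E F : Type*} [NormedAddCommGroup E] [NormedSpace ℝ E]
    [FiniteDimensional ℝ E] [MeasureSpace E] [BorelSpace E]
    [(volume : Measure E).IsAddHaarMeasure]
    [NormedAddCommGroup F] [NormedSpace ℝ F] [CompleteSpace F] (φ : ContDiffBump (0 : E))
    {g : E → F} {M : ℝ} (hg : Continuous g) (hM : ∀ x, ‖g x‖ ≤ M) (x : E) :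
    ‖convolution (φ.normed volume) g (ContinuousLinearMap.lsmul ℝ ℝ) volume x‖ ≤ 3 * M := by
  have h1 := φ.dist_normed_convolution_le (μ := volume) (x₀ := x) (ε := M + M)
    hg.aestronglyMeasurable fun y _ =>
      (dist_le_norm_add_norm _ _).trans (add_le_add (hM y) (hM x))
  rw [dist_eq_norm] at h1
  have h2 := norm_add_le
    (convolution (φ.normed volume) g (ContinuousLinearMap.lsmul ℝ ℝ) volume x - g x) (g x)
  rw [sub_add_cancel] at h2
  linarith [hM x]

/-- A compactly supported `C¹` function is approximated by mollification together with its first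
derivatives. -/
lemma exists_smooth_approx {E F : Type*} [NormedAddCommGroup E] [NormedSpace ℝ E]
    [FiniteDimensional ℝ E] [MeasureSpace E] [BorelSpace E]
    [(volume : Measure E).IsAddHaarMeasure]
    [NormedAddCommGroup F] [NormedSpace ℝ F] [CompleteSpace F]
    {w : E → F} (hw : ContDiff ℝ 1 w) (hc : HasCompactSupport w) {Ω : Set E} (hΩ : IsOpen Ω)
    (hs : tsupport w ⊆ Ω) :
    ∃ (K : Set E) (M : ℝ) (W : ℕ → E → F), IsCompact K ∧ K ⊆ Ω ∧
      (∀ n, ContDiff ℝ ∞ (W n) ∧ tsupport (W n) ⊆ K ∧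
        ∀ x, ‖W n x‖ ≤ M ∧ ‖fderiv ℝ (W n) x‖ ≤ M) ∧
      ∀ x, Tendsto (fun n => W n x) atTop (𝓝 (w x)) ∧
        Tendsto (fun n => fderiv ℝ (W n) x) atTop (𝓝 (fderiv ℝ w x)) := by
  obtain ⟨r, hr, hrΩ⟩ := hc.isCompact.exists_cthickening_subset_open hΩ hs
  have hwc := hw.continuous
  have hdc := hw.continuous_fderiv one_ne_zero
  obtain ⟨M₁, hM₁⟩ := hwc.bounded_above_of_compact_support hc
  obtain ⟨M₂, hM₂⟩ := hdc.bounded_above_of_compact_support (hc.fderiv ℝ)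
  let φ : ℕ → ContDiffBump (0 : E) := fun n =>
    ⟨r / (n + 1) / 2, r / (n + 1), by positivity, half_lt_self (by positivity)⟩
  have hφr : ∀ n, (φ n).rOut = r / (n + 1) := fun n => rfl
  have hφt : Tendsto (fun n => (φ n).rOut) atTop (𝓝 0) := by
    simp only [hφr]
    exact tendsto_const_nhds.div_atTop
      (tendsto_atTop_add_const_right _ _ tendsto_natCast_atTop_atTop)
  let W : ℕ → E → F := fun n =>
    convolution ((φ n).normed volume) w (ContinuousLinearMap.lsmul ℝ ℝ) volume
  have hφi : ∀ n, LocallyIntegrable ((φ n).normed volume) volume := fun n =>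
    (φ n).continuous_normed.locallyIntegrable
  have hfd : ∀ n x, fderiv ℝ (W n) x =
      convolution ((φ n).normed volume) (fderiv ℝ w) (ContinuousLinearMap.lsmul ℝ ℝ) volume x := by
    intro n x
    rw [(hc.hasFDerivAt_convolution_right (ContinuousLinearMap.lsmul ℝ ℝ) (hφi n) hw x).fderiv]
    rfl
  refine ⟨Metric.cthickening r (tsupport w), max (3 * M₁) (3 * M₂), W, hc.isCompact.cthickening,
    hrΩ, fun n => ⟨?_, ?_, fun x => ⟨?_, ?_⟩⟩, fun x => ⟨?_, ?_⟩⟩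
  · exact (φ n).hasCompactSupport_normed.contDiff_convolution_left _ (φ n).contDiff_normed
      hwc.locallyIntegrable
  · refine closure_minimal ?_ Metric.isClosed_cthickening
    refine (support_convolution_subset _).trans ?_
    rintro _ ⟨a, ha, b, hb, rfl⟩
    rw [(φ n).support_normed_eq, hφr, mem_ball_zero_iff] at ha
    refine Metric.mem_cthickening_of_dist_le _ b r _ (subset_tsupport w hb) ?_
    rw [dist_eq_norm]
    simp only [add_sub_cancel_right]
    refine ha.le.trans (div_le_self hr.le ?_)
    linarith [(Nat.cast_nonneg n : (0 : ℝ) ≤ n)]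
  · exact (norm_normed_convolution_le (φ n) hwc hM₁ x).trans (le_max_left _ _)
  · rw [hfd]
    exact (norm_normed_convolution_le (φ n) hdc hM₂ x).trans (le_max_right _ _)
  · exact ContDiffBump.convolution_tendsto_right_of_continuous hφt hwc x
  · simp only [hfd]
    exact ContDiffBump.convolution_tendsto_right_of_continuous hφt hdc x

/-- Dominated convergence for square integrals of functions supported in a fixed compact set. -/
lemma tendsto_sqrt_integral_sq {E F : Type*} [TopologicalSpace E] [T2Space E] [MeasureSpace E]
    [BorelSpace E] [SecondCountableTopology E]
    [IsFiniteMeasureOnCompacts (volume : Measure E)] [NormedAddCommGroup F]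
    {Ω K : Set E} {M : ℝ} {W : ℕ → E → F} {w : E → F} (hK : IsCompact K)
    (hc : ∀ n, Continuous (W n)) (h0 : ∀ n x, x ∉ K → W n x = 0) (hM : ∀ n, ∀ x ∈ K, ‖W n x‖ ≤ M)
    (ht : ∀ x, Tendsto (fun n => W n x) atTop (𝓝 (w x))) :
    Tendsto (fun n => √(∫ x in Ω, ‖W n x‖ ^ 2)) atTop (𝓝 √(∫ x in Ω, ‖w x‖ ^ 2)) := by
  refine (Real.continuous_sqrt.tendsto _).comp ?_
  refine tendsto_integral_of_dominated_convergence (K.indicator fun _ => M ^ 2)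
    (fun n => ((hc n).norm.pow 2).aestronglyMeasurable) ?_ (fun n => ?_) ?_
  · rw [integrable_indicator_iff hK.measurableSet]
    exact integrableOn_const ((Measure.restrict_le_self K).trans_lt hK.measure_lt_top).ne
  · refine Eventually.of_forall fun x => ?_
    by_cases hx : x ∈ K
    · rw [indicator_of_mem hx, norm_pow, norm_norm]
      gcongr
      exact hM n x hx
    · rw [indicator_of_notMem hx, h0 n x hx]
      simp
  · exact Eventually.of_forall fun x => ((ht x).norm.pow 2)

/-- `volume` on a product space is the product measure, but this is seen only after unfolding. -/
instance isAddHaarMeasure_volume_prod (d : ℕ) :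
    (volume : Measure (ℝ × Sp d)).IsAddHaarMeasure :=
  inferInstanceAs ((volume : Measure ℝ).prod (volume : Measure (Sp d))).IsAddHaarMeasure

/-- The local energy estimate extends from smooth to `C¹` functions of compact support. -/
lemma LocalL2Estimate.of_contDiff_one {d N : ℕ} {A : Coeffs d N} (hA : ∀ j, Continuous (A j))
    {Ω : Set (ℝ × Sp d)} (hΩ : IsOpen Ω) (h : LocalL2Estimate A Ω) :
    ∃ C γ₀ : ℝ, ∀ γ : ℝ, γ₀ ≤ γ → ∀ u : ℝ × Sp d → Vec N, ContDiff ℝ 1 u →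
      HasCompactSupport u → tsupport u ⊆ Ω →
      γ * √(∫ p in Ω, ‖u p‖ ^ 2) ≤ C * √(∫ p in Ω, ‖op A u p + γ • u p‖ ^ 2) := by
  obtain ⟨C, γ₀, hC⟩ := h
  refine ⟨C, γ₀, fun γ hγ u hu hc hs => ?_⟩
  obtain ⟨K, M, W, hK, hKΩ, hW, hlim⟩ := exists_smooth_approx hu hc hΩ hs
  obtain ⟨B, hB⟩ := hK.exists_bound_of_continuousOn (continuous_coeffBound hA).continuousOn
  have hW1 : ∀ n, ContDiff ℝ 1 (W n) := fun n => (hW n).1.of_le (by exact_mod_cast le_top)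
  have hcs : ∀ n, HasCompactSupport (W n) := fun n =>
    hK.of_isClosed_subset (isClosed_tsupport _) (hW n).2.1
  have hz : ∀ n x, x ∉ K → W n x = 0 := fun n x hx =>
    image_eq_zero_of_notMem_tsupport fun h => hx ((hW n).2.1 h)
  have hdz : ∀ n x, x ∉ K → fderiv ℝ (W n) x = 0 := fun n x hx =>
    image_eq_zero_of_notMem_tsupport fun h => hx ((hW n).2.1 (tsupport_fderiv_subset ℝ h))
  have t1 := tendsto_sqrt_integral_sq (Ω := Ω) (M := M) hK (fun n => (hW1 n).continuous) hz
    (fun n x _ => ((hW n).2.2 x).1) fun x => (hlim x).1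
  have t2 := tendsto_sqrt_integral_sq (Ω := Ω) (K := K) (M := B * M + |γ| * M)
    (W := fun n p => op A (W n) p + γ • W n p) (w := fun p => op A u p + γ • u p) hK
    (fun n => (continuous_op hA (hW1 n)).add ((hW1 n).continuous.const_smul γ))
    (fun n x hx => by simp [op, dt, dx, hz n x hx, hdz n x hx])
    (fun n x hx => by
      refine (norm_add_le _ _).trans (add_le_add ((norm_op_le A (W n) x).trans ?_) ?_)
      · have h1 : coeffBound A x ≤ B := (le_abs_self _).trans (hB x hx)
        exact mul_le_mul h1 ((hW n).2.2 x).2 (norm_nonneg _) ((norm_nonneg _).trans (hB x hx))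
      · rw [norm_smul, Real.norm_eq_abs]
        gcongr
        exact ((hW n).2.2 x).1)
    fun x => (tendsto_op (hlim x).2).add ((hlim x).1.const_smul γ)
  exact le_of_tendsto_of_tendsto' (t1.const_mul γ) (t2.const_mul C) fun n =>
    hC γ hγ (W n) (hW n).1 (hcs n) ((hW n).2.1.trans hKΩ)

/-- The coordinates of the plane preserve volume. -/
lemma measurePreserving_coords :
    MeasurePreserving (fun z : Sp 2 => (z 0, z 1)) volume volume :=
  (volume_preserving_finTwoArrow ℝ).comp (PiLp.volume_preserving_ofLp (Fin 2))

lemma measurableEmbedding_coords : MeasurableEmbedding (fun z : Sp 2 => (z 0, z 1)) :=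
  (MeasurableEquiv.finTwoArrow (α := ℝ)).measurableEmbedding.comp
    (MeasurableEquiv.toLp 2 (Fin 2 → ℝ)).symm.measurableEmbedding

lemma integrable_prod_coords {f g h : ℝ → ℝ} (hf : Integrable f) (hg : Integrable g)
    (hh : Integrable h) :
    Integrable fun p : ℝ × Sp 2 => f p.1 * (g (p.2 0) * h (p.2 1)) := by
  have h1 : Integrable fun z : Sp 2 => g (z 0) * h (z 1) :=
    measurePreserving_coords.integrable_comp_of_integrable (g := fun z : ℝ × ℝ => g z.1 * h z.2)
      (hg.mul_prod hh)
  exact hf.mul_prod h1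

lemma integral_prod_coords (f g h : ℝ → ℝ) :
    ∫ p : ℝ × Sp 2, f p.1 * (g (p.2 0) * h (p.2 1)) =
      (∫ t, f t) * ((∫ x, g x) * ∫ y, h y) := by
  have h1 : ∫ z : Sp 2, g (z 0) * h (z 1) = (∫ x, g x) * ∫ y, h y := by
    rw [← integral_prod_mul]
    exact measurePreserving_coords.integral_comp measurableEmbedding_coords
      (fun z : ℝ × ℝ => g z.1 * h z.2)
  rw [← h1]
  exact integral_prod_mul f (fun z : Sp 2 => g (z 0) * h (z 1))

lemma contDiff_mode (l : ℂ) (η : ℝ) {P P' : ℝ → Vec 3} (hP : ∀ x, HasDerivAt P (P' x) x)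
    (hP' : Continuous P') : ContDiff ℝ 1 (mode l η P) := by
  have hPc : Continuous P := continuous_iff_continuousAt.2 fun x => (hP x).continuousAt
  rw [contDiff_one_iff_fderiv]
  refine ⟨fun p => (hasFDerivAt_mode l η hP p).differentiableAt, ?_⟩
  have : fderiv ℝ (mode l η P) = fun p => modeFDeriv l η P P' p :=
    funext fun p => (hasFDerivAt_mode l η hP p).fderiv
  rw [this]
  exact continuous_modeFDeriv (X := ℝ × Sp 2) (P := fun _ => P) (P' := fun _ => P')
    continuous_const continuous_const (by fun_prop) (by fun_prop) continuous_id

lemma norm_phase_of_re_eq_zero {l : ℂ} (hl : l.re = 0) (η : ℝ) (p : ℝ × Sp 2) :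
    ‖phase l η p‖ = 1 := by
  rw [phase, Complex.norm_exp]
  simp [hl]

/-- The space-time profile `1_{|t - t₀| ≤ r} g(x) 1_{|y - y₀| ≤ r}`. -/
noncomputable def boxProfile (t₀ y₀ r : ℝ) (g : ℝ → ℝ) (p : ℝ × Sp 2) : ℝ :=
  (Icc (t₀ - r) (t₀ + r)).indicator (fun _ => (1 : ℝ)) p.1 *
    (g (p.2 0) * (Icc (y₀ - r) (y₀ + r)).indicator (fun _ => (1 : ℝ)) (p.2 1))

lemma integrable_indicator_Icc (a b c : ℝ) :
    Integrable ((Icc a b).indicator fun _ => c) :=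
  (integrable_indicator_iff measurableSet_Icc).2 (integrableOn_const (by simp))

lemma integrable_boxProfile (t₀ y₀ r : ℝ) {g : ℝ → ℝ} (hg : Integrable g) :
    Integrable (boxProfile t₀ y₀ r g) :=
  integrable_prod_coords (integrable_indicator_Icc _ _ _) hg (integrable_indicator_Icc _ _ _)

lemma integral_boxProfile (t₀ y₀ : ℝ) {r : ℝ} (hr : 0 ≤ r) (g : ℝ → ℝ) :
    ∫ p, boxProfile t₀ y₀ r g p = (2 * r) ^ 2 * ∫ x, g x := by
  have h : ∀ c : ℝ, ∫ s, (Icc (c - r) (c + r)).indicator (fun _ => (1 : ℝ)) s = 2 * r := by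
    intro c
    rw [integral_indicator measurableSet_Icc, setIntegral_const]
    simp only [Measure.real, Real.volume_Icc, smul_eq_mul, mul_one]
    rw [ENNReal.toReal_ofReal (by linarith)]
    ring
  simp only [boxProfile]
  rw [integral_prod_coords, h, h]
  ring

lemma setIntegral_sq_le_of_boxProfile {F : ℝ × Sp 2 → Vec 3} {t₀ y₀ r : ℝ} {g : ℝ → ℝ}
    (Ω : Set (ℝ × Sp 2)) (hr : 0 ≤ r) (hg : Integrable g)
    (h : ∀ p, ‖F p‖ ^ 2 ≤ boxProfile t₀ y₀ r g p) :
    ∫ p in Ω, ‖F p‖ ^ 2 ≤ (2 * r) ^ 2 * ∫ x, g x := by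
  rw [← integral_boxProfile t₀ y₀ hr g]
  exact (integral_mono_of_nonneg (Eventually.of_forall fun p => sq_nonneg _)
    (integrable_boxProfile t₀ y₀ r hg).integrableOn (Eventually.of_forall h)).trans
    (setIntegral_le_integral (integrable_boxProfile t₀ y₀ r hg)
      (Eventually.of_forall fun p => (sq_nonneg _).trans (h p)))

lemma le_setIntegral_sq_of_boxProfile {F : ℝ × Sp 2 → Vec 3} {t₀ y₀ r : ℝ} {g : ℝ → ℝ}
    {Ω : Set (ℝ × Sp 2)} (hr : 0 ≤ r) (hg : Integrable g) (hF : Integrable fun p => ‖F p‖ ^ 2)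
    (h : ∀ p, boxProfile t₀ y₀ r g p ≠ 0 → p ∈ Ω ∧ boxProfile t₀ y₀ r g p ≤ ‖F p‖ ^ 2) :
    (2 * r) ^ 2 * ∫ x, g x ≤ ∫ p in Ω, ‖F p‖ ^ 2 := by
  have h1 : ∫ p in Ω, boxProfile t₀ y₀ r g p = ∫ p, boxProfile t₀ y₀ r g p :=
    setIntegral_eq_integral_of_forall_compl_eq_zero fun p hpΩ => by
      by_contra hne
      exact hpΩ (h p hne).1
  rw [← integral_boxProfile t₀ y₀ hr g, ← h1]
  refine setIntegral_mono (integrable_boxProfile t₀ y₀ r hg).integrableOn hF.integrableOn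
    fun p => ?_
  by_cases hne : boxProfile t₀ y₀ r g p = 0
  · rw [hne]; positivity
  · exact (h p hne).2

lemma mem_box_of_mem_closedBall {p p₀ : ℝ × Sp 2} {R : ℝ} (h : p ∈ Metric.closedBall p₀ R) :
    p.1 ∈ Icc (p₀.1 - R) (p₀.1 + R) ∧ p.2 1 ∈ Icc (p₀.2 1 - R) (p₀.2 1 + R) := by
  have hd : dist p p₀ ≤ R := h
  have hd1 : |p.1 - p₀.1| ≤ R := (le_max_left _ _).trans hd
  have hd2 : |p.2 1 - p₀.2 1| ≤ R := by
    refine le_trans ?_ ((le_max_right _ _).trans hd)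
    rw [dist_eq_norm]
    exact PiLp.norm_apply_le (p.2 - p₀.2) 1
  rw [abs_le] at hd1 hd2
  exact ⟨⟨by linarith, by linarith⟩, ⟨by linarith, by linarith⟩⟩

lemma mem_closedBall_of_mem_box {p p₀ : ℝ × Sp 2} {r : ℝ} (hr : 0 ≤ r) (hx₀ : p₀.2 0 = 0)
    (h1 : p.1 ∈ Icc (p₀.1 - r) (p₀.1 + r)) (h2 : p.2 1 ∈ Icc (p₀.2 1 - r) (p₀.2 1 + r))
    (hx : |p.2 0| ≤ r) : p ∈ Metric.closedBall p₀ (2 * r) := by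
  have ht : dist p.1 p₀.1 ≤ 2 * r := by
    rw [Real.dist_eq, abs_le]; constructor <;> linarith [h1.1, h1.2]
  have hz : dist p.2 p₀.2 ≤ 2 * r := by
    rw [EuclideanSpace.dist_eq, Fin.sum_univ_two, hx₀]
    apply Real.sqrt_le_iff.2 ⟨by positivity, ?_⟩
    have d1 : dist (p.2 0) 0 ≤ r := by rwa [Real.dist_eq, sub_zero]
    have d2 : dist (p.2 1) (p₀.2 1) ≤ r := by
      rw [Real.dist_eq, abs_le]; constructor <;> linarith [h2.1, h2.2]
    have d3 := pow_le_pow_left₀ dist_nonneg d1 2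
    have d4 := pow_le_pow_left₀ dist_nonneg d2 2
    nlinarith
  exact Metric.mem_closedBall.2 (max_le ht hz)

lemma integral_exp_neg_half_mul_sq {η : ℝ} (hη : 0 < η) :
    η * ∫ x : ℝ, Real.exp (-(η / 2) * x ^ 2) = √(2 * Real.pi) * √η := by
  rw [integral_gaussian, show Real.pi / (η / 2) = 2 * Real.pi / η by field_simp,
    Real.sqrt_div' _ hη.le]
  have hs0 : √η ≠ 0 := (Real.sqrt_pos.2 hη).ne'
  have hss : √η * √η = η := Real.mul_self_sqrt hη.le
  field_simp
  rw [sq, hss]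

lemma integral_indicator_Icc_neg {q c : ℝ} (hq : 0 ≤ q) :
    ∫ x, (Icc (-q) q).indicator (fun _ => c) x = 2 * q * c := by
  rw [integral_indicator measurableSet_Icc, setIntegral_const]
  simp only [Measure.real, Real.volume_Icc, smul_eq_mul]
  rw [ENNReal.toReal_ofReal (by linarith)]
  ring

lemma integrable_norm_sq {u : ℝ × Sp 2 → Vec 3} (hu : Continuous u) (hc : HasCompactSupport u) :
    Integrable fun p => ‖u p‖ ^ 2 := by
  refine (hu.norm.pow 2).integrable_of_hasCompactSupport (hc.mono fun p hp h => hp ?_)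
  change ‖u p‖ ^ 2 = 0
  rw [h, norm_zero, zero_pow two_ne_zero]

set_option maxHeartbeats 400000 in
/-- The modes of large frequency, multiplied by `e^{-γ t}` with `γ = Re λ`, violate the energy
estimate: after multiplication with a cut-off `χ` they satisfy `(L + γ) u = [L, χ] u`,
which is bounded by a constant times the `L²` norm of the profile, whereas `γ` is large. -/
theorem not_localL2Estimate {α : ℝ} (h0 : 0 < α) (h1 : α < 1) {Ω : Set (ℝ × Sp 2)}
    (hΩ : IsOpen Ω) (hp : ∃ p ∈ Ω, p.2 0 = 0) :
    ¬ LocalL2Estimate (exampleSystem fun x => |x| ^ α) Ω := by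
  intro hL
  set A := exampleSystem fun x => |x| ^ α with hA
  have hAc : ∀ j, Continuous (A j) := continuous_exampleSystem (continuous_abs_rpow h0)
  obtain ⟨C, γ₀, hest⟩ := hL.of_contDiff_one hAc hΩ
  obtain ⟨p₀, hp₀, hx₀⟩ := hp
  obtain ⟨η₀, K, c, l, P, P', hη₀, hK, hc, -, hPc, hP'c, hlt, hder, hmode⟩ :=
    exists_growing_modes h0 h1
  obtain ⟨R, hR, hRΩ⟩ := Metric.nhds_basis_closedBall.mem_iff.1 (hΩ.mem_nhds hp₀)
  let χ : ContDiffBump p₀ := ⟨R / 2, R, by positivity, by linarith⟩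
  have hχ1 : ContDiff ℝ 1 χ := χ.contDiff
  have hχs : tsupport χ = Metric.closedBall p₀ R := χ.tsupport_eq
  obtain ⟨M, hM⟩ := (isCompact_closedBall p₀ R).exists_bound_of_continuousOn
    (((hχ1.continuous_fderiv one_ne_zero).norm.mul (continuous_coeffBound hAc)).continuousOn)
  set t₀ := p₀.1
  set y₀ := p₀.2 1
  set r := R / 4 with hr
  set a := (2 * r) ^ 2 * (c ^ 2 * 2) with ha
  set b := (2 * R) ^ 2 * (M ^ 2 * K ^ 2 * √(2 * Real.pi)) with hb
  have ha0 : 0 < a := by positivity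
  have hb0 : 0 ≤ b := by positivity
  obtain ⟨η, ⟨hη, hη1⟩, hη2, hη3⟩ := (((eventually_ge_atTop η₀).and
    (eventually_ge_atTop ((r⁻¹) ^ 2))).and ((hlt.eventually_ge_atTop γ₀).and
    (hlt.eventually_gt_atTop (|C| * √b / √a)))).exists
  have hη0 : 0 < η := by linarith
  obtain ⟨heq, hup, hlow⟩ := hmode η hη
  set γ := (l η).re with hγ
  set m : ℂ := Complex.I * (l η).im with hm
  have hlm : l η = γ + m := by rw [hm, hγ, mul_comm]; exact (Complex.re_add_im _).symm
  have hmre : m.re = 0 := by simp [hm]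
  have hγpos : 0 < γ := lt_of_le_of_lt (by positivity) hη3
  let u : ℝ × Sp 2 → Vec 3 := fun p => χ p • mode m η (P η) p
  have hP'η : Continuous (P' η) := hP'c.comp (Continuous.prodMk_right η)
  have hmC : ContDiff ℝ 1 (mode m η (P η)) := contDiff_mode m η (hder η) hP'η
  have huC : ContDiff ℝ 1 u := hχ1.smul hmC
  have hus : tsupport u ⊆ Metric.closedBall p₀ R := by
    rw [← hχs]; exact tsupport_smul_subset_left _ _
  have huc : HasCompactSupport u :=
    (isCompact_closedBall p₀ R).of_isClosed_subset (isClosed_tsupport _) hus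
  have hnm : ∀ p, ‖mode m η (P η) p‖ = ‖P η (p.2 0)‖ := fun p => by
    rw [mode, norm_smul, norm_phase_of_re_eq_zero hmre, one_mul]
  have hopm : ∀ p, op A (mode m η (P η)) p + γ • mode m η (P η) p = 0 := by
    intro p
    rw [op_of_modeFDeriv A m η (P η) (P' η) (hasFDerivAt_mode m η (hder η) p).fderiv, mode,
      ← smul_comm, ← smul_add]
    have h2 : m • P η (p.2 0) + Matrix.toEuclideanLin (A 0 p) (P' η (p.2 0)) +
        (Complex.I * η) • Matrix.toEuclideanLin (A 1 p) (P η (p.2 0)) + γ • P η (p.2 0) = 0 := by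
      have h3 := heq p
      rw [hlm, add_smul] at h3
      rw [← h3, Complex.coe_smul]
      abel
    rw [h2, smul_zero]
  have hop : ∀ p, op A u p + γ • u p = principalPart A p (fderiv ℝ χ p) (mode m η (P η) p) := by
    intro p
    have h2 := op_smul A (p := p) (hχ1.differentiable one_ne_zero p)
      (hmC.differentiable one_ne_zero p)
    have h3 : γ • u p = χ p • γ • mode m η (P η) p := smul_comm _ _ _
    have h4 : op A u p = _ := h2
    rw [h4, h3, add_right_comm, ← smul_add, hopm, smul_zero, zero_add]
  have hs0 : 0 < √η := Real.sqrt_pos.2 hη0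
  have hss : √η * √η = η := Real.mul_self_sqrt hη0.le
  have key := hest γ hη2 u huC huc (hus.trans hRΩ)
  -- the upper bound for `(L + γ) u`
  have hupper : ∫ p in Ω, ‖op A u p + γ • u p‖ ^ 2 ≤ b * √η := by
    set g : ℝ → ℝ := fun x => M ^ 2 * K ^ 2 * η * Real.exp (-(η / 2) * x ^ 2) with hg
    have hgi : Integrable g := (integrable_exp_neg_mul_sq (by positivity)).const_mul _
    have hgint : ∫ x, g x = M ^ 2 * K ^ 2 * (√(2 * Real.pi) * √η) := by
      rw [hg, integral_const_mul, ← integral_exp_neg_half_mul_sq hη0]; ring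
    refine (setIntegral_sq_le_of_boxProfile (t₀ := t₀) (y₀ := y₀) Ω hR.le hgi fun p => ?_).trans_eq
      (by rw [hgint, hb]; ring)
    rw [hop]
    by_cases hpB : p ∈ Metric.closedBall p₀ R
    · obtain ⟨e1, e2⟩ := mem_box_of_mem_closedBall hpB
      rw [boxProfile, indicator_of_mem e1, indicator_of_mem e2, one_mul, mul_one]
      have h2 : ‖principalPart A p (fderiv ℝ χ p) (mode m η (P η) p)‖ ≤
          M * (K * √η * Real.exp (-(η * p.2 0 ^ 2 / 4))) := by
        refine (norm_principalPart_le _ _ _ _).trans ?_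
        rw [hnm]
        have h3 := (le_abs_self _).trans (hM p hpB)
        exact mul_le_mul h3 (hup _) (norm_nonneg _) ((norm_nonneg _).trans (hM p hpB))
      calc _ ≤ (M * (K * √η * Real.exp (-(η * p.2 0 ^ 2 / 4)))) ^ 2 := by gcongr
        _ = M ^ 2 * K ^ 2 * (√η * √η) * Real.exp (-(η * p.2 0 ^ 2 / 4)) ^ 2 := by ring
        _ = g (p.2 0) := by
          rw [hss, ← Real.exp_nat_mul, hg]
          congr 2
          push_cast
          ring
    · have h2 : fderiv ℝ χ p = 0 :=
        image_eq_zero_of_notMem_tsupport fun h => hpB (hχs ▸ tsupport_fderiv_subset ℝ h)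
      have hnn : 0 ≤ boxProfile t₀ y₀ R g p := by
        unfold boxProfile
        refine mul_nonneg (indicator_nonneg (fun _ _ => zero_le_one) _)
          (mul_nonneg (by positivity) (indicator_nonneg (fun _ _ => zero_le_one) _))
      simpa [h2, principalPart] using hnn
  -- the lower bound for `u`
  have hlower : a * √η ≤ ∫ p in Ω, ‖u p‖ ^ 2 := by
    have hr0 : 0 < r := by positivity
    set q := (√η)⁻¹ with hq
    have hq0 : 0 < q := by positivity
    have hqr : q ≤ r := by
      rw [hq, inv_le_comm₀ hs0 hr0]
      exact Real.le_sqrt_of_sq_le hη1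
    have hqη : q * η = √η := by rw [hq, inv_mul_eq_iff_eq_mul₀ hs0.ne', hss]
    set g : ℝ → ℝ := (Icc (-q) q).indicator fun _ => c ^ 2 * η with hg
    have hgint : ∫ x, g x = c ^ 2 * 2 * √η := by
      rw [hg, integral_indicator_Icc_neg hq0.le, ← hqη]; ring
    have hui := integrable_norm_sq huC.continuous huc
    have hgi : Integrable g := integrable_indicator_Icc _ _ _
    have hagg : a * √η = (2 * r) ^ 2 * ∫ x, g x := by rw [hgint, ha]; ring
    suffices hbox : ∀ p, boxProfile t₀ y₀ r g p ≠ 0 →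
        p ∈ Ω ∧ boxProfile t₀ y₀ r g p ≤ ‖u p‖ ^ 2 by
      rw [hagg]
      exact le_setIntegral_sq_of_boxProfile hr0.le hgi hui hbox
    intro p hne
    have e1 : p.1 ∈ Icc (t₀ - r) (t₀ + r) := by
      by_contra h; exact hne (by simp [boxProfile, indicator_of_notMem h])
    have e2 : p.2 1 ∈ Icc (y₀ - r) (y₀ + r) := by
      by_contra h; exact hne (by simp [boxProfile, indicator_of_notMem h])
    have e3 : p.2 0 ∈ Icc (-q) q := by
      by_contra h; exact hne (by simp [boxProfile, hg, indicator_of_notMem h])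
    have hx : |p.2 0| ≤ q := abs_le.2 e3
    have hmem : p ∈ Metric.closedBall p₀ (R / 2) := by
      have := mem_closedBall_of_mem_box hr0.le hx₀ e1 e2 (hx.trans hqr)
      rwa [show 2 * r = R / 2 by rw [hr]; ring] at this
    refine ⟨hRΩ (Metric.closedBall_subset_closedBall (by linarith) hmem), ?_⟩
    have hχp : χ p = 1 := χ.one_of_mem_closedBall hmem
    have hx2 : η * p.2 0 ^ 2 ≤ 1 := by
      have : p.2 0 ^ 2 ≤ q ^ 2 := by rw [← sq_abs]; gcongr
      calc η * p.2 0 ^ 2 ≤ η * q ^ 2 := by gcongr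
        _ = 1 := by rw [hq, inv_pow, Real.sq_sqrt hη0.le]; field_simp
    have h5 := hlow _ hx2
    rw [boxProfile, indicator_of_mem e1, indicator_of_mem e2, hg, indicator_of_mem e3, one_mul,
      mul_one]
    have hup1 : ‖u p‖ = ‖P η (p.2 0)‖ := by simp only [u, hχp, one_smul, hnm]
    rw [hup1]
    calc c ^ 2 * η = (c * √η) ^ 2 := by rw [mul_pow, Real.sq_sqrt hη0.le]
      _ ≤ _ := by gcongr
  have hfin : γ * √a ≤ |C| * √b := by
    have hss0 : 0 < √√η := Real.sqrt_pos.2 hs0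
    refine le_of_mul_le_mul_right ?_ hss0
    calc γ * √a * √√η = γ * √(a * √η) := by rw [Real.sqrt_mul ha0.le]; ring
      _ ≤ γ * √(∫ p in Ω, ‖u p‖ ^ 2) := by gcongr
      _ ≤ C * √(∫ p in Ω, ‖op A u p + γ • u p‖ ^ 2) := key
      _ ≤ |C| * √(b * √η) := by
          have := le_abs_self C
          gcongr
      _ = |C| * √b * √√η := by rw [Real.sqrt_mul hb0]; ring
  rw [div_lt_iff₀ (Real.sqrt_pos.2 ha0)] at hη3
  exact absurd hfin (not_le.2 hη3)

end HypSys

/-! ### Superposition of modes -/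

namespace HypSys

open Filter Topology FourierTransform SchwartzMap

lemma lintegral_enorm_sq {X F : Type*} [MeasureSpace X] [NormedAddCommGroup F] (φ : X → F) :
    ∫⁻ x, ‖φ x‖ₑ ^ 2 = eLpNorm φ 2 volume ^ 2 := by
  rw [eLpNorm_eq_lintegral_rpow_enorm_toReal two_ne_zero ENNReal.ofNat_ne_top,
    ← ENNReal.rpow_natCast (_ ^ _), ← ENNReal.rpow_mul]
  simp

section plancherel

variable {F : Type*} [NormedAddCommGroup F] [InnerProductSpace ℂ F] [CompleteSpace F]

/-- On `L¹ ∩ L²` the Fourier transform of `L²` is given by the Fourier integral: both have the same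
integral against every test function. -/
lemma fourier_toLp_ae_eq {f : ℝ → F} (h1 : Integrable f) (h2 : MemLp f 2) :
    (𝓕 (h2.toLp f) : Lp F 2 (volume : Measure ℝ)) =ᵐ[volume] 𝓕 f := by
  have hcont : Continuous (𝓕 f) := VectorFourier.fourierIntegral_continuous
    Real.continuous_fourierChar (by exact continuous_inner) h1
  refine ae_eq_of_integral_contDiff_smul_eq ((Lp.memLp _).locallyIntegrable one_le_two)
    hcont.locallyIntegrable fun g hg hgc => ?_
  have hgc' : HasCompactSupport fun x => (g x : ℂ) := hgc.comp_left (g := Complex.ofReal) rfl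
  let G : 𝓢(ℝ, ℂ) := hgc'.toSchwartzMap (Complex.ofRealCLM.contDiff.comp hg)
  have hG : ∀ x, G x = g x := fun x => rfl
  have e1 : ∀ φ : ℝ → F, ∫ x, g x • φ x = ∫ x, G x • φ x := fun φ => by
    simp only [hG, Complex.coe_smul]
  rw [e1, e1, ← Lp.toTemperedDistribution_apply, ← Lp.fourier_toTemperedDistribution_eq,
    TemperedDistribution.fourier_apply, Lp.toTemperedDistribution_apply]
  have e2 : ∫ x, (𝓕 G) x • (h2.toLp f) x = ∫ x, (𝓕 G) x • f x :=
    integral_congr_ae (h2.coeFn_toLp.mono fun x hx => by simp only [hx])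
  rw [e2, SchwartzMap.fourier_coe]
  simpa using! VectorFourier.integral_fourierIntegral_smul_eq_flip (L := innerₗ ℝ)
    Real.continuous_fourierChar continuous_inner G.integrable h1

lemma lintegral_enorm_sq_fourier {f : ℝ → F} (h1 : Integrable f) (h2 : MemLp f 2) :
    ∫⁻ w, ‖𝓕 f w‖ₑ ^ 2 = ∫⁻ x, ‖f x‖ₑ ^ 2 := by
  have h : eLpNorm (𝓕 f) 2 volume = eLpNorm f 2 volume := by
    rw [← eLpNorm_congr_ae (fourier_toLp_ae_eq h1 h2), ← eLpNorm_congr_ae h2.coeFn_toLp]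
    have := Lp.norm_fourier_eq (h2.toLp f)
    rw [Lp.norm_def, Lp.norm_def,
      ENNReal.toReal_eq_toReal_iff' (Lp.eLpNorm_ne_top _) (Lp.eLpNorm_ne_top _)] at this
    exact this
  rw [lintegral_enorm_sq, lintegral_enorm_sq, h]

lemma lintegral_comp_mul_left {a : ℝ} (ha : a ≠ 0) (g : ℝ → ENNReal) :
    ∫⁻ x, g (a * x) = ENNReal.ofReal |a⁻¹| * ∫⁻ x, g x := by
  have hm : MeasurableEmbedding fun x : ℝ => a * x :=
    (Homeomorph.mulLeft₀ a ha).measurableEmbedding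
  rw [← hm.lintegral_map, Real.map_volume_mul_left ha, lintegral_smul_measure, smul_eq_mul]

/-- Plancherel's formula for `∫ e^{i η y} f(η) dη`, which is the Fourier transform of `f` at
`-y / (2 π)`. -/
lemma lintegral_enorm_sq_integral_exp {f : ℝ → F} (h1 : Integrable f) (h2 : MemLp f 2) :
    ∫⁻ y : ℝ, ‖∫ η : ℝ, Complex.exp (Complex.I * η * y) • f η‖ₑ ^ 2 =
      ENNReal.ofReal (2 * Real.pi) * ∫⁻ η, ‖f η‖ₑ ^ 2 := by
  have hpi := Real.pi_pos
  have e : ∀ y : ℝ, ∫ η : ℝ, Complex.exp (Complex.I * η * y) • f η =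
      𝓕 f (-(2 * Real.pi)⁻¹ * y) := by
    intro y
    rw [Real.fourier_real_eq_integral_exp_smul]
    congr with η
    congr 2
    push_cast
    field_simp
  simp only [e]
  rw [lintegral_comp_mul_left (by simp [hpi.ne']) (fun w => ‖𝓕 f w‖ₑ ^ 2),
    lintegral_enorm_sq_fourier h1 h2]
  congr 2
  rw [inv_neg, inv_inv, abs_neg, abs_of_pos (by positivity)]

end plancherel

lemma continuous_setIntegral {X F : Type*} [TopologicalSpace X] [FirstCountableTopology X]
    [LocallyCompactSpace X] [NormedAddCommGroup F] [NormedSpace ℝ F] {J : Set ℝ} (hJ : IsCompact J)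
    {f : X → ℝ → F} (hf : Continuous f.uncurry) : Continuous fun p => ∫ η in J, f p η :=
  continuous_parametric_integral_of_continuous hf hJ

/-- Differentiation of an integral over a compact set, with jointly continuous integrand. -/
lemma hasFDerivAt_setIntegral {E F : Type*} [NormedAddCommGroup E] [NormedSpace ℝ E]
    [ProperSpace E] [NormedAddCommGroup F] [NormedSpace ℝ F] [CompleteSpace F]
    {J : Set ℝ} (hJ : IsCompact J) {f : E → ℝ → F} {f' : E → ℝ → E →L[ℝ] F}
    (hf' : Continuous f'.uncurry) (hfc : ∀ p, Continuous (f p))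
    (hd : ∀ p η, HasFDerivAt (fun q => f q η) (f' p η) p) (p : E) :
    HasFDerivAt (fun q => ∫ η in J, f q η) (∫ η in J, f' p η) p := by
  obtain ⟨M, hM⟩ := ((isCompact_closedBall p 1).prod hJ).exists_bound_of_continuousOn
    hf'.continuousOn
  refine hasFDerivAt_integral_of_dominated_of_fderiv_le (bound := fun _ => M)
    (Metric.closedBall_mem_nhds p one_pos)
    (Eventually.of_forall fun q => (hfc q).aestronglyMeasurable)
    ((hfc p).continuousOn.integrableOn_compact hJ)
    (hf'.comp (Continuous.prodMk_right p)).aestronglyMeasurable ?_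
    (integrableOn_const hJ.measure_lt_top.ne) (Eventually.of_forall fun η q _ => hd q η)
  rw [ae_restrict_iff' hJ.measurableSet]
  exact Eventually.of_forall fun η hη q hq => hM (q, η) ⟨hq, hη⟩

/-- `L u` at the point `p`, as a linear map of the derivative of `u` at `p`. -/
noncomputable def opL {d N : ℕ} (A : Coeffs d N) (p : ℝ × Sp d) :
    (ℝ × Sp d →L[ℝ] Vec N) →L[ℝ] Vec N :=
  ContinuousLinearMap.apply ℝ (Vec N) (1, 0) +
    ∑ j, (((Matrix.toEuclideanLin (A j p)).restrictScalars ℝ).toContinuousLinearMap) ∘L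
      ContinuousLinearMap.apply ℝ (Vec N) (0, EuclideanSpace.single j 1)

lemma op_eq_opL {d N : ℕ} (A : Coeffs d N) (u : ℝ × Sp d → Vec N) (p : ℝ × Sp d) :
    op A u p = opL A p (fderiv ℝ u p) := by
  simp [op, opL, dt, dx]

section superposition

variable {J : Set ℝ} {l : ℝ → ℂ} {P P' : ℝ → ℝ → Vec 3}

/-- The superposition `∫_J e^{l(η) t + i η y} P(η, x) dη` of modes. -/
noncomputable def superpose (J : Set ℝ) (l : ℝ → ℂ) (P : ℝ → ℝ → Vec 3) (p : ℝ × Sp 2) : Vec 3 :=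
  ∫ η in J, mode (l η) η (P η) p

lemma continuous_uncurry_modeFDeriv (hl : Continuous l) (hP : Continuous P.uncurry)
    (hP' : Continuous P'.uncurry) :
    Continuous (fun (p : ℝ × Sp 2) (η : ℝ) => modeFDeriv (l η) η (P η) (P' η) p).uncurry :=
  continuous_modeFDeriv (X := (ℝ × Sp 2) × ℝ) (l := fun z => l z.2) (η := fun z => z.2)
    (P := fun z => P z.2) (P' := fun z => P' z.2) (p := fun z => z.1) (hl.comp continuous_snd)
    continuous_snd (hP.comp (f := fun z : (ℝ × Sp 2) × ℝ => (z.2, z.1.2 0)) (by fun_prop))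
    (hP'.comp (f := fun z : (ℝ × Sp 2) × ℝ => (z.2, z.1.2 0)) (by fun_prop)) continuous_fst

lemma continuous_mode_param (hl : Continuous l) (hP : Continuous P.uncurry) (p : ℝ × Sp 2) :
    Continuous fun η => mode (l η) η (P η) p := by
  have h1 : Continuous fun η => P η (p.2 0) := hP.comp (Continuous.prodMk_left _)
  unfold mode phase
  fun_prop

lemma hasFDerivAt_superpose (hJ : IsCompact J) (hl : Continuous l) (hP : Continuous P.uncurry)
    (hP' : Continuous P'.uncurry) (hd : ∀ η x, HasDerivAt (P η) (P' η x) x) (p : ℝ × Sp 2) :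
    HasFDerivAt (superpose J l P) (∫ η in J, modeFDeriv (l η) η (P η) (P' η) p) p :=
  hasFDerivAt_setIntegral hJ (continuous_uncurry_modeFDeriv hl hP hP')
    (continuous_mode_param hl hP) (fun q η => hasFDerivAt_mode (l η) η (hd η) q) p

lemma contDiff_superpose (hJ : IsCompact J) (hl : Continuous l) (hP : Continuous P.uncurry)
    (hP' : Continuous P'.uncurry) (hd : ∀ η x, HasDerivAt (P η) (P' η x) x) :
    ContDiff ℝ 1 (superpose J l P) := by
  rw [contDiff_one_iff_fderiv]
  have h := hasFDerivAt_superpose hJ hl hP hP' hd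
  refine ⟨fun p => (h p).differentiableAt, ?_⟩
  rw [funext fun p => (h p).fderiv]
  exact continuous_setIntegral hJ (continuous_uncurry_modeFDeriv hl hP hP')

lemma op_superpose (hJ : IsCompact J) (hl : Continuous l) (hP : Continuous P.uncurry)
    (hP' : Continuous P'.uncurry) (hd : ∀ η x, HasDerivAt (P η) (P' η x) x) {A : Coeffs 2 3}
    (hA : ∀ η ∈ J, ∀ p : ℝ × Sp 2, l η • P η (p.2 0) +
      Matrix.toEuclideanLin (A 0 p) (P' η (p.2 0)) +
      (Complex.I * η) • Matrix.toEuclideanLin (A 1 p) (P η (p.2 0)) = 0) (p : ℝ × Sp 2) :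
    op A (superpose J l P) p = 0 := by
  have hc : Continuous fun η => modeFDeriv (l η) η (P η) (P' η) p :=
    continuous_modeFDeriv (p := fun _ => p) hl continuous_id
      (hP.comp (Continuous.prodMk_left _)) (hP'.comp (Continuous.prodMk_left _)) continuous_const
  have hi : IntegrableOn (fun η => modeFDeriv (l η) η (P η) (P' η) p) J :=
    hc.continuousOn.integrableOn_compact hJ
  have hcomm : opL A p (∫ η in J, modeFDeriv (l η) η (P η) (P' η) p) =
      ∫ η in J, opL A p (modeFDeriv (l η) η (P η) (P' η) p) :=
    ((opL A p).integral_comp_comm hi).symm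
  rw [op_eq_opL, (hasFDerivAt_superpose hJ hl hP hP' hd p).fderiv, hcomm]
  refine setIntegral_eq_zero_of_forall_eq_zero fun η hη => ?_
  have hm := (hasFDerivAt_mode (l η) η (hd η) p).fderiv
  rw [← hm, ← op_eq_opL, op_of_modeFDeriv A _ _ _ _ hm, hA η hη p, smul_zero]

/-- The function `∫_J m(η) e^{i η y} P(η, x) dη` of the space variables. -/
noncomputable def packet (J : Set ℝ) (P : ℝ → ℝ → Vec 3) (m : ℝ → ℂ) (z : Sp 2) : Vec 3 :=
  ∫ η in J, Complex.exp (Complex.I * (η : ℝ) * z 1) • m η • P η (z 0)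

lemma superpose_eq_packet (J : Set ℝ) (l : ℝ → ℂ) (P : ℝ → ℝ → Vec 3) (t : ℝ) (z : Sp 2) :
    superpose J l P (t, z) = packet J P (fun η => Complex.exp (l η * t)) z := by
  simp only [superpose, packet, mode, phase, smul_smul, ← Complex.exp_add]
  congr with η
  ring_nf

lemma continuous_packet (hJ : IsCompact J) (hP : Continuous P.uncurry) {m : ℝ → ℂ}
    (hm : Continuous m) : Continuous (packet J P m) := by
  have h1 : Continuous fun q : Sp 2 × ℝ => P q.2 (q.1 0) :=
    hP.comp (f := fun q : Sp 2 × ℝ => (q.2, q.1 0)) (by fun_prop)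
  have h2 : Continuous
      (fun (z : Sp 2) (η : ℝ) => Complex.exp (Complex.I * η * z 1) • m η • P η (z 0)).uncurry := by
    unfold Function.uncurry
    fun_prop
  exact continuous_setIntegral hJ h2

lemma packet_sub (hJ : IsCompact J) (hP : Continuous P.uncurry) {m m' : ℝ → ℂ}
    (hm : Continuous m) (hm' : Continuous m') (z : Sp 2) :
    packet J P (fun η => m η - m' η) z = packet J P m z - packet J P m' z := by
  have h1 : Continuous fun η => P η (z 0) := hP.comp (Continuous.prodMk_left _)
  have hi : ∀ m : ℝ → ℂ, Continuous m →
      IntegrableOn (fun η : ℝ => Complex.exp (Complex.I * η * z 1) • m η • P η (z 0)) J :=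
    fun m hm => by
      have h2 : Continuous fun η : ℝ => Complex.exp (Complex.I * η * z 1) • m η • P η (z 0) := by
        fun_prop
      exact h2.continuousOn.integrableOn_compact hJ
  simp only [packet]
  rw [← integral_sub (hi m hm) (hi m' hm')]
  simp only [sub_smul, smul_sub]

/-- Plancherel's formula in the variable `y` for a packet. -/
lemma lintegral_enorm_sq_packet (hJ : IsCompact J) (hP : Continuous P.uncurry) {m : ℝ → ℂ}
    (hm : Continuous m) :
    ∫⁻ z, ‖packet J P m z‖ₑ ^ 2 =
      ∫⁻ x, ENNReal.ofReal (2 * Real.pi) * ∫⁻ η in J, ‖m η • P η x‖ₑ ^ 2 := by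
  let G : ℝ × ℝ → ENNReal := fun q =>
    ‖∫ η in J, Complex.exp (Complex.I * (η : ℝ) * q.2) • m η • P η q.1‖ₑ ^ 2
  have hG : ∫⁻ z, ‖packet J P m z‖ₑ ^ 2 = ∫⁻ q, G q :=
    measurePreserving_coords.lintegral_comp_emb measurableEmbedding_coords G
  have hGm : Measurable G := by
    have h1 : Continuous fun q : (ℝ × ℝ) × ℝ => P q.2 q.1.1 :=
      hP.comp (f := fun q : (ℝ × ℝ) × ℝ => (q.2, q.1.1)) (by fun_prop)
    have h2 : Continuous (fun (q : ℝ × ℝ) (η : ℝ) =>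
        Complex.exp (Complex.I * η * q.2) • m η • P η q.1).uncurry := by
      unfold Function.uncurry
      fun_prop
    exact (continuous_setIntegral hJ h2).enorm.measurable.pow_const 2
  rw [hG, Measure.volume_eq_prod, lintegral_prod _ hGm.aemeasurable]
  refine lintegral_congr fun x => ?_
  have hc : Continuous fun η => m η • P η x := by
    have h1 : Continuous fun η => P η x := hP.comp (Continuous.prodMk_left _)
    fun_prop
  obtain ⟨B, hB⟩ := hJ.exists_bound_of_continuousOn hc.continuousOn
  set f : ℝ → Vec 3 := J.indicator fun η => m η • P η x with hf
  have hi : Integrable f :=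
    (integrable_indicator_iff hJ.measurableSet).2 (hc.continuousOn.integrableOn_compact hJ)
  have hb : ∀ᵐ η, ‖f η‖ ≤ B ⊔ 0 := Eventually.of_forall fun η => by
    by_cases hη : η ∈ J
    · rw [hf, indicator_of_mem hη]; exact (hB η hη).trans (le_max_left _ _)
    · rw [hf, indicator_of_notMem hη, norm_zero]; exact le_max_right _ _
  have h2 : MemLp f 2 := by
    have h3 : MemLp (fun η => m η • P η x) 2 (volume.restrict J) := by
      have : IsFiniteMeasure (volume.restrict J) := ⟨by simpa using hJ.measure_lt_top⟩
      exact MemLp.of_bound hc.aestronglyMeasurable B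
        ((ae_restrict_iff' hJ.measurableSet).2 (Eventually.of_forall hB))
    exact (memLp_indicator_iff_restrict hJ.measurableSet).2 h3
  have key := lintegral_enorm_sq_integral_exp hi h2
  have e1 : ∀ y : ℝ, ∫ η : ℝ, Complex.exp (Complex.I * η * y) • f η =
      ∫ η in J, Complex.exp (Complex.I * (η : ℝ) * y) • m η • P η x := by
    intro y
    rw [← integral_indicator hJ.measurableSet]
    congr with η
    by_cases hη : η ∈ J <;> simp [hf, hη]
  have e2 : ∫⁻ η, ‖f η‖ₑ ^ 2 = ∫⁻ η in J, ‖m η • P η x‖ₑ ^ 2 := by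
    rw [← lintegral_indicator hJ.measurableSet]
    congr with η
    by_cases hη : η ∈ J <;> simp [hf, hη]
  simp only [e1, e2] at key
  exact key

end superposition

end HypSys

/-! ### Exponentially growing solutions -/

namespace HypSys

open Filter Topology

section packets

variable {J : Set ℝ} {P : ℝ → ℝ → Vec 3}

/-- By Plancherel's formula, a pointwise bound between amplitudes `m`, `m'` gives the same bound
between the `L²` norms of the packets. -/
lemma eLpNorm_packet_le (hJ : IsCompact J) (hP : Continuous P.uncurry) {m m' : ℝ → ℂ}
    (hm : Continuous m) (hm' : Continuous m') {C : ℝ} (hC : 0 ≤ C)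
    (h : ∀ η ∈ J, ‖m η‖ ≤ C * ‖m' η‖) :
    eLpNorm (packet J P m) 2 volume ≤ ENNReal.ofReal C * eLpNorm (packet J P m') 2 volume := by
  refine (ENNReal.pow_right_strictMono two_ne_zero).le_iff_le.1 ?_
  rw [mul_pow, ← lintegral_enorm_sq, ← lintegral_enorm_sq, lintegral_enorm_sq_packet hJ hP hm,
    lintegral_enorm_sq_packet hJ hP hm', ← lintegral_const_mul' _ _ (by finiteness)]
  refine lintegral_mono fun x => ?_
  rw [mul_left_comm]
  gcongr
  rw [← lintegral_const_mul' _ _ (by finiteness)]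
  refine setLIntegral_mono' hJ.measurableSet fun η hη => ?_
  rw [← mul_pow]
  gcongr
  rw [enorm_smul, enorm_smul, ← mul_assoc]
  gcongr
  rw [← ofReal_norm, ← ofReal_norm, ← ENNReal.ofReal_mul hC]
  exact ENNReal.ofReal_le_ofReal (h η hη)

lemma memLp_packet (hJ : IsCompact J) (hP : Continuous P.uncurry) {m : ℝ → ℂ} (hm : Continuous m)
    {B : ℝ → ℝ} (hB : Integrable fun x => B x ^ 2) (hPB : ∀ η ∈ J, ∀ x, ‖P η x‖ ≤ B x) :
    MemLp (packet J P m) 2 volume := by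
  refine ⟨(continuous_packet hJ hP hm).aestronglyMeasurable, ?_⟩
  obtain ⟨M, hM⟩ := hJ.exists_bound_of_continuousOn hm.continuousOn
  have key : eLpNorm (packet J P m) 2 volume ^ 2 < ⊤ := by
    rw [← lintegral_enorm_sq, lintegral_enorm_sq_packet hJ hP hm]
    calc ∫⁻ x, ENNReal.ofReal (2 * Real.pi) * ∫⁻ η in J, ‖m η • P η x‖ₑ ^ 2
        ≤ ∫⁻ x, ENNReal.ofReal (2 * Real.pi) *
            (ENNReal.ofReal (M ^ 2) * volume J) * ENNReal.ofReal (B x ^ 2) := by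
          refine lintegral_mono fun x => ?_
          rw [mul_assoc]
          gcongr
          refine (setLIntegral_mono' (g := fun _ => ENNReal.ofReal (M ^ 2) *
            ENNReal.ofReal (B x ^ 2)) hJ.measurableSet fun η hη => ?_).trans
              (by rw [setLIntegral_const]; exact (mul_right_comm _ _ _).le)
          rw [← ofReal_norm, ← ENNReal.ofReal_pow (norm_nonneg _),
            ← ENNReal.ofReal_mul (sq_nonneg _), norm_smul, mul_pow]
          gcongr
          · exact hM η hη
          · exact hPB η hη x
      _ < ⊤ := by
          rw [lintegral_const_mul' _ _ (by have := hJ.measure_lt_top (μ := volume); finiteness)]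
          have h1 := hB.lintegral_lt_top
          have h2 := hJ.measure_lt_top (μ := volume)
          finiteness
  by_contra h
  rw [not_lt, top_le_iff] at h
  simp [h] at key

lemma eLpNorm_packet_one_ne_zero (hJ : IsCompact J) (hP : Continuous P.uncurry)
    (hJ0 : volume J ≠ 0) {I : Set ℝ} (hI : MeasurableSet I) (hI0 : volume I ≠ 0) {c : ℝ}
    (hc : 0 < c) (h : ∀ η ∈ J, ∀ x ∈ I, c ≤ ‖P η x‖) :
    eLpNorm (packet J P fun _ => 1) 2 volume ≠ 0 := by
  have key : 0 < eLpNorm (packet J P fun _ => 1) 2 volume ^ 2 := by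
    rw [← lintegral_enorm_sq, lintegral_enorm_sq_packet hJ hP continuous_const]
    calc 0 < ENNReal.ofReal (2 * Real.pi) * (ENNReal.ofReal c ^ 2 * volume J) * volume I := by
          have := Real.pi_pos
          positivity
      _ = ∫⁻ _ in I, ENNReal.ofReal (2 * Real.pi) * ∫⁻ _ in J, ENNReal.ofReal c ^ 2 := by
          rw [setLIntegral_const, setLIntegral_const]
      _ ≤ ∫⁻ x in I, ENNReal.ofReal (2 * Real.pi) * ∫⁻ η in J, ‖(1 : ℂ) • P η x‖ₑ ^ 2 := by
          refine setLIntegral_mono' hI fun x hx => ?_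
          refine mul_le_mul_right ?_ _
          refine setLIntegral_mono' hJ.measurableSet fun η hη => ?_
          rw [one_smul, ← ofReal_norm]
          gcongr
          exact h η hη x hx
      _ ≤ _ := setLIntegral_le_lintegral _ _
  intro h0
  simp [h0] at key

end packets

/-- The superposition of the modes with frequencies in an interval on which `Re λ ≥ μ`. -/
theorem exists_growing_solution {α : ℝ} (h0 : 0 < α) (h1 : α < 1) (μ : ℝ) :
    ∃ (U : ℝ × Sp 2 → Vec 3) (u : ℝ → L2 2 3), ContDiff ℝ 1 U ∧
      (∀ p, op (exampleSystem fun x => |x| ^ α) U p = 0) ∧ Continuous u ∧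
      (∀ t : ℝ, u t =ᵐ[volume] fun z => U (t, z)) ∧ u 0 ≠ 0 ∧
      ∀ t : ℝ, 0 ≤ t → Real.exp (μ * t) * ‖u 0‖ ≤ ‖u t‖ := by
  obtain ⟨η₀, K, c, l, P, P', hη₀, hK, hc, hl, hP, hP', hre, hd, hmode⟩ :=
    exists_growing_modes h0 h1
  obtain ⟨η₁, hη₁⟩ := eventually_atTop.1
    ((hre.eventually_ge_atTop μ).and (eventually_ge_atTop η₀))
  have hη₁0 : 1 ≤ η₁ := hη₀.trans (hη₁ η₁ le_rfl).2
  set J := Icc η₁ (η₁ + 1) with hJdef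
  have hJ : IsCompact J := isCompact_Icc
  have hJμ : ∀ η ∈ J, μ ≤ (l η).re := fun η hη => (hη₁ η hη.1).1
  have hJη : ∀ η ∈ J, η₀ ≤ η := fun η hη => (hη₁ η hη.1).2
  have hm : ∀ t : ℝ, Continuous fun η => Complex.exp (l η * t) := fun t => by fun_prop
  -- the profiles are dominated by a single Gaussian and bounded below near `x = 0`
  have hPB : ∀ η ∈ J, ∀ x, ‖P η x‖ ≤ K * √(η₁ + 1) * Real.exp (-(x ^ 2 / 4)) := by
    intro η hη x
    refine ((hmode η (hJη η hη)).2.1 x).trans ?_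
    have : 1 ≤ η := hη₁0.trans hη.1
    gcongr
    · exact hη.2
    · nlinarith [sq_nonneg x]
  have hB : Integrable fun x : ℝ => (K * √(η₁ + 1) * Real.exp (-(x ^ 2 / 4))) ^ 2 := by
    refine ((integrable_exp_neg_mul_sq (b := 1 / 2) (by norm_num)).const_mul
      ((K * √(η₁ + 1)) ^ 2)).congr (Eventually.of_forall fun x => ?_)
    simp only [mul_pow, ← Real.exp_nat_mul]
    ring_nf
  have hlow : ∀ η ∈ J, ∀ x ∈ Icc (0 : ℝ) (√(η₁ + 1))⁻¹, c ≤ ‖P η x‖ := by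
    intro η hη x hx
    have h1η : 1 ≤ η := hη₁0.trans hη.1
    refine le_trans ?_ ((hmode η (hJη η hη)).2.2 x ?_)
    · exact le_mul_of_one_le_right hc.le (Real.one_le_sqrt.2 h1η)
    · have h2 : x ^ 2 ≤ (√(η₁ + 1))⁻¹ ^ 2 := by gcongr; exacts [hx.1, hx.2]
      rw [inv_pow, Real.sq_sqrt (by linarith)] at h2
      calc η * x ^ 2 ≤ (η₁ + 1) * (η₁ + 1)⁻¹ := by gcongr; exact hη.2
        _ = 1 := mul_inv_cancel₀ (by linarith)
  have hmem : ∀ t : ℝ, MemLp (packet J P fun η => Complex.exp (l η * t)) 2 volume := fun t =>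
    memLp_packet hJ hP (hm t) hB hPB
  have hmem1 : MemLp (packet J P fun _ => 1) 2 volume :=
    memLp_packet hJ hP continuous_const hB hPB
  have hU : ∀ t : ℝ, (packet J P fun η => Complex.exp (l η * t)) =
      fun z => superpose J l P (t, z) := fun t =>
    funext fun z => (superpose_eq_packet J l P t z).symm
  refine ⟨superpose J l P, fun t => (hmem t).toLp _, contDiff_superpose hJ hl hP hP' hd,
    op_superpose hJ hl hP hP' hd fun η hη => (hmode η (hJη η hη)).1, ?_, fun t => ?_, ?_, ?_⟩
  · refine continuous_iff_continuousAt.2 fun t₀ => Metric.tendsto_nhds.2 fun ε hε => ?_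
    set N := (eLpNorm (packet J P fun _ => 1) 2 volume).toReal with hN
    have hδ : 0 < ε / (N + 1) := by positivity
    have hev : ∀ᶠ t : ℝ in 𝓝 t₀, ∀ η ∈ J,
        ‖Complex.exp (l η * t) - Complex.exp (l η * t₀)‖ < ε / (N + 1) := by
      refine hJ.eventually_forall_of_forall_eventually fun η _ => ?_
      have hcont : Continuous fun q : ℝ × ℝ =>
        ‖Complex.exp (l q.2 * q.1) - Complex.exp (l q.2 * t₀)‖ := by fun_prop
      exact (hcont.tendsto (t₀, η)).eventually_lt_const (by simpa using hδ)
    filter_upwards [hev] with t ht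
    rw [dist_eq_norm, ← MemLp.toLp_sub, Lp.norm_toLp]
    have heq : ((packet J P fun η => Complex.exp (l η * t)) -
        packet J P fun η => Complex.exp (l η * t₀)) =
        packet J P fun η => Complex.exp (l η * t) - Complex.exp (l η * t₀) :=
      funext fun z => (packet_sub hJ hP (hm t) (hm t₀) z).symm
    rw [heq]
    have hle := eLpNorm_packet_le hJ hP ((hm t).sub (hm t₀)) (continuous_const (y := (1 : ℂ)))
      hδ.le (fun η hη => by simpa using (ht η hη).le)
    refine (ENNReal.toReal_mono (by have := hmem1.2; finiteness) hle).trans_lt ?_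
    rw [ENNReal.toReal_mul, ENNReal.toReal_ofReal hδ.le, ← hN, div_mul_eq_mul_div,
      div_lt_iff₀ (by positivity)]
    nlinarith
  · rw [← hU t]
    exact (hmem t).coeFn_toLp
  · rw [← norm_ne_zero_iff, Lp.norm_toLp]
    have h := eLpNorm_packet_one_ne_zero hJ hP (by simp [hJdef]) measurableSet_Icc
      (by simp; positivity) hc hlow
    simpa [ENNReal.toReal_eq_zero_iff] using And.intro h hmem1.2.ne
  · intro t ht
    rw [Lp.norm_toLp, Lp.norm_toLp]
    have hle := eLpNorm_packet_le hJ hP (hm 0) (hm t) (Real.exp_pos (-(μ * t))).le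
      (fun η hη => by
        rw [Complex.norm_exp, Complex.norm_exp, ← Real.exp_add]
        refine Real.exp_le_exp.2 ?_
        have := mul_le_mul_of_nonneg_right (hJμ η hη) ht
        simp
        linarith)
    have := ENNReal.toReal_mono (by have := (hmem t).2; finiteness) hle
    rw [ENNReal.toReal_mul, ENNReal.toReal_ofReal (Real.exp_pos _).le] at this
    calc _ ≤ Real.exp (μ * t) * (Real.exp (-(μ * t)) * _) := by gcongr
      _ = _ := by rw [← mul_assoc, ← Real.exp_add]; simp

end HypSys

/-! ### Classical solutions are weak solutions, and ill-posedness -/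

namespace HypSys

section weak

variable {d N : ℕ}

/-- Integration by parts against a compactly supported function. -/
lemma integral_inner_fderiv_left {ψ U : ℝ × Sp d → Vec N} (hψ : ContDiff ℝ 1 ψ)
    (hc : HasCompactSupport ψ) (hU : ContDiff ℝ 1 U) (v : ℝ × Sp d) :
    ∫ p, inner ℂ (fderiv ℝ ψ p v) (U p) = -∫ p, inner ℂ (ψ p) (fderiv ℝ U p v) := by
  have hψ' : Continuous fun p => fderiv ℝ ψ p v :=
    (hψ.continuous_fderiv one_ne_zero).clm_apply continuous_const
  have hU' : Continuous fun p => fderiv ℝ U p v :=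
    (hU.continuous_fderiv one_ne_zero).clm_apply continuous_const
  have hi1 : Integrable fun p => inner ℂ (fderiv ℝ ψ p v) (U p) :=
    (hψ'.inner hU.continuous).integrable_of_hasCompactSupport
      ((hc.fderiv_apply ℝ v).mono fun p hp h => hp (by simp [h]))
  have hi2 : Integrable fun p => inner ℂ (ψ p) (fderiv ℝ U p v) :=
    (hψ.continuous.inner hU').integrable_of_hasCompactSupport
      (hc.mono fun p hp h => hp (by simp [h]))
  have hi3 : Integrable fun p => inner ℂ (ψ p) (U p) :=
    (hψ.continuous.inner hU.continuous).integrable_of_hasCompactSupport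
      (hc.mono fun p hp h => hp (by simp [h]))
  have hdψ := hψ.differentiable one_ne_zero
  have hdU := hU.differentiable one_ne_zero
  have hf : ∀ p, fderiv ℝ (fun q => inner ℂ (ψ q) (U q)) p v =
      inner ℂ (ψ p) (fderiv ℝ U p v) + inner ℂ (fderiv ℝ ψ p v) (U p) := fun p =>
    fderiv_inner_apply ℂ (hdψ p) (hdU p) v
  have h0 : ∫ p, fderiv ℝ (fun q => inner ℂ (ψ q) (U q)) p v = 0 := by
    have := integral_smul_fderiv_eq_neg_fderiv_smul_of_integrable (μ := volume) (v := v)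
      (f := fun _ : ℝ × Sp d => (1 : ℝ)) (g := fun q => inner ℂ (ψ q) (U q))
      (by simp) (by simpa [hf] using! hi2.add hi1) (by simpa using hi3)
      (fun _ _ => differentiableAt_const _) (fun p _ => (hdψ p).inner ℂ (hdU p))
    simpa using this
  simp only [hf] at h0
  rw [integral_add hi2 hi1] at h0
  linear_combination h0

lemma inner_toEuclideanLin_conjTranspose (M : Matrix (Fin N) (Fin N) ℂ) (v w : Vec N) :
    inner ℂ (Matrix.toEuclideanLin M.conjTranspose v) w =
      inner ℂ v (Matrix.toEuclideanLin M w) := by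
  rw [Matrix.toEuclideanLin_conjTranspose_eq_adjoint, LinearMap.adjoint_inner_left]

lemma contDiff_toEuclideanLin {E : Type*} [NormedAddCommGroup E] [NormedSpace ℝ E]
    {M : E → Matrix (Fin N) (Fin N) ℂ} {v : E → Vec N} (hM : ∀ i k, ContDiff ℝ 1 fun p => M p i k)
    (hv : ContDiff ℝ 1 v) : ContDiff ℝ 1 fun p => Matrix.toEuclideanLin (M p) (v p) := by
  refine (contDiff_piLp 2).2 fun i => ?_
  simp only [Matrix.toLpLin_apply, PiLp.toLp_apply, Matrix.mulVec, dotProduct]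
  exact ContDiff.sum fun k _ => (hM i k).mul ((contDiff_piLp 2).1 hv k)

lemma tsupport_adjoint_coeff_subset (A : Coeffs d N) (φ : ℝ × Sp d → Vec N) (j : Fin d) :
    tsupport (fun q => Matrix.toEuclideanLin (A j q).conjTranspose (φ q)) ⊆ tsupport φ :=
  closure_mono fun p hp h => hp (by simp [h])

lemma opAdj_eq_zero (A : Coeffs d N) {φ : ℝ × Sp d → Vec N} {p : ℝ × Sp d} (hp : p ∉ tsupport φ) :
    opAdj A φ p = 0 := by
  have h1 : fderiv ℝ φ p = 0 := by
    by_contra h; exact hp (support_fderiv_subset ℝ h)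
  have h2 : ∀ j, fderiv ℝ (fun q => Matrix.toEuclideanLin (A j q).conjTranspose (φ q)) p = 0 := by
    intro j
    by_contra h
    exact hp (tsupport_adjoint_coeff_subset A φ j (support_fderiv_subset ℝ h))
  simp [opAdj, dt, dx, h1, h2]

lemma contDiff_adjoint_coeff {A : Coeffs d N} (hA : ∀ j i k, ContDiff ℝ 1 fun p => A j p i k)
    {φ : ℝ × Sp d → Vec N} (hφ : ContDiff ℝ 1 φ) (j : Fin d) :
    ContDiff ℝ 1 fun q => Matrix.toEuclideanLin (A j q).conjTranspose (φ q) :=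
  contDiff_toEuclideanLin
    (fun i k => Complex.conjCLE.contDiff.comp (hA j k i)) hφ

lemma continuous_opAdj {A : Coeffs d N} (hA : ∀ j i k, ContDiff ℝ 1 fun p => A j p i k)
    {φ : ℝ × Sp d → Vec N} (hφ : ContDiff ℝ 1 φ) : Continuous (opAdj A φ) :=
  (continuous_dt hφ).neg.sub
    (continuous_finsetSum _ fun j _ => continuous_dx (contDiff_adjoint_coeff hA hφ j) j)

/-- `L*` is the formal adjoint of `L`. -/
lemma integral_inner_opAdj {A : Coeffs d N} (hA : ∀ j i k, ContDiff ℝ 1 fun p => A j p i k)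
    {φ : ℝ × Sp d → Vec N} (hφ : ContDiff ℝ 1 φ) (hc : HasCompactSupport φ) {U : ℝ × Sp d → Vec N}
    (hU : ContDiff ℝ 1 U) :
    ∫ p, inner ℂ (opAdj A φ p) (U p) = ∫ p, inner ℂ (φ p) (op A U p) := by
  have hcj : ∀ j, HasCompactSupport
      fun q => Matrix.toEuclideanLin (A j q).conjTranspose (φ q) := fun j =>
    hc.of_isClosed_subset (isClosed_tsupport _) (tsupport_adjoint_coeff_subset A φ j)
  have hψj := contDiff_adjoint_coeff hA hφ
  -- the four families of integrands are continuous with compact support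
  have hl : ∀ ψ : ℝ × Sp d → Vec N, ContDiff ℝ 1 ψ → HasCompactSupport ψ → ∀ v,
      Integrable fun p => inner ℂ (fderiv ℝ ψ p v) (U p) := fun ψ hψ hψc v =>
    (((hψ.continuous_fderiv one_ne_zero).clm_apply
      continuous_const).inner hU.continuous).integrable_of_hasCompactSupport
      ((hψc.fderiv_apply ℝ v).mono fun p hp h => hp (by simp [h]))
  have hr : ∀ ψ : ℝ × Sp d → Vec N, ContDiff ℝ 1 ψ → HasCompactSupport ψ → ∀ v,
      Integrable fun p => inner ℂ (ψ p) (fderiv ℝ U p v) := fun ψ hψ hψc v =>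
    (hψ.continuous.inner ((hU.continuous_fderiv one_ne_zero).clm_apply
      continuous_const)).integrable_of_hasCompactSupport
      (hψc.mono fun p hp h => hp (by simp [h]))
  simp only [opAdj, op, dt, dx, inner_sub_left, inner_neg_left, sum_inner, inner_add_right,
    inner_sum, ← inner_toEuclideanLin_conjTranspose]
  rw [integral_sub (hl φ hφ hc _).fun_neg
      (integrable_finsetSum _ fun j _ => hl _ (hψj j) (hcj j) _),
    integral_neg, integral_finsetSum _ fun j _ => hl _ (hψj j) (hcj j) _,
    integral_add (hr φ hφ hc _) (integrable_finsetSum _ fun j _ => hr _ (hψj j) (hcj j) _),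
    integral_finsetSum _ fun j _ => hr _ (hψj j) (hcj j) _,
    integral_inner_fderiv_left hφ hc hU]
  simp only [fun j v => integral_inner_fderiv_left (hψj j) (hcj j) hU v, Finset.sum_neg_distrib]
  ring

lemma IsSolution.of_classical {A : Coeffs d N} (hA : ∀ j i k, ContDiff ℝ 1 fun p => A j p i k)
    (T : ℝ) {U : ℝ × Sp d → Vec N} {u : ℝ → L2 d N} (hU : ContDiff ℝ 1 U)
    (hLU : ∀ p, op A U p = 0) (hu : Continuous u) (huU : ∀ t, u t =ᵐ[volume] fun x => U (t, x)) :
    IsSolution A T (u 0) 0 u where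
  cont := hu.continuousOn
  initial := rfl
  weak φ hφ hc hs := by
    have hφ1 : ContDiff ℝ 1 φ := hφ.of_le (by exact_mod_cast le_top)
    have hcont : Continuous fun p => inner ℂ (opAdj A φ p) (U p) :=
      (continuous_opAdj hA hφ1).inner hU.continuous
    have hint : Integrable fun p => inner ℂ (opAdj A φ p) (U p) :=
      hcont.integrable_of_hasCompactSupport
        (HasCompactSupport.intro hc fun p hp => by simp [opAdj_eq_zero A hp])
    have hR : ∀ t, ∫ x, inner ℂ (φ (t, x)) ((0 : ℝ → L2 d N) t x) = 0 := fun t => by simp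
    have hL : ∀ t, ∫ x, inner ℂ (opAdj A φ (t, x)) (u t x) =
        ∫ x, inner ℂ (opAdj A φ (t, x)) (U (t, x)) := fun t =>
      integral_congr_ae ((huU t).mono fun x hx => by simp only [hx])
    simp only [hR, hL, integral_zero]
    rw [setIntegral_eq_integral_of_forall_compl_eq_zero, ← integral_prod _ hint,
      ← Measure.volume_eq_prod, integral_inner_opAdj hA hφ1 hc hU]
    · simp [hLU]
    · intro t ht
      have : ∀ x, opAdj A φ (t, x) = 0 := fun x => opAdj_eq_zero A fun h => ht (hs h).1
      simp [this]

end weak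

lemma contDiff_exampleSystem {α : ℝ} (h0 : 0 < α) (j : Fin 2) (i k : Fin 3) :
    ContDiff ℝ 1 fun p => exampleSystem (fun x => |x| ^ α) j p i k := by
  have hx : ContDiff ℝ 1 fun p : ℝ × Sp 2 => p.2 0 := (coordX 0).contDiff
  have hc := continuous_abs_rpow h0
  have h1 : ContDiff ℝ 1 fun x : ℝ => x * |x| ^ α := by
    have hd := hasDerivAt_mul_abs_rpow h0
    rw [contDiff_one_iff_deriv, funext fun x => (hd x).deriv]
    exact ⟨fun x => (hd x).differentiableAt, by fun_prop⟩
  have h2 : ContDiff ℝ 1 fun x : ℝ => x * (1 + (|x| ^ α) ^ 2) := by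
    have hd := hasDerivAt_mul_one_add_abs_rpow_sq h0
    rw [contDiff_one_iff_deriv, funext fun x => (hd x).deriv]
    exact ⟨fun x => (hd x).differentiableAt, by fun_prop⟩
  have h1' := h1.comp hx
  have h2' := h2.comp hx
  refine Complex.ofRealCLM.contDiff.comp ?_
  fin_cases j <;> fin_cases i <;> fin_cases k <;>
    first | exact contDiff_const | exact hx | exact h1' | exact h1'.neg | exact h2'

theorem not_L2WellPosed {α T : ℝ} (h0 : 0 < α) (h1 : α < 1) (hT : 0 < T) :
    ¬ L2WellPosed (exampleSystem fun x => |x| ^ α) T := by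
  rintro ⟨C, hC⟩
  -- a solution whose norm is multiplied by at least `e ^ C > C` between the times `0` and `T`
  obtain ⟨U, u, hU, hLU, hu, huU, hu0, hgrow⟩ := exists_growing_solution h0 h1 (C / T)
  have hsol := IsSolution.of_classical (contDiff_exampleSystem h0) T hU hLU hu huU
  obtain ⟨v, -, hv, huniq⟩ := hC (u 0) 0 (integrable_zero _ _ _)
  have hTT : T ∈ Icc 0 T := ⟨hT.le, le_rfl⟩
  have h2 := hv T hTT
  rw [← huniq u hsol hTT] at h2
  have h3 := hgrow T hT.le
  rw [div_mul_cancel₀ _ hT.ne'] at h3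
  simp only [Pi.zero_apply, norm_zero, integral_zero, mul_zero, add_zero] at h2
  have h4 : 0 < ‖u 0‖ := norm_pos_iff.2 hu0
  nlinarith [Real.add_one_le_exp C]

end HypSys

theorem mainTheorem6 (α : ℝ) (hα0 : 0 < α) (hα1 : α < 1) :
    -- Hölder continuous microlocal symmetrizers of order `α`, over every strip `|x| < R`
    (∃ S : ℝ × HypSys.Sp 2 → HypSys.Sp 2 → Matrix (Fin 3) (Fin 3) ℂ, ∀ R : ℝ, 0 < R →
      HypSys.IsMicrolocalSymmetrizer (HypSys.exampleSystem fun x => |x| ^ α)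
        {p | |p.2 0| < R} S ∧
      HypSys.IsHolderSymbol α.toNNReal {p | |p.2 0| < R} S) ∧
    -- the Cauchy problem is not well posed in `L²`, on any time interval
    (∀ T : ℝ, 0 < T → ¬ HypSys.L2WellPosed (HypSys.exampleSystem fun x => |x| ^ α) T) ∧
    -- exact solutions of `L U = 0` with arbitrarily fast exponential growth of the `L²` norm
    (∀ μ : ℝ, 0 < μ → ∃ (U : ℝ × HypSys.Sp 2 → HypSys.Vec 3) (u : ℝ → HypSys.L2 2 3),
      ContDiff ℝ 1 U ∧
      (∀ p, HypSys.op (HypSys.exampleSystem fun x => |x| ^ α) U p = 0) ∧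
      Continuous u ∧
      (∀ t : ℝ, u t =ᵐ[volume] fun z => U (t, z)) ∧
      u 0 ≠ 0 ∧
      ∀ t : ℝ, 0 ≤ t → Real.exp (μ * t) * ‖u 0‖ ≤ ‖u t‖) ∧
    -- the local energy estimate fails near every point of `{x = 0}`
    (∀ Ω : Set (ℝ × HypSys.Sp 2), IsOpen Ω → (∃ p ∈ Ω, p.2 0 = 0) →
      ¬ HypSys.LocalL2Estimate (HypSys.exampleSystem fun x => |x| ^ α) Ω) := by
  refine ⟨⟨HypSys.exampleSymmetrizer α, fun R hR => ⟨HypSys.isMicrolocalSymmetrizer_example hα0 hR,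
      HypSys.isHolderSymbol_example hα0 hα1 hR⟩⟩, fun T hT => HypSys.not_L2WellPosed hα0 hα1 hT,
    fun μ _ => HypSys.exists_growing_solution hα0 hα1 μ,
    fun _ hΩ hp => HypSys.not_localL2Estimate hα0 hα1 hΩ hp⟩
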